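/- **Conventions.** A vocabulary $V$ is a countable set of constant, function and predicate symbols. A *real-valued $V$-structure* $\mathcal M$ is a non-empty set $M$ with interpretations of the constant and function symbols as usual and of each $n$-ary predicate symbol as a function $M^n\to[0,1]$. Continuous formulas are built from atomic formulas (without built-in equality) using all continuous functions $[0,1]^k\to[0,1]$ as connectives and the quantifiers $\inf$ and $\sup$; the truth value $0$ means "true", and a set of formulas is *satisfiable* in $\mathcal M$ if some tuple of $M$ gives all of them the value $0$. $\mathrm{Th}(\mathcal M)$ is the set of continuous sentences with value $0$ in $\mathcal M$, and $\mathcal M$ is a model of $T$ if all sentences of $T$ have value $0$ in $\mathcal M$. A *metric structure* is a real-valued structure in which some binary predicate symbol of $V$ is interpreted by a complete metric with respect to which every symbol of $V$ is uniformly continuous (with a given modulus); a *metric theory* is a set $T=\mathrm{Th}(\mathcal M)$ with $\mathcal M$ a metric structure. $\mathcal M$ is *$\kappa$-saturated* if for each $A\subseteq M$ with $|A|<\kappa$, each set of formulas with parameters from $A$ that is finitely satisfiable in $\mathcal M$ is satisfiable in $\mathcal M$. First order structures (with equality) are viewed as metric structures with the discrete metric and $\{0,1\}$-valued predicates, and a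 complete first order theory is viewed as the metric theory of its models. For an ultrafilter $\mathcal D$ over $I$, the *ultrapower* $\mathcal M_{\mathcal D}$ has universe $M^I$, with functions computed coordinatewise and predicates computed as $\mathcal D$-limits, modulo the identification of elements that cannot be distinguished by atomic formulas with parameters. For infinite $I$, $\mathcal D$ is *regular* if some $\mathcal X\subseteq\mathcal D$ with $|\mathcal X|=|I|$ is such that each $t\in I$ belongs to only finitely many $X\in\mathcal X$. Such a $\mathcal D$ *saturates* $T$ if $\mathcal M_{\mathcal D}$ is $|I|^+$-saturated for every model $\mathcal M$ of $T$. For theories $T,U$ with possibly different vocabularies, $T\trianglelefteq U$ means that each regular ultrafilter (over any infinite set) that saturates $U$ saturates $T$. A metric theory $T$ is *TP$_2$* if in some $\aleph_1$-saturated model $\mathcal M$ of $T$ there are a continuous formula $\varphi(\vec x,\vec y)$ and an array $\langle\vec b_{n,m}\rangle_{n,m\in\mathbb N}$ of $|\vec y|$-tuples such that (a) the sequences $\mathcal I_n=\langle\vec b_{n,m}\rangle_{m\in\mathbb N}$ are mutually indiscernible (each $\mathcal I_n$ is indiscernible over the union of the others); (b) the sequence of sequences $\langle\mathcal I_n\rangle_{n\in\mathbb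 N}$ is indiscernible; (c) for each $n$, $\{\varphi(\vec x,\vec b_{n,m}):m\in\mathbb N\}$ is not satisfiable in $\mathcal M$; (d) for each $f\colon\mathbb N\to\mathbb N$, $\{\varphi(\vec x,\vec b_{n,f(n)}):n\in\mathbb N\}$ is satisfiable in $\mathcal M$. Let $T_{feq}$ be the first order theory of parametrized equivalence relations: in the language with unary $P,Q$ and ternary $E$ it says that $P$ and $Q$ partition the universe, that $E(z,x,y)$ implies $P(z)\wedge Q(x)\wedge Q(y)$, and that for each $z\in P$, $E(z,\cdot,\cdot)$ is an equivalence relation on $Q$. Let $T^*_{feq}$ be its model completion. **Theorem.** $T_{feq}$ has a model completion $T^*_{feq}$, and $T^*_{feq}$ is $\trianglelefteq$-minimal among TP$_2$ metric theories. That is, $T^*_{feq}$ (viewed as a metric theory) is a TP$_2$ metric theory, and $T^*_{feq}\trianglelefteq T$ for every TP$_2$ metric theory $T$ with a countable vocabulary. -/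

import Mathlib

open FirstOrder Cardinal

universe u

namespace ContModel

/-! ### Vocabularies, continuous formulas and real-valued structures

A vocabulary is a `FirstOrder.Language.{0, 0}` (the constant symbols are the `0`-ary function
symbols); countability is a separate hypothesis. -/

/-- Continuous formulas in the vocabulary `L`, with free variables from `α` and from `Fin n`
(the latter are the ones that can still be quantified). They are built from atomic formulas
(there is no built-in equality) with all continuous functions `[0,1]ᵏ → [0,1]` as connectives
and the quantifiers `inf` and `sup`. -/
inductive CFormula (L : FirstOrder.Language.{0, 0}) (α : Type*) : ℕ → Type _
  | atom {n l : ℕ} (R : L.Relations l) (ts : Fin l → L.Term (α ⊕ Fin n)) : CFormula L α n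
  | conn {n k : ℕ} (c : C(Fin k → unitInterval, unitInterval))
      (φs : Fin k → CFormula L α n) : CFormula L α n
  | inf {n : ℕ} (φ : CFormula L α (n + 1)) : CFormula L α n
  | sup {n : ℕ} (φ : CFormula L α (n + 1)) : CFormula L α n

/-- Continuous sentences. -/
abbrev CSentence (L : FirstOrder.Language.{0, 0}) := CFormula L Empty 0

/-- Sets of continuous sentences. -/
abbrev CTheory (L : FirstOrder.Language.{0, 0}) := Set (CSentence L)

/-- Real-valued structures with vocabulary `L`. -/
structure RVStructure (L : FirstOrder.Language.{0, 0}) : Type (u + 1) where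
  /-- The universe set. -/
  carrier : Type u
  nonempty : Nonempty carrier
  /-- Interpretation of the function symbols. -/
  funMap : ∀ {n : ℕ}, L.Functions n → (Fin n → carrier) → carrier
  /-- Interpretation of the predicate symbols. -/
  relMap : ∀ {n : ℕ}, L.Relations n → (Fin n → carrier) → unitInterval

instance (L : FirstOrder.Language.{0, 0}) : CoeSort (RVStructure.{u} L) (Type u) := ⟨RVStructure.carrier⟩

instance {L : FirstOrder.Language.{0, 0}} (M : RVStructure.{u} L) : Nonempty M := M.nonempty

namespace RVStructure

variable {L : FirstOrder.Language.{0, 0}}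

/-- The value of a term under an assignment. -/
def termVal (M : RVStructure.{u} L) {α : Type*} (v : α → M) : L.Term α → M
  | .var i => v i
  | .func F ts => M.funMap F fun i => M.termVal v (ts i)

/-- The truth value of a continuous formula under an assignment (`0` is truth). -/
noncomputable def value (M : RVStructure.{u} L) {α : Type*} :
    ∀ {n : ℕ}, CFormula L α n → (α → M) → (Fin n → M) → unitInterval
  | _, .atom R ts, v, xs => M.relMap R fun i => M.termVal (Sum.elim v xs) (ts i)
  | _, .conn c φs, v, xs => c fun i => M.value (φs i) v xs
  | _, .inf φ, v, xs => ⨅ a : M, M.value φ v (Fin.snoc xs a)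
  | _, .sup φ, v, xs => ⨆ a : M, M.value φ v (Fin.snoc xs a)

/-- The truth value of a continuous formula all of whose free variables are in `α`. -/
noncomputable def val (M : RVStructure.{u} L) {α : Type*} (φ : CFormula L α 0) (v : α → M) :
    unitInterval :=
  M.value φ v Fin.elim0

/-- The set `Th(M)` of all continuous sentences with truth value `0` in `M`. -/
def theory (M : RVStructure.{u} L) : CTheory L :=
  {φ | M.val φ Empty.elim = 0}

/-- `M` is a model of `T`: all sentences of `T` have truth value `0` in `M`. -/
def IsModel (M : RVStructure.{u} L) (T : CTheory L) : Prop :=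
  ∀ φ ∈ T, M.val φ Empty.elim = 0

/-! ### Saturation -/

/-- A set `Γ` of formulas with parameters from `A ⊆ M` and with free variables `x₁, …, xₙ` is
satisfiable in `M`. (A formula with parameters is a formula in which each element of `A` stands as
a variable that is assigned to itself.) -/
def Satisfiable (M : RVStructure.{u} L) {A : Set M} {n : ℕ} (Γ : Set (CFormula L (A ⊕ Fin n) 0)) :
    Prop :=
  ∃ x : Fin n → M, ∀ φ ∈ Γ, M.val φ (Sum.elim (fun a : A => (a : M)) x) = 0

/-- `M` is `κ`-saturated: for every `A ⊆ M` with fewer than `κ` elements, every set of formulas with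
parameters from `A` that is finitely satisfiable in `M` is satisfiable in `M`. -/
def IsSaturated (M : RVStructure.{u} L) (κ : Cardinal.{u}) : Prop :=
  ∀ A : Set M, #A < κ → ∀ (n : ℕ) (Γ : Set (CFormula L (A ⊕ Fin n) 0)),
    (∀ Γ₀ ⊆ Γ, Γ₀.Finite → M.Satisfiable Γ₀) → M.Satisfiable Γ

/-! ### Reductions and ultrapowers -/

/-- Leibniz equality: `a` and `b` give the same truth value to each atomic formula `φ(x, z)`
(`x` is the variable `0`) for each tuple `c` of values of `z`. -/
def LeibnizEq (M : RVStructure.{u} L) (a b : M) : Prop :=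
  ∀ (k l : ℕ) (R : L.Relations l) (ts : Fin l → L.Term (Fin (k + 1))) (c : Fin k → M),
    M.relMap R (fun i => M.termVal (Fin.cons a c : Fin (k + 1) → M) (ts i)) =
      M.relMap R (fun i => M.termVal (Fin.cons b c : Fin (k + 1) → M) (ts i))

/-- Leibniz equality as an equivalence relation. -/
def leibnizSetoid (M : RVStructure.{u} L) : Setoid M where
  r := M.LeibnizEq
  iseqv :=
    { refl := fun _ _ _ _ _ _ => rfl
      symm := fun h k l R ts c => (h k l R ts c).symm
      trans := fun h₁ h₂ k l R ts c => (h₁ k l R ts c).trans (h₂ k l R ts c) }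

/-- The reduction of `M`: its universe is the set of classes of Leibniz equality. The symbols are
interpreted through representatives; `reduction_funMap` and `reduction_relMap` show that the choice
does not matter. -/
noncomputable def reduction (M : RVStructure.{u} L) : RVStructure.{u} L where
  carrier := Quotient M.leibnizSetoid
  nonempty := M.nonempty.map (Quotient.mk M.leibnizSetoid)
  funMap F xs := Quotient.mk M.leibnizSetoid (M.funMap F fun i => (xs i).out)
  relMap R xs := M.relMap R fun i => (xs i).out

theorem termVal_relabel (M : RVStructure.{u} L) {α β : Type*} (g : α → β) (v : β → M)
    (t : L.Term α) : M.termVal v (t.relabel g) = M.termVal (v ∘ g) t := by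
  induction t with
  | var i => rfl
  | func F ts ih => simp only [FirstOrder.Language.Term.relabel, termVal, ih]

theorem termVal_subst (M : RVStructure.{u} L) {α β : Type*} (s : α → L.Term β) (v : β → M)
    (t : L.Term α) : M.termVal v (t.subst s) = M.termVal (fun i => M.termVal v (s i)) t := by
  induction t with
  | var i => rfl
  | func F ts ih => simp only [FirstOrder.Language.Term.subst, termVal, ih]

theorem relMap_congr_leibniz (M : RVStructure.{u} L) {n l : ℕ} (R : L.Relations l)
    (ts : Fin l → L.Term (Fin n)) (v w : Fin n → M) (h : ∀ i, M.LeibnizEq (v i) (w i)) :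
    M.relMap R (fun i => M.termVal v (ts i)) = M.relMap R (fun i => M.termVal w (ts i)) := by
  classical
  have step : ∀ (v : Fin n → M) (j : Fin n) (a b : M), M.LeibnizEq a b →
      M.relMap R (fun i => M.termVal (Function.update v j a) (ts i)) =
        M.relMap R (fun i => M.termVal (Function.update v j b) (ts i)) := by
    intro v j a b hab
    have key : ∀ a : M, Function.update v j a =
        (Fin.cons a v : Fin (n + 1) → M) ∘ fun i => if i = j then 0 else i.succ := by
      intro a
      funext i
      by_cases hij : i = j
      · subst hij; simp
      · simp [hij]
    have := hab n l R (fun i => (ts i).relabel fun i => if i = j then 0 else i.succ) v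
    simpa only [termVal_relabel, ← key] using this
  have main : ∀ s : Finset (Fin n),
      M.relMap R (fun i => M.termVal v (ts i)) =
        M.relMap R (fun i => M.termVal (s.piecewise w v) (ts i)) := by
    intro s
    induction s using Finset.induction_on with
    | empty => simp
    | insert j s hj ih =>
      rw [ih, Finset.piecewise_insert, ← step _ j _ _ (h j)]
      congr 1
      funext i
      congr 1
      rw [Function.eq_update_iff]
      exact ⟨by simp [hj], fun _ _ => rfl⟩
  simpa using main Finset.univ

theorem reduction_relMap (M : RVStructure.{u} L) {n : ℕ} (R : L.Relations n) (a : Fin n → M) :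
    M.reduction.relMap R (fun i => Quotient.mk M.leibnizSetoid (a i)) = M.relMap R a :=
  M.relMap_congr_leibniz R (fun i => .var i) _ a fun i => Quotient.mk_out (s := M.leibnizSetoid) (a i)

theorem reduction_funMap (M : RVStructure.{u} L) {n : ℕ} (F : L.Functions n) (a : Fin n → M) :
    M.reduction.funMap F (fun i => Quotient.mk M.leibnizSetoid (a i)) =
      Quotient.mk M.leibnizSetoid (M.funMap F a) := by
  apply Quotient.sound
  intro k l R ts c
  let s : Fin (k + 1) → L.Term (Fin (n + k)) :=
    Fin.cons (.func F fun i => .var (Fin.castAdd k i)) fun i => .var (Fin.natAdd n i)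
  have hs : ∀ a : Fin n → M, (fun i => M.termVal (Fin.append a c) (s i)) =
      (Fin.cons (M.funMap F a) c : Fin (k + 1) → M) := by
    intro a
    funext i
    refine Fin.cases ?_ (fun i => ?_) i
    · simp [s, termVal]
    · simp [s, termVal]
  have := M.relMap_congr_leibniz R (fun i => (ts i).subst s)
    (Fin.append (fun i => (Quotient.mk M.leibnizSetoid (a i)).out) c) (Fin.append a c) (by
      intro i
      refine Fin.addCases (fun i => ?_) (fun i => ?_) i
      · rw [Fin.append_left, Fin.append_left]
        exact Quotient.mk_out (s := M.leibnizSetoid) (a i)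
      · rw [Fin.append_right, Fin.append_right]
        exact M.leibnizSetoid.refl (c i))
  simpa only [termVal_subst, hs] using this

/-- The limit of `r : I → [0,1]` along an ultrafilter `D`. -/
noncomputable def ulim {I : Type*} (D : Ultrafilter I) (r : I → unitInterval) : unitInterval :=
  (D.map r).lim

theorem tendsto_ulim {I : Type*} (D : Ultrafilter I) (r : I → unitInterval) :
    Filter.Tendsto r D (nhds (ulim D r)) :=
  (D.map r).le_nhds_lim

/-- The pre-ultrapower of `M` modulo `D`, on the full power `M^I`. -/
noncomputable def preUltrapower (M : RVStructure.{u} L) {I : Type u} (D : Ultrafilter I) :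
    RVStructure.{u} L where
  carrier := I → M
  nonempty := M.nonempty.map fun a _ => a
  funMap F xs := fun t => M.funMap F fun i => xs i t
  relMap R xs := ulim D fun t => M.relMap R fun i => xs i t

/-- The ultrapower of `M` modulo `D`. -/
noncomputable def ultrapower (M : RVStructure.{u} L) {I : Type u} (D : Ultrafilter I) :
    RVStructure.{u} L :=
  (M.preUltrapower D).reduction

end RVStructure

/-! ### Metric structures and metric theories -/

/-- A metric signature over the vocabulary `L`: a distance predicate, and a modulus of uniform
continuity for each function symbol and each predicate symbol. -/
structure MetricSignature (L : FirstOrder.Language.{0, 0}) where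
  /-- The distance predicate. -/
  dist : L.Relations 2
  /-- Moduli of the function symbols. -/
  funMod : ∀ {n : ℕ}, L.Functions n → ℝ → ℝ
  /-- Moduli of the predicate symbols. -/
  relMod : ∀ {n : ℕ}, L.Relations n → ℝ → ℝ
  funMod_pos : ∀ {n : ℕ} (F : L.Functions n) (ε : ℝ), 0 < ε → 0 < funMod F ε
  relMod_pos : ∀ {n : ℕ} (R : L.Relations n) (ε : ℝ), 0 < ε → 0 < relMod R ε

namespace MetricSignature

variable {L : FirstOrder.Language.{0, 0}} (S : MetricSignature L) (M : RVStructure.{u} L)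

/-- The interpretation of the distance predicate, as a real number. -/
def d (a b : M) : ℝ := (M.relMap S.dist ![a, b] : ℝ)

/-- `M` is a premetric structure with the metric signature `S`. -/
structure IsPremetric : Prop where
  d_self : ∀ a : M, S.d M a a = 0
  d_comm : ∀ a b : M, S.d M a b = S.d M b a
  d_triangle : ∀ a b c : M, S.d M a c ≤ S.d M a b + S.d M b c
  fun_modulus : ∀ {n : ℕ} (F : L.Functions n) (ε : ℝ), 0 < ε → ∀ x y : Fin n → M,
    (∀ i, S.d M (x i) (y i) < S.funMod F ε) → S.d M (M.funMap F x) (M.funMap F y) ≤ ε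
  rel_modulus : ∀ {n : ℕ} (R : L.Relations n) (ε : ℝ), 0 < ε → ∀ x y : Fin n → M,
    (∀ i, S.d M (x i) (y i) < S.relMod R ε) →
      |(M.relMap R x : ℝ) - (M.relMap R y : ℝ)| ≤ ε

/-- `M` is a metric structure with the metric signature `S`: the interpretation of the distance
predicate is a complete metric. -/
structure IsMetric : Prop extends S.IsPremetric M where
  eq_of_d_eq_zero : ∀ a b : M, S.d M a b = 0 → a = b
  complete : ∀ s : ℕ → M,
    (∀ ε : ℝ, 0 < ε → ∃ N : ℕ, ∀ m ≥ N, ∀ n ≥ N, S.d M (s m) (s n) < ε) →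
      ∃ a : M, ∀ ε : ℝ, 0 < ε → ∃ N : ℕ, ∀ n ≥ N, S.d M (s n) a < ε

end MetricSignature

/-- `T` is a metric theory: the theory of a metric structure (for some metric signature). -/
def IsMetricTheory {L : FirstOrder.Language.{0, 0}} (T : CTheory L) : Prop :=
  ∃ (S : MetricSignature L) (M : RVStructure.{u} L), S.IsMetric M ∧ T = M.theory

/-! ### Regular ultrafilters and the order `⊴` -/

/-- `D` is regular: it has a subset of cardinality `#I` such that each point of `I` is in only
finitely many members of it. -/
def IsRegularUltrafilter {I : Type u} (D : Ultrafilter I) : Prop :=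
  ∃ X : Set (Set I), (∀ A ∈ X, A ∈ D) ∧ #X = #I ∧ ∀ t : I, {A ∈ X | t ∈ A}.Finite

/-- `D` saturates `T`: for each model `M` of `T`, the ultrapower of `M` modulo `D` is
`λ⁺`-saturated, where `λ` is the cardinality of the index set. -/
def Saturates {L : FirstOrder.Language.{0, 0}} {I : Type u} (D : Ultrafilter I) (T : CTheory L) : Prop :=
  ∀ M : RVStructure.{u} L, M.IsModel T → (M.ultrapower D).IsSaturated (Order.succ #I)

/-- `T ⊴ U`: each regular ultrafilter (over any infinite set) that saturates `U` saturates `T`. -/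
def TriangleLE {L L' : FirstOrder.Language.{0, 0}} (T : CTheory L) (U : CTheory L') : Prop :=
  ∀ (I : Type u) [Infinite I] (D : Ultrafilter I), IsRegularUltrafilter D →
    Saturates D U → Saturates D T

/-! ### The tree property of the second kind -/

section Indiscernibility

variable {L : FirstOrder.Language.{0, 0}} (M : RVStructure.{u} L) {p : ℕ}

/-- A sequence of `p`-tuples is indiscernible over `B`: any two increasing finite subsequences of
the same length have the same type over `B`. -/
def IsIndiscernibleOver (B : Set M) (b : ℕ → Fin p → M) : Prop :=
  ∀ (k : ℕ) (i j : Fin k → ℕ), StrictMono i → StrictMono j →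
    ∀ ψ : CFormula L (B ⊕ (Fin k × Fin p)) 0,
      M.val ψ (Sum.elim (fun a : B => (a : M)) fun x => b (i x.1) x.2) =
        M.val ψ (Sum.elim (fun a : B => (a : M)) fun x => b (j x.1) x.2)

/-- The sequences `b 0, b 1, …` are mutually indiscernible: each of them is indiscernible over the
set of all entries of all the others. -/
def MutuallyIndiscernible (b : ℕ → ℕ → Fin p → M) : Prop :=
  ∀ n : ℕ, IsIndiscernibleOver M {a | ∃ n' m r, n' ≠ n ∧ a = b n' m r} (b n)

/-- The sequence `b 0, b 1, …` of sequences is indiscernible. -/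
def SeqIndiscernible (b : ℕ → ℕ → Fin p → M) : Prop :=
  ∀ (k : ℕ) (i j : Fin k → ℕ), StrictMono i → StrictMono j →
    ∀ ψ : CFormula L (Fin k × ℕ × Fin p) 0,
      M.val ψ (fun x => b (i x.1) x.2.1 x.2.2) = M.val ψ (fun x => b (j x.1) x.2.1 x.2.2)

end Indiscernibility

/-- `T` has the tree property of the second kind. -/
def IsTP₂ {L : FirstOrder.Language.{0, 0}} (T : CTheory L) : Prop :=
  ∃ M : RVStructure.{u} L, M.IsModel T ∧ M.IsSaturated ℵ₁ ∧
    ∃ (q p : ℕ) (φ : CFormula L (Fin q ⊕ Fin p) 0) (b : ℕ → ℕ → Fin p → M),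
      MutuallyIndiscernible M b ∧ SeqIndiscernible M b ∧
      (∀ n : ℕ, ¬ ∃ x : Fin q → M, ∀ m : ℕ, M.val φ (Sum.elim x (b n m)) = 0) ∧
      (∀ f : ℕ → ℕ, ∃ x : Fin q → M, ∀ n : ℕ, M.val φ (Sum.elim x (b n (f n))) = 0)

/-! ### First order theories as metric theories -/

/-- The added symbol for the discrete metric. -/
inductive DistSymbol : ℕ → Type
  | dist : DistSymbol 2

/-- The vocabulary `L` together with a distance predicate, which plays the role of equality. -/
abbrev withDist (L : FirstOrder.Language.{0, 0}) : FirstOrder.Language.{0, 0} where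
  Functions := L.Functions
  Relations n := L.Relations n ⊕ DistSymbol n

open Classical in
/-- A first order structure as a two-valued metric structure with the discrete metric
(`0` is truth). -/
noncomputable def discreteStructure (L : FirstOrder.Language.{0, 0}) (K : Type u) [L.Structure K]
    [hK : Nonempty K] : RVStructure.{u} (withDist L) where
  carrier := K
  nonempty := hK
  funMap F xs := FirstOrder.Language.Structure.funMap (show L.Functions _ from F) xs
  relMap := fun {n} R xs => match n, R, xs with
    | _, Sum.inl R, xs => if FirstOrder.Language.Structure.RelMap R xs then 0 else 1
    | _, Sum.inr .dist, xs => if xs 0 = xs 1 then 0 else 1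

/-- The continuous theory of the models of the first order theory `T`, as discrete metric
structures. If `T` is complete then this is the theory of each one of its models. -/
def continuousTheory {L : FirstOrder.Language.{0, 0}} (T : L.Theory) : CTheory (withDist L) :=
  {φ | ∀ (K : Type u) [L.Structure K] [Nonempty K], K ⊨ T →
    (discreteStructure L K).val φ Empty.elim = 0}

/-- `T'` is a model completion of `T`: each model of `T'` is a model of `T`, each model of `T`
embeds in a model of `T'`, and for each model `K` of `T`, the union of `T'` and the diagram of `K`
is complete. -/
structure IsModelCompletion {L : FirstOrder.Language.{0, 0}} (T T' : L.Theory) : Prop where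
  models : ∀ (K : Type u) [L.Structure K] [Nonempty K], K ⊨ T' → K ⊨ T
  embeds : ∀ (K : Type u) [L.Structure K] [Nonempty K], K ⊨ T →
    ∃ (N : Type u) (_ : L.Structure N), N ⊨ T' ∧ Nonempty (K ↪[L] N)
  complete : ∀ (K : Type u) [L.Structure K] [Nonempty K], K ⊨ T →
    ∀ (N₁ N₂ : Type u) [L.Structure N₁] [L.Structure N₂], N₁ ⊨ T' → N₂ ⊨ T' →
      ∀ (f₁ : K ↪[L] N₁) (f₂ : K ↪[L] N₂) (φ : L.Formula K), φ.Realize f₁ ↔ φ.Realize f₂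

/-! ### Parametrized equivalence relations -/

/-- The relation symbols: `P` (parameters), `Q` (objects), and `E` (`E(z, x, y)` says that `x` and
`y` are equivalent for the parameter `z`). -/
inductive FeqRel : ℕ → Type
  | P : FeqRel 1
  | Q : FeqRel 1
  | E : FeqRel 3

/-- The language of parametrized equivalence relations. -/
abbrev feqLang : FirstOrder.Language.{0, 0} := ⟨fun _ => Empty, FeqRel⟩

/-- `P x`. -/
def feqP {n : ℕ} (x : feqLang.Term (Empty ⊕ Fin n)) : feqLang.BoundedFormula Empty n :=
  FirstOrder.Language.Relations.boundedFormula (L := feqLang) FeqRel.P ![x]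

/-- `Q x`. -/
def feqQ {n : ℕ} (x : feqLang.Term (Empty ⊕ Fin n)) : feqLang.BoundedFormula Empty n :=
  FirstOrder.Language.Relations.boundedFormula (L := feqLang) FeqRel.Q ![x]

/-- `E(z, x, y)`. -/
def feqE {n : ℕ} (z x y : feqLang.Term (Empty ⊕ Fin n)) : feqLang.BoundedFormula Empty n :=
  FirstOrder.Language.Relations.boundedFormula (L := feqLang) FeqRel.E ![z, x, y]

open Language in
/-- The first order theory of parametrized equivalence relations: `P` and `Q` partition the
universe, and for each `z` in `P`, `E(z, ·, ·)` is an equivalence relation on `Q`. -/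
def feqTheory : feqLang.Theory :=
  { ∀' (feqP (&0) ⊔ feqQ (&0)),
    ∀' ∼(feqP (&0) ⊓ feqQ (&0)),
    ∀' ∀' ∀' (feqE (&0) (&1) (&2) ⟹ (feqP (&0) ⊓ (feqQ (&1) ⊓ feqQ (&2)))),
    ∀' ∀' (feqP (&0) ⟹ feqQ (&1) ⟹ feqE (&0) (&1) (&1)),
    ∀' ∀' ∀' (feqE (&0) (&1) (&2) ⟹ feqE (&0) (&2) (&1)),
    ∀' ∀' ∀' ∀' (feqE (&0) (&1) (&2) ⟹ feqE (&0) (&2) (&3) ⟹ feqE (&0) (&1) (&3)) }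

end ContModel

/-!
# Minimality of the model completion of parametrized equivalence relations

Call a regular ultrafilter `D` over `I` *good for equality* if any `#I` functions on `I` that are
pairwise distinct modulo `D` can be restricted to sets in `D` so that they are pairwise distinct at
each point. The theorem says that `D` saturates `T*_feq` whenever it saturates some `TP₂` theory,
and goodness for equality is the property in between.

*From `TP₂` to goodness for equality* (`IsTP₂.goodForEquality`). In an array that witnesses `TP₂`,
let `r` be maximal such that `r` elements of each row are together consistent with `φ`. By
indiscernibility and `ℵ₁`-saturation there is an `N` such that `r + 1` elements in each of `N` rows
are inconsistent, with a uniform gap (`exists_consistency_pattern`). Given the functions `g α`, ask in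
the ultrapower for a realization of the instances of `φ` at `r` elements of each of `N` rows, where
at `t` the block of rows is chosen by `g α t` and the columns are chosen by `α`. This is finitely
satisfiable because distinct functions choose distinct blocks almost everywhere. If `α` and `β`
chose the same block at a point where a realization satisfies both groups of instances up to the
gap, at least `r + 1` columns of this block would be used.

*From goodness for equality to saturation* (`GoodForEquality.saturates`). The models of `T*_feq` are
the generic parametrized equivalence relations (`Feq.IsGeneric`): finitely many objects can be
partitioned by a new parameter in any way, and a new object can be put into any classes of finitely
many distinct parameters. Both kinds of requirements only need that the elements involved are
distinct, so in an ultrapower by an ultrafilter that is good for equality they can be met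
coordinatewise for `#I` elements at once (`IsGeneric.germ`). A back-and-forth argument
(`value_eq_of_isPartIso`) shows that genericity for sets of size less than `κ` implies
`κ`-saturation (`Represents.isSaturated`).

*The model completion.* Any parametrized equivalence relation has a generic extension
(`GenericExt`), even for countable sets of requirements. Genericity for finite sets is a first order
property that is preserved by elementary substructures, so it axiomatizes the model completion and
holds in all models of any model completion. The extension of a suitable countable array is an
`ℵ₁`-saturated structure that witnesses `TP₂`.

Models of the continuous theory need not be discrete structures a priori; the truth values of atomic
formulas at tuples in them are limits of, hence equal to, truth values in models of `T*_feq`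
(`exists_represents_of_isModel`).
-/

namespace ContModel

open Filter Topology

/-! ### Operations on continuous formulas -/

namespace CFormula

variable {L : FirstOrder.Language.{0, 0}}

/-- Renaming of free variables. -/
def relabel {α β : Type*} (g : α → β) : ∀ {n : ℕ}, CFormula L α n → CFormula L β n
  | _, .atom R ts => .atom R fun i => (ts i).relabel (Sum.map g id)
  | _, .conn c φs => .conn c fun i => (φs i).relabel g
  | _, .inf φ => .inf (φ.relabel g)
  | _, .sup φ => .sup (φ.relabel g)

/-- The substitution of variables that `bindVars` performs in a term. -/
def bindMap {α β : Type*} {q : ℕ} (g : β → α ⊕ Fin q) (n : ℕ) : β ⊕ Fin n → α ⊕ Fin (q + n) :=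
  Sum.elim (fun b => (g b).map id (Fin.castAdd n)) fun i => .inr (Fin.natAdd q i)

/-- Renaming of free variables in which some of the new names are variables that can be
quantified. -/
def bindVars {α β : Type*} {q : ℕ} (g : β → α ⊕ Fin q) :
    ∀ {n : ℕ}, CFormula L β n → CFormula L α (q + n)
  | n, .atom R ts => .atom R fun i => (ts i).relabel (bindMap g n)
  | _, .conn c φs => .conn c fun i => (φs i).bindVars g
  | _, .inf φ => .inf (φ.bindVars g)
  | _, .sup φ => .sup (φ.bindVars g)

/-- The infimum over all the quantifiable variables. -/
def infs {α : Type*} : ∀ {n : ℕ}, CFormula L α n → CFormula L α 0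
  | 0, φ => φ
  | _ + 1, φ => infs (.inf φ)

/-- The supremum over all the quantifiable variables. -/
def sups {α : Type*} : ∀ {n : ℕ}, CFormula L α n → CFormula L α 0
  | 0, φ => φ
  | _ + 1, φ => sups (.sup φ)

/-- The formula `φ ∸ ε`. -/
noncomputable def tsub {α : Type*} {n : ℕ} (φ : CFormula L α n) (ε : ℝ) : CFormula L α n :=
  .conn ⟨fun v : Fin 1 → unitInterval => Set.projIcc 0 1 zero_le_one ((v 0 : ℝ) - ε), by fun_prop⟩
    fun _ => φ

/-- A connective applied to a finite family of formulas. -/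
noncomputable def comb {α J : Type*} [Fintype J] {n : ℕ}
    (c : C(J → unitInterval, unitInterval)) (φs : J → CFormula L α n) : CFormula L α n :=
  .conn (c.comp ⟨fun v j => v (Fintype.equivFin J j), by fun_prop⟩)
    fun i => φs ((Fintype.equivFin J).symm i)

open Classical in
/-- The free variables of a formula (other than those that can be quantified). -/
noncomputable def freeVars {α : Type*} : ∀ {n : ℕ}, CFormula L α n → Finset α
  | _, .atom _ ts => Finset.univ.biUnion fun i => (ts i).varFinsetLeft
  | _, .conn _ φs => Finset.univ.biUnion fun i => (φs i).freeVars
  | _, .inf φ => φ.freeVars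
  | _, .sup φ => φ.freeVars

end CFormula

namespace RVStructure

variable {L : FirstOrder.Language.{0, 0}}

theorem value_eq_val (M : RVStructure.{u} L) {α : Type*} (φ : CFormula L α 0) (v : α → M)
    (xs : Fin 0 → M) : M.value φ v xs = M.val φ v :=
  congrArg (M.value φ v) (Subsingleton.elim (α := Fin 0 → M) _ _)

theorem value_relabel (M : RVStructure.{u} L) {α β : Type*} (g : α → β) {n : ℕ}
    (φ : CFormula L α n) (v : β → M) (xs : Fin n → M) :
    M.value (φ.relabel g) v xs = M.value φ (v ∘ g) xs := by
  induction φ with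
  | atom R ts =>
    simp only [CFormula.relabel, value, termVal_relabel]
    congr 1; funext i; congr 1; funext j; rcases j with j | j <;> rfl
  | conn c φs ih => simp only [CFormula.relabel, value, ih]
  | inf φ ih => simp only [CFormula.relabel, value, ih]
  | sup φ ih => simp only [CFormula.relabel, value, ih]

theorem val_relabel (M : RVStructure.{u} L) {α β : Type*} (g : α → β)
    (φ : CFormula L α 0) (v : β → M) : M.val (φ.relabel g) v = M.val φ (v ∘ g) :=
  M.value_relabel g φ v _

theorem value_bindVars (M : RVStructure.{u} L) {α β : Type*} {q : ℕ} (g : β → α ⊕ Fin q) {n : ℕ}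
    (φ : CFormula L β n) (v : α → M) (ys : Fin q → M) (xs : Fin n → M) :
    M.value (φ.bindVars g) v (Fin.append ys xs) = M.value φ (Sum.elim v ys ∘ g) xs := by
  induction φ with
  | atom R ts =>
    simp only [CFormula.bindVars, value, termVal_relabel]
    congr 1; funext i; congr 1; funext j
    rcases j with j | j
    · simp only [CFormula.bindMap, Function.comp, Sum.elim_inl]
      rcases g j with k | k <;> simp
    · simp [CFormula.bindMap]
  | conn c φs ih => simp only [CFormula.bindVars, value, ih]
  | inf φ ih => simp only [CFormula.bindVars, value, ← Fin.append_snoc, ih]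
  | sup φ ih => simp only [CFormula.bindVars, value, ← Fin.append_snoc, ih]

theorem val_infs (M : RVStructure.{u} L) {α : Type*} {n : ℕ} (φ : CFormula L α n) (v : α → M) :
    M.val φ.infs v = ⨅ xs : Fin n → M, M.value φ v xs := by
  induction n with
  | zero =>
    rw [iInf_unique]
    exact congrArg (M.value φ v) (Subsingleton.elim (α := Fin 0 → M) _ _)
  | succ n ih =>
    rw [CFormula.infs, ih]
    apply le_antisymm
    · refine le_iInf fun xs => (iInf_le _ (Fin.init xs)).trans ?_
      refine (iInf_le _ (xs (Fin.last n))).trans ?_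
      rw [Fin.snoc_init_self]
    · exact le_iInf fun xs => le_iInf fun a => iInf_le (fun xs => M.value φ v xs) _

theorem val_sups (M : RVStructure.{u} L) {α : Type*} {n : ℕ} (φ : CFormula L α n) (v : α → M) :
    M.val φ.sups v = ⨆ xs : Fin n → M, M.value φ v xs := by
  induction n with
  | zero =>
    rw [iSup_unique]
    exact congrArg (M.value φ v) (Subsingleton.elim (α := Fin 0 → M) _ _)
  | succ n ih =>
    rw [CFormula.sups, ih]
    apply le_antisymm
    · exact iSup_le fun xs => iSup_le fun a => le_iSup (fun xs => M.value φ v xs) _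
    · refine iSup_le fun xs => le_trans ?_ (le_iSup _ (Fin.init xs))
      refine le_trans ?_ (le_iSup _ (xs (Fin.last n)))
      rw [Fin.snoc_init_self]

theorem val_sups_eq_zero (M : RVStructure.{u} L) {α : Type*} {n : ℕ} (φ : CFormula L α n)
    (v : α → M) : M.val φ.sups v = 0 ↔ ∀ xs : Fin n → M, M.value φ v xs = 0 := by
  rw [val_sups]
  exact iSup_eq_bot

theorem value_tsub_eq_zero (M : RVStructure.{u} L) {α : Type*} {n : ℕ} (φ : CFormula L α n) (ε : ℝ)
    (v : α → M) (xs : Fin n → M) :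
    M.value (φ.tsub ε) v xs = 0 ↔ (M.value φ v xs : ℝ) ≤ ε := by
  simp only [CFormula.tsub, value, ContinuousMap.coe_mk]
  rw [show (0 : unitInterval) = ⟨0, Set.left_mem_Icc.2 zero_le_one⟩ from rfl,
    Set.projIcc_eq_left zero_lt_one, sub_nonpos]

theorem value_comb (M : RVStructure.{u} L) {α J : Type*} [Fintype J] {n : ℕ}
    (c : C(J → unitInterval, unitInterval)) (φs : J → CFormula L α n) (v : α → M)
    (xs : Fin n → M) :
    M.value (CFormula.comb c φs) v xs = c fun j => M.value (φs j) v xs := by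
  simp only [CFormula.comb, value, ContinuousMap.comp_apply, ContinuousMap.coe_mk,
    Equiv.symm_apply_apply]

/-! ### Invariance of truth values, and the theorem of Łoś -/

theorem termVal_comp (M N : RVStructure.{u} L) (h : M → N)
    (hf : ∀ {l : ℕ} (F : L.Functions l) (a : Fin l → M), h (M.funMap F a) = N.funMap F (h ∘ a))
    {β : Type*} (w : β → M) (t : L.Term β) : h (M.termVal w t) = N.termVal (h ∘ w) t := by
  induction t with
  | var i => rfl
  | func F ts ih =>
    simp only [termVal, hf]
    congr 1; funext i; exact ih i

/-- Truth values are preserved by maps onto that preserve the interpretation of all symbols. -/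
theorem value_of_surjective (M N : RVStructure.{u} L) (h : M → N) (hs : Function.Surjective h)
    (hf : ∀ {l : ℕ} (F : L.Functions l) (a : Fin l → M), h (M.funMap F a) = N.funMap F (h ∘ a))
    (hr : ∀ {l : ℕ} (R : L.Relations l) (a : Fin l → M), M.relMap R a = N.relMap R (h ∘ a))
    {α : Type*} {n : ℕ} (φ : CFormula L α n) (v : α → M) (xs : Fin n → M) :
    M.value φ v xs = N.value φ (h ∘ v) (h ∘ xs) := by
  induction φ with
  | atom R ts =>
    simp only [value, hr]
    congr 1; funext i
    simp only [Function.comp_apply, M.termVal_comp N h hf, Sum.comp_elim]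
  | conn c φs ih => simp only [value, ih]
  | inf φ ih =>
    simp only [value, ih, Fin.comp_snoc]
    exact hs.iInf_comp fun a => N.value φ (h ∘ v) (Fin.snoc (h ∘ xs) a)
  | sup φ ih =>
    simp only [value, ih, Fin.comp_snoc]
    exact hs.iSup_comp fun a => N.value φ (h ∘ v) (Fin.snoc (h ∘ xs) a)

theorem ulim_eq {I : Type*} {D : Ultrafilter I} {r : I → unitInterval} {a : unitInterval}
    (h : Tendsto r D (𝓝 a)) : ulim D r = a :=
  tendsto_nhds_unique (tendsto_ulim D r) h

/-- The value of an element of the pre-ultrapower at a point of the index set. -/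
def coord (M : RVStructure.{u} L) {I : Type u} (D : Ultrafilter I) (t : I) :
    M.preUltrapower D → M := fun f => f t

theorem termVal_preUltrapower (M : RVStructure.{u} L) {I : Type u} (D : Ultrafilter I)
    {β : Type*} (w : β → M.preUltrapower D) (s : L.Term β) (t : I) :
    M.coord D t ((M.preUltrapower D).termVal w s) = M.termVal (M.coord D t ∘ w) s :=
  termVal_comp _ M (M.coord D t) (fun _ _ => rfl) w s

theorem value_preUltrapower (M : RVStructure.{u} L) {I : Type u} (D : Ultrafilter I)
    {α : Type*} {n : ℕ} (φ : CFormula L α n) (v : α → M.preUltrapower D)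
    (xs : Fin n → M.preUltrapower D) :
    (M.preUltrapower D).value φ v xs =
      ulim D fun t => M.value φ (M.coord D t ∘ v) (M.coord D t ∘ xs) := by
  induction φ with
  | atom R ts =>
    simp only [value, ← Sum.comp_elim, ← termVal_preUltrapower]
    rfl
  | conn c φs ih =>
    simp only [value, ih]
    refine (ulim_eq ?_).symm
    exact (c.continuous.tendsto _).comp (tendsto_pi_nhds.2 fun i => tendsto_ulim D _)
  | inf φ ih =>
    simp only [value, ih, Fin.comp_snoc]
    apply le_antisymm
    · refine le_of_forall_gt_imp_ge_of_dense fun c hc => ?_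
      have hev := (tendsto_ulim D _).eventually_lt_const hc
      -- a point at which the infimum is almost attained, wherever it is below `c`
      have : ∀ t, ∃ a : M,
          (⨅ a : M, M.value φ (M.coord D t ∘ v) (Fin.snoc (M.coord D t ∘ xs) a)) < c →
            M.value φ (M.coord D t ∘ v) (Fin.snoc (M.coord D t ∘ xs) a) < c := by
        intro t
        by_cases h :
            (⨅ a : M, M.value φ (M.coord D t ∘ v) (Fin.snoc (M.coord D t ∘ xs) a)) < c
        · obtain ⟨a, ha⟩ := iInf_lt_iff.1 h
          exact ⟨a, fun _ => ha⟩
        · exact ⟨Classical.arbitrary M, fun h' => absurd h' h⟩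
      choose a ha using this
      refine le_trans (iInf_le _ (show M.preUltrapower D from a)) ?_
      exact le_of_tendsto (tendsto_ulim D _) (hev.mono fun t h => (ha t h).le)
    · refine le_iInf fun a => ?_
      exact le_of_tendsto_of_tendsto' (tendsto_ulim D _) (tendsto_ulim D _)
        fun t => iInf_le _ (M.coord D t a)
  | sup φ ih =>
    simp only [value, ih, Fin.comp_snoc]
    apply le_antisymm
    · refine iSup_le fun a => ?_
      exact le_of_tendsto_of_tendsto' (tendsto_ulim D _) (tendsto_ulim D _)
        fun t => le_iSup (fun a => M.value φ _ (Fin.snoc _ a)) (M.coord D t a)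
    · refine le_of_forall_lt_imp_le_of_dense fun c hc => ?_
      have hev := (tendsto_ulim D _).eventually_const_lt hc
      have : ∀ t, ∃ a : M,
          c < (⨆ a : M, M.value φ (M.coord D t ∘ v) (Fin.snoc (M.coord D t ∘ xs) a)) →
            c < M.value φ (M.coord D t ∘ v) (Fin.snoc (M.coord D t ∘ xs) a) := by
        intro t
        by_cases h :
            c < (⨆ a : M, M.value φ (M.coord D t ∘ v) (Fin.snoc (M.coord D t ∘ xs) a))
        · obtain ⟨a, ha⟩ := lt_iSup_iff.1 h
          exact ⟨a, fun _ => ha⟩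
        · exact ⟨Classical.arbitrary M, fun h' => absurd h' h⟩
      choose a ha using this
      refine le_trans ?_ (le_iSup _ (show M.preUltrapower D from a))
      exact ge_of_tendsto (tendsto_ulim D _) (hev.mono fun t h => (ha t h).le)

/-- The class of `f` in the ultrapower. -/
noncomputable def toUltrapower (M : RVStructure.{u} L) {I : Type u} (D : Ultrafilter I)
    (f : I → M) : M.ultrapower D :=
  Quotient.mk (M.preUltrapower D).leibnizSetoid f

theorem toUltrapower_surjective (M : RVStructure.{u} L) {I : Type u} (D : Ultrafilter I) :
    Function.Surjective (M.toUltrapower D) := Quotient.mk_surjective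

/-- The theorem of Łoś for continuous formulas. -/
theorem val_ultrapower (M : RVStructure.{u} L) {I : Type u} (D : Ultrafilter I)
    {α : Type*} (φ : CFormula L α 0) (v : α → I → M) :
    (M.ultrapower D).val φ (fun a => M.toUltrapower D (v a)) =
      ulim D fun t => M.val φ fun a => v a t := by
  have h₁ := value_of_surjective (M.preUltrapower D) (M.ultrapower D) (M.toUltrapower D)
    (M.toUltrapower_surjective D)
    (fun F a => ((M.preUltrapower D).reduction_funMap F a).symm)
    (fun R a => ((M.preUltrapower D).reduction_relMap R a).symm) φ v Fin.elim0
  have h₂ := h₁.symm.trans (M.value_preUltrapower D φ v Fin.elim0)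
  rw [value_eq_val] at h₂
  refine h₂.trans (congrArg _ (funext fun t => ?_))
  rw [value_eq_val]
  rfl

end RVStructure

/-! ### Regular ultrafilters that are good for equality -/

/-- An ultrafilter `D` over `I` is good for equality if each family of at most `#I` functions on `I`
that are pairwise distinct modulo `D` can be made pairwise distinct at each single point, by
restricting each function to a set in `D`. -/
def GoodForEquality {I : Type u} (D : Ultrafilter I) : Prop :=
  ∀ (ι X : Type u), #ι ≤ #I → ∀ g : ι → I → X,
    (∀ α β, α ≠ β → ∀ᶠ t in (D : Filter I), g α t ≠ g β t) →
    ∃ d : ι → Set I, (∀ α, d α ∈ D) ∧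
      ∀ t α β, t ∈ d α → t ∈ d β → α ≠ β → g α t ≠ g β t

theorem IsRegularUltrafilter.exists_family {I : Type u} {D : Ultrafilter I}
    (hD : IsRegularUltrafilter D) (ι : Type u) (hι : #ι ≤ #I) :
    ∃ Z : ι → Set I, (∀ α, Z α ∈ D) ∧ ∀ t, {α | t ∈ Z α}.Finite := by
  obtain ⟨X, hX, hc, hfin⟩ := hD
  rw [← hc] at hι
  obtain ⟨e⟩ := hι
  refine ⟨fun α => e α, fun α => hX _ (e α).2, fun t => ?_⟩
  refine Set.Finite.of_finite_image (f := fun α => (e α : Set I)) ((hfin t).subset ?_) ?_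
  · rintro _ ⟨α, hα, rfl⟩
    exact ⟨(e α).2, hα⟩
  · exact fun α _ β _ h => e.injective (Subtype.ext h)

/-! ### Consistency of finite parts of an array -/

namespace RVStructure

variable {L : FirstOrder.Language.{0, 0}} (M : RVStructure.{u} L) {q p : ℕ}

/-- In an `ℵ₁`-saturated structure a countable set of instances of a formula is satisfiable as soon
as its finite parts are satisfiable approximately. -/
theorem exists_of_approx (hM : M.IsSaturated ℵ₁) {J : Type*} [Countable J]
    (φ : CFormula L (Fin q ⊕ Fin p) 0) (b : J → Fin p → M)
    (h : ∀ (F : Finset J) (ε : ℝ), 0 < ε →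
      ∃ x : Fin q → M, ∀ j ∈ F, (M.val φ (Sum.elim x (b j)) : ℝ) ≤ ε) :
    ∃ x : Fin q → M, ∀ j, M.val φ (Sum.elim x (b j)) = 0 := by
  classical
  let A : Set M := Set.range fun y : J × Fin p => b y.1 y.2
  let f : J × ℕ → CFormula L (A ⊕ Fin q) 0 := fun y =>
    (φ.relabel (Sum.elim .inr fun r => .inl ⟨b y.1 r, (y.1, r), rfl⟩)).tsub (1 / (y.2 + 1))
  have hf : ∀ (y : J × ℕ) (x : Fin q → M),
      M.val (f y) (Sum.elim (fun a : A => (a : M)) x) = 0 ↔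
        (M.val φ (Sum.elim x (b y.1)) : ℝ) ≤ 1 / (y.2 + 1) := by
    intro y x
    have e : Sum.elim (fun a : A => (a : M)) x ∘
        Sum.elim .inr (fun r => .inl ⟨b y.1 r, (y.1, r), rfl⟩) = Sum.elim x (b y.1) := by
      funext j; rcases j with j | j <;> rfl
    rw [← e, ← val_relabel]
    exact M.value_tsub_eq_zero _ _ _ _
  have hA : #A < ℵ₁ := by
    rw [Cardinal.lt_aleph_one_iff, Cardinal.le_aleph0_iff_set_countable]
    exact Set.countable_range _
  obtain ⟨x, hx⟩ := hM A hA q (Set.range f) (by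
    intro Γ₀ hΓ₀ hfin
    rw [← Set.image_univ] at hΓ₀
    obtain ⟨s, -, hs, rfl⟩ := Set.exists_subset_image_finite_and.1
      ⟨Γ₀, hΓ₀, hfin, (rfl : Γ₀ = Γ₀)⟩
    obtain ⟨K, hK⟩ := (hs.image Prod.snd).bddAbove
    obtain ⟨x, hx⟩ := h (hs.toFinset.image Prod.fst) (1 / (K + 1)) (by positivity)
    refine ⟨x, ?_⟩
    rintro _ ⟨y, hy, rfl⟩
    rw [hf]
    refine (hx y.1 (Finset.mem_image_of_mem _ (hs.mem_toFinset.2 hy))).trans ?_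
    have : (y.2 : ℝ) ≤ K := by exact_mod_cast hK ⟨y, hy, rfl⟩
    gcongr)
  refine ⟨x, fun j => ?_⟩
  have hle : (M.val φ (Sum.elim x (b j)) : ℝ) ≤ 0 :=
    ge_of_tendsto' tendsto_one_div_add_atTop_nhds_zero_nat
      fun k => (hf (j, k) x).1 (hx _ ⟨(j, k), rfl⟩)
  exact le_antisymm (Subtype.coe_le_coe.1 hle) bot_le

/-- The infimum over `x` of the maximum of the values `φ(x, b j)`. -/
noncomputable def jointVal {J : Type*} [Fintype J] (φ : CFormula L (Fin q ⊕ Fin p) 0)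
    (b : J → Fin p → M) : unitInterval :=
  ⨅ x : Fin q → M, Finset.univ.sup fun j => M.val φ (Sum.elim x (b j))

/-- `jointVal` is the value of a formula. -/
theorem exists_jointFormula {J : Type*} [Fintype J] (φ : CFormula L (Fin q ⊕ Fin p) 0) :
    ∃ ψ : CFormula L (J × Fin p) 0, ∀ v : J × Fin p → M,
      M.val ψ v = M.jointVal φ fun j r => v (j, r) := by
  refine ⟨CFormula.infs (n := q) (CFormula.comb
    ⟨fun v => Finset.univ.sup v, by fun_prop⟩ fun j : J =>
      (φ.bindVars (Sum.elim .inr fun r => .inl (j, r)) : CFormula L (J × Fin p) (q + 0))), ?_⟩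
  intro v
  rw [val_infs]
  refine iInf_congr fun x => ?_
  rw [value_comb]
  simp only [ContinuousMap.coe_mk]
  congr 1
  funext j
  have h := M.value_bindVars (Sum.elim .inr fun r => .inl (j, r)) φ v x Fin.elim0
  have e : (Fin.append x Fin.elim0 : Fin (q + 0) → M) = x :=
    funext fun i => Fin.append_left x Fin.elim0 i
  rw [e] at h
  refine h.trans ?_
  rw [value_eq_val]
  congr 1
  funext i; rcases i with i | i <;> rfl

variable {M}

theorem exists_le_of_jointVal_eq_zero {J : Type*} [Fintype J] {φ : CFormula L (Fin q ⊕ Fin p) 0}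
    {b : J → Fin p → M} (h : M.jointVal φ b = 0) (ε : ℝ) (hε : 0 < ε) :
    ∃ x : Fin q → M, ∀ j, (M.val φ (Sum.elim x (b j)) : ℝ) ≤ ε := by
  by_contra! hcon
  rcases lt_or_ge 1 ε with h1 | h1
  · obtain ⟨j, hj⟩ := hcon fun _ => Classical.arbitrary M
    exact absurd (hj.trans_le (M.val φ _).2.2) (by linarith)
  · have : (⟨ε, hε.le, h1⟩ : unitInterval) ≤ M.jointVal φ b := by
      refine le_iInf fun x => ?_
      obtain ⟨j, hj⟩ := hcon x
      exact le_trans (Subtype.coe_le_coe.1 hj.le)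
        (Finset.le_sup (f := fun j => M.val φ (Sum.elim x (b j))) (Finset.mem_univ j))
    rw [h] at this
    exact absurd (Subtype.coe_le_coe.2 this) (not_le.2 hε)

theorem jointVal_eq_zero_of_exists {J : Type*} [Fintype J] {φ : CFormula L (Fin q ⊕ Fin p) 0}
    {b : J → Fin p → M} {x : Fin q → M} (h : ∀ j, M.val φ (Sum.elim x (b j)) = 0) :
    M.jointVal φ b = 0 := by
  refine le_antisymm ((iInf_le _ x).trans ?_) bot_le
  exact Finset.sup_le fun j _ => (h j).le

theorem exists_jointVal_le {J : Type*} [Fintype J] {φ : CFormula L (Fin q ⊕ Fin p) 0}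
    {b : J → Fin p → M} (h : 0 < M.jointVal φ b) (x : Fin q → M) :
    ∃ j, M.jointVal φ b ≤ M.val φ (Sum.elim x (b j)) := by
  by_contra! hcon
  have : (Finset.univ.sup fun j => M.val φ (Sum.elim x (b j))) < M.jointVal φ b :=
    (Finset.sup_lt_iff h).2 fun j _ => hcon j
  exact absurd (iInf_le _ x) (not_le.2 this)

/-- In a mutually indiscernible array, the elements of one row of a rectangular part can be moved
without a change of the joint value. -/
theorem jointVal_update_row {b : ℕ → ℕ → Fin p → M} (hb : MutuallyIndiscernible M b)
    (φ : CFormula L (Fin q ⊕ Fin p) 0) {N s : ℕ} {ρ : Fin N → ℕ} (hρ : StrictMono ρ)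
    (G : Fin N → Fin s → ℕ) (l : Fin N) {H H' : Fin s → ℕ} (hH : StrictMono H)
    (hH' : StrictMono H') :
    M.jointVal φ (fun x : Fin N × Fin s => b (ρ x.1) (Function.update G l H x.1 x.2)) =
      M.jointVal φ (fun x : Fin N × Fin s => b (ρ x.1) (Function.update G l H' x.1 x.2)) := by
  classical
  obtain ⟨ψ, hψ⟩ := M.exists_jointFormula (J := Fin N × Fin s) φ
  let B : Set M := {a | ∃ n' m r, n' ≠ ρ l ∧ a = b n' m r}
  let f : (Fin N × Fin s) × Fin p → B ⊕ (Fin s × Fin p) := fun x =>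
    if h : x.1.1 = l then .inr (x.1.2, x.2)
    else .inl ⟨b (ρ x.1.1) (G x.1.1 x.1.2) x.2, _, _, _, fun h' => h (hρ.injective h'), rfl⟩
  have key := hb (ρ l) s H H' hH hH' (ψ.relabel f)
  have e : ∀ H : Fin s → ℕ,
      (fun (y : Fin N × Fin s) (r : Fin p) => (Sum.elim (fun a : B => (a : M))
        (fun x : Fin s × Fin p => b (ρ l) (H x.1) x.2) ∘ f) (y, r)) =
      fun x => b (ρ x.1) (Function.update G l H x.1 x.2) := by
    intro H
    funext y r
    by_cases h : y.1 = l
    · simp [f, h]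
    · simp [f, h]
  rw [val_relabel, val_relabel, hψ, hψ, e, e] at key
  exact key

theorem jointVal_rectangle {b : ℕ → ℕ → Fin p → M} (hb : MutuallyIndiscernible M b)
    (hb' : SeqIndiscernible M b) (φ : CFormula L (Fin q ⊕ Fin p) 0) {N s : ℕ} {ρ : Fin N → ℕ}
    (hρ : StrictMono ρ) {F : Fin N → Fin s → ℕ} (hF : ∀ n, StrictMono (F n)) :
    M.jointVal φ (fun x : Fin N × Fin s => b (ρ x.1) (F x.1 x.2)) =
      M.jointVal φ (fun x : Fin N × Fin s => b x.1 x.2) := by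
  classical
  let F₀ : Fin N → Fin s → ℕ := fun _ i => i
  have hF₀ : ∀ n, StrictMono (F₀ n) := fun n => Fin.val_strictMono
  have main : ∀ T : Finset (Fin N),
      M.jointVal φ (fun x : Fin N × Fin s => b (ρ x.1) (F₀ x.1 x.2)) =
        M.jointVal φ (fun x : Fin N × Fin s => b (ρ x.1) (T.piecewise F F₀ x.1 x.2)) := by
    intro T
    induction T using Finset.induction_on with
    | empty => simp
    | insert l T hl ih =>
      have e : T.piecewise F F₀ = Function.update (T.piecewise F F₀) l (F₀ l) := by
        rw [Function.eq_update_iff]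
        exact ⟨by simp [hl], fun _ _ => rfl⟩
      rw [ih, Finset.piecewise_insert, jointVal_update_row hb φ hρ _ l (hF l) (hF₀ l), ← e]
  have h₁ := main Finset.univ
  rw [Finset.piecewise_univ] at h₁
  rw [← h₁]
  obtain ⟨ψ, hψ⟩ := M.exists_jointFormula (J := Fin N × Fin s) φ
  have := hb' N ρ (fun i => i) hρ Fin.val_strictMono
    (ψ.relabel fun x => (x.1.1, (x.1.2 : ℕ), x.2))
  rw [val_relabel, val_relabel, hψ, hψ] at this
  exact this

/-- An array that witnesses `TP₂` gives numbers `N` and `r ≥ 1` such that any choice of `r` elements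
from each row is consistent, while any choice of `r + 1` common columns in a block of `N`
consecutive rows is inconsistent, with a uniform gap `ε`. -/
theorem exists_consistency_pattern (hM : M.IsSaturated ℵ₁) {b : ℕ → ℕ → Fin p → M}
    (hb : MutuallyIndiscernible M b) (hb' : SeqIndiscernible M b)
    (φ : CFormula L (Fin q ⊕ Fin p) 0)
    (hrow : ∀ n : ℕ, ¬ ∃ x : Fin q → M, ∀ m : ℕ, M.val φ (Sum.elim x (b n m)) = 0)
    (hpath : ∀ f : ℕ → ℕ, ∃ x : Fin q → M, ∀ n : ℕ, M.val φ (Sum.elim x (b n (f n))) = 0) :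
    ∃ (N r : ℕ) (ε : unitInterval), 0 < r ∧ 0 < ε ∧
      (∀ F : ℕ → Fin r → ℕ, (∀ n, StrictMono (F n)) →
        ∃ x : Fin q → M, ∀ n i, M.val φ (Sum.elim x (b n (F n i))) = 0) ∧
      ∀ (n : ℕ) (F : Fin (r + 1) → ℕ), StrictMono F → ∀ x : Fin q → M,
        ∃ (j : Fin N) (i : Fin (r + 1)), ε ≤ M.val φ (Sum.elim x (b (N * n + j) (F i))) := by
  classical
  let V : ℕ → ℕ → unitInterval := fun N s => M.jointVal φ fun x : Fin N × Fin s => b x.1 x.2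
  have hex : ∃ s, ∃ N, 0 < V N s := by
    by_contra! hcon
    refine hrow 0 (M.exists_of_approx hM φ (b 0) fun F ε hε => ?_)
    obtain ⟨K, hK⟩ := F.bddAbove
    have h0 : V 1 (K + 1) = 0 := le_antisymm (hcon (K + 1) 1) bot_le
    obtain ⟨x, hx⟩ := exists_le_of_jointVal_eq_zero h0 ε hε
    exact ⟨x, fun j hj => hx (0, ⟨j, Nat.lt_succ_of_le (hK hj)⟩)⟩
  obtain ⟨N, hN⟩ := Nat.find_spec hex
  have hmin : ∀ s < Nat.find hex, ∀ N, V N s = 0 := fun s hs N =>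
    le_antisymm (not_lt.1 fun h => Nat.find_min hex hs ⟨N, h⟩) bot_le
  have h1 : 1 < Nat.find hex := by
    obtain ⟨x, hx⟩ := hpath fun _ => 0
    by_contra hle
    refine hN.ne' (jointVal_eq_zero_of_exists (x := x) fun j => ?_)
    have : (j.2 : ℕ) = 0 := by have := j.2.2; omega
    rw [this]
    exact hx _
  obtain ⟨r, hr⟩ : ∃ r, Nat.find hex = r + 1 := ⟨Nat.find hex - 1, by omega⟩
  rw [hr] at hN hmin h1
  refine ⟨N, r, V N (r + 1), by omega, hN, fun F hF => ?_, fun n F hF x => ?_⟩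
  · obtain ⟨x, hx⟩ := M.exists_of_approx hM φ (fun y : ℕ × Fin r => b y.1 (F y.1 y.2))
      fun S ε hε => by
        obtain ⟨K, hK⟩ := (S.image Prod.fst).bddAbove
        have h0 := jointVal_rectangle hb hb' φ (Fin.val_strictMono (n := K + 1))
          (F := fun n => F n) fun n => hF n
        obtain ⟨x, hx⟩ := exists_le_of_jointVal_eq_zero
          (h0.trans (hmin r (by omega) (K + 1))) ε hε
        refine ⟨x, fun y hy => ?_⟩
        exact hx (⟨y.1, Nat.lt_succ_of_le (hK (Finset.mem_image_of_mem _ hy))⟩, y.2)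
    exact ⟨x, fun n i => hx (n, i)⟩
  · have hρ : StrictMono fun j : Fin N => N * n + (j : ℕ) := fun i j h =>
      Nat.add_lt_add_left h _
    have h0 := jointVal_rectangle hb hb' φ hρ (F := fun _ => F) fun _ => hF
    obtain ⟨j, hj⟩ := exists_jointVal_le (hN.trans_eq h0.symm) x
    exact ⟨j.1, j.2, h0.symm.le.trans hj⟩

end RVStructure

/-! ### Saturation of a theory with the tree property of the second kind -/

theorem exists_injOn_nat_of_finite {X : Type*} {s : Set X} (hs : s.Finite) :
    ∃ e : X → ℕ, Set.InjOn e s :=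
  Set.countable_iff_exists_injOn.1 hs.countable

/-- A regular ultrafilter that saturates a theory with `TP₂` is good for equality. Given the family
`g`, consider the type that asks for instances of `φ` at `r` elements in each of `N` rows for each
`α`; at `t` the block of rows is given by `g α t` and the columns are given by `α`. A realization
of this type leaves no room for two indices with the same block. -/
theorem IsTP₂.goodForEquality {L : FirstOrder.Language.{0, 0}} {T : CTheory L}
    (hT : IsTP₂.{u} T) {I : Type u} [Infinite I] {D : Ultrafilter I}
    (hreg : IsRegularUltrafilter D) (hsat : Saturates D T) : GoodForEquality D := by
  classical
  intro ι X hι g hg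
  obtain ⟨M, hMT, hM, q, p, φ, b, hb, hb', hrow, hpath⟩ := hT
  obtain ⟨N, r, ε, hr, hε, hcons, hincons⟩ :=
    RVStructure.exists_consistency_pattern hM hb hb' φ hrow hpath
  obtain ⟨Z, hZ, hZfin⟩ := hreg.exists_family ι hι
  choose idx hidx using fun t => exists_injOn_nat_of_finite (hZfin t)
  choose e he using fun t => exists_injOn_nat_of_finite ((hZfin t).image fun α => g α t)
  -- the parameters of the type
  let c : ι → Fin N → Fin r → Fin p → I → M := fun α j i k t =>
    b (N * e t (g α t) + j) (r * idx t α + i) k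
  let A : Set (M.ultrapower D) := Set.range fun y : ι × Fin N × Fin r × Fin p =>
    M.toUltrapower D (c y.1 y.2.1 y.2.2.1 y.2.2.2)
  have hA : #A < Order.succ #I := by
    rw [Order.lt_succ_iff]
    refine Cardinal.mk_range_le.trans ?_
    rw [Cardinal.mk_prod]
    refine Cardinal.mul_le_of_le (Cardinal.aleph0_le_mk I) (by simpa using hι) ?_
    exact (Cardinal.lift_lt_aleph0.2 (Cardinal.mk_lt_aleph0)).le.trans (Cardinal.aleph0_le_mk I)
  let f : ι × Fin N × Fin r → CFormula L (A ⊕ Fin q) 0 := fun y =>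
    φ.relabel (Sum.elim .inr fun k =>
      .inl ⟨M.toUltrapower D (c y.1 y.2.1 y.2.2 k), (y.1, y.2.1, y.2.2, k), rfl⟩)
  have hf : ∀ (y : ι × Fin N × Fin r) (x : Fin q → I → M),
      (M.ultrapower D).val (f y)
        (Sum.elim (fun a : A => (a : M.ultrapower D)) fun k => M.toUltrapower D (x k)) =
      RVStructure.ulim D fun t => M.val φ
        (Sum.elim (fun k => x k t) fun k => c y.1 y.2.1 y.2.2 k t) := by
    intro y x
    rw [RVStructure.val_relabel]
    have e₁ : Sum.elim (fun a : A => (a : M.ultrapower D)) (fun k => M.toUltrapower D (x k)) ∘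
        Sum.elim .inr (fun k =>
          .inl ⟨M.toUltrapower D (c y.1 y.2.1 y.2.2 k), (y.1, y.2.1, y.2.2, k), rfl⟩) =
        fun z => M.toUltrapower D (Sum.elim x (c y.1 y.2.1 y.2.2) z) := by
      funext z; rcases z with z | z <;> rfl
    rw [e₁, RVStructure.val_ultrapower]
    congr 1; funext t; congr 1
    funext z; rcases z with z | z <;> rfl
  obtain ⟨x, hx⟩ := hsat M hMT A hA q (Set.range f) (by
    intro Γ₀ hΓ₀ hfin
    rw [← Set.image_univ] at hΓ₀
    obtain ⟨s, -, hs, rfl⟩ := Set.exists_subset_image_finite_and.1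
      ⟨Γ₀, hΓ₀, hfin, (rfl : Γ₀ = Γ₀)⟩
    let w : Set ι := Prod.fst '' s
    have hw : w.Finite := hs.image _
    have hgood : ∀ᶠ t in (D : Filter I), (∀ α ∈ w, t ∈ Z α) ∧
        ∀ α ∈ w, ∀ β ∈ w, α ≠ β → g α t ≠ g β t := by
      refine ((eventually_all_finite hw).2 fun α _ => hZ α).and ?_
      refine (eventually_all_finite hw).2 fun α _ => (eventually_all_finite hw).2 fun β _ => ?_
      by_cases h : α = β
      · exact Eventually.of_forall fun t h' => absurd h h'
      · exact (hg α β h).mono fun t ht _ => ht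
    have hsol : ∀ t, ∃ x : Fin q → M, ((∀ α ∈ w, t ∈ Z α) ∧
        ∀ α ∈ w, ∀ β ∈ w, α ≠ β → g α t ≠ g β t) → ∀ α ∈ w, ∀ j i,
          M.val φ (Sum.elim x fun k => c α j i k t) = 0 := by
      intro t
      by_cases ht : (∀ α ∈ w, t ∈ Z α) ∧ ∀ α ∈ w, ∀ β ∈ w, α ≠ β → g α t ≠ g β t
      · -- the columns chosen in row `n`: those of the index whose block contains `n`
        let F : ℕ → Fin r → ℕ := fun n i =>
          if h : ∃ α ∈ w, n / N = e t (g α t) then r * idx t h.choose + i else i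
        obtain ⟨x, hx⟩ := hcons F fun n i j hij => by
          simp only [F]
          split_ifs
          · exact Nat.add_lt_add_left hij _
          · exact hij
        refine ⟨x, fun _ α hα j i => ?_⟩
        have hNpos : 0 < N := j.pos
        have hdiv : (N * e t (g α t) + j) / N = e t (g α t) := by
          rw [Nat.mul_add_div hNpos, Nat.div_eq_of_lt j.2, add_zero]
        have hFα : F (N * e t (g α t) + j) i = r * idx t α + i := by
          have h : ∃ β ∈ w, (N * e t (g α t) + j) / N = e t (g β t) := ⟨α, hα, hdiv⟩
          have hch : h.choose = α := by
            by_contra hne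
            have h2 := h.choose_spec
            refine ht.2 _ h2.1 α hα hne ?_
            exact he t ⟨_, ht.1 _ h2.1, rfl⟩ ⟨α, ht.1 α hα, rfl⟩ (h2.2.symm.trans hdiv)
          simp only [F]
          rw [dif_pos h, hch]
        rw [← hx (N * e t (g α t) + j) i, hFα]
      · exact ⟨fun _ => Classical.arbitrary M, fun h => absurd h ht⟩
    choose x hx using hsol
    refine ⟨fun k => M.toUltrapower D fun t => x t k, ?_⟩
    rintro _ ⟨y, hy, rfl⟩
    rw [hf y fun k t => x t k]
    refine RVStructure.ulim_eq (tendsto_const_nhds.congr' ?_)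
    filter_upwards [hgood] with t ht
    exact (hx t ht y.1 ⟨y, hy, rfl⟩ y.2.1 y.2.2).symm)
  choose x' hx' using fun k => M.toUltrapower_surjective D (x k)
  obtain rfl : (fun k => M.toUltrapower D (x' k)) = x := funext hx'
  have hsmall : ∀ y : ι × Fin N × Fin r, ∀ᶠ t in (D : Filter I),
      M.val φ (Sum.elim (fun k => x' k t) fun k => c y.1 y.2.1 y.2.2 k t) < ε := by
    intro y
    have h0 := hx _ ⟨y, rfl⟩
    rw [hf y x'] at h0
    have := RVStructure.tendsto_ulim D fun t =>
      M.val φ (Sum.elim (fun k => x' k t) fun k => c y.1 y.2.1 y.2.2 k t)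
    rw [h0] at this
    exact this.eventually_lt_const hε
  refine ⟨fun α => {t | t ∈ Z α ∧ ∀ j i,
    M.val φ (Sum.elim (fun k => x' k t) fun k => c α j i k t) < ε}, fun α => ?_, ?_⟩
  · exact Eventually.and (hZ α)
      (eventually_all.2 fun j => eventually_all.2 fun i => hsmall (α, j, i))
  · intro t
    have main : ∀ α β, idx t α < idx t β →
        (∀ j i, M.val φ (Sum.elim (fun k => x' k t) fun k => c α j i k t) < ε) →
        (∀ j i, M.val φ (Sum.elim (fun k => x' k t) fun k => c β j i k t) < ε) →
        g α t ≠ g β t := by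
      intro α β hlt hα hβ heq
      -- `r` columns of `α` and one column of `β` in the same block of rows
      let F : Fin (r + 1) → ℕ := Fin.snoc (fun i : Fin r => r * idx t α + i) (r * idx t β)
      have hF : StrictMono F := by
        intro i j hij
        induction j using Fin.lastCases with
        | last =>
          induction i using Fin.lastCases with
          | last => exact absurd hij (lt_irrefl _)
          | cast i =>
            simp only [F, Fin.snoc_castSucc, Fin.snoc_last]
            calc r * idx t α + i < r * (idx t α + 1) := by rw [mul_add_one]; omega
              _ ≤ r * idx t β := Nat.mul_le_mul_left _ hlt
        | cast j =>
          induction i using Fin.lastCases with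
          | last => exact absurd hij (not_lt.2 (Fin.le_last _))
          | cast i =>
            simp only [F, Fin.snoc_castSucc]
            exact Nat.add_lt_add_left hij _
      obtain ⟨j, i, hji⟩ := hincons (e t (g α t)) F hF fun k => x' k t
      induction i using Fin.lastCases with
      | last =>
        simp only [F, Fin.snoc_last] at hji
        rw [heq] at hji
        exact absurd (hβ j ⟨0, hr⟩) (not_lt.2 hji)
      | cast i =>
        simp only [F, Fin.snoc_castSucc] at hji
        exact absurd (hα j i) (not_lt.2 hji)
    intro α β hα hβ hne
    rcases lt_trichotomy (idx t α) (idx t β) with h | h | h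
    · exact main α β h hα.2 hβ.2
    · exact absurd (hidx t hα.1 hβ.1 h) hne
    · exact (main β α h hβ.2 hα.2).symm

/-! ### Generic parametrized equivalence relations -/

/-- A parametrized equivalence relation on `X`: the parameters are the elements of `P`, the objects
are all other elements. -/
class Feq (X : Type u) where
  /-- The set of parameters. -/
  P : X → Prop
  /-- `E z x y`: the objects `x` and `y` are equivalent for the parameter `z`. -/
  E : X → X → X → Prop
  dom : ∀ {z x y}, E z x y → P z ∧ ¬ P x ∧ ¬ P y
  refl : ∀ {z x}, P z → ¬ P x → E z x x
  symm : ∀ {z x y}, E z x y → E z y x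
  trans : ∀ {z x y w}, E z x y → E z y w → E z x w

namespace Feq

variable {X X' : Type u} [Feq X] [Feq X']

variable (X) in
/-- `κ`-genericity, an explicit form of saturation. Fewer than `κ` objects can be partitioned in an
arbitrary way by a new parameter (the partition is given by the fibres of `k`), and a new object can
be put into arbitrary classes `g z` of parameters `z ∈ A`, while it avoids the classes of the
elements of `Y` for the parameters `z ∈ B`, if there are fewer than `κ` requirements. -/
structure IsGeneric (κ : Cardinal.{u}) : Prop where
  param : ∀ (Y Z : Set X) (C : Type u) (k : X → C), #Y < κ → #Z < κ →
    ∃ z, P z ∧ z ∉ Z ∧ ∀ y ∈ Y, ∀ y' ∈ Y, ¬ P y → ¬ P y' → (E z y y' ↔ k y = k y')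
  obj : ∀ (A B Y : Set X) (g : X → X), #A < κ → #B < κ → #Y < κ → (∀ z ∈ A, P z) →
    (∀ z ∈ B, P z) → Disjoint A B → (∀ z ∈ A, ¬ P (g z)) →
    ∃ x, ¬ P x ∧ x ∉ Y ∧ (∀ z ∈ A, E z x (g z)) ∧ ∀ z ∈ B, ∀ y ∈ Y, ¬ E z x y

theorem IsGeneric.mono {κ κ' : Cardinal.{u}} (h : IsGeneric X κ) (hκ : κ' ≤ κ) :
    IsGeneric X κ' where
  param Y Z C k hY hZ := h.param Y Z C k (hY.trans_le hκ) (hZ.trans_le hκ)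
  obj A B Y g hA hB hY := h.obj A B Y g (hA.trans_le hκ) (hB.trans_le hκ) (hY.trans_le hκ)

theorem IsGeneric.nonempty {κ : Cardinal.{u}} (h : IsGeneric X κ) (hκ : 0 < κ) : Nonempty X := by
  obtain ⟨z, -⟩ := h.param ∅ ∅ PUnit (fun _ => ⟨⟩) (by simpa using hκ) (by simpa using hκ)
  exact ⟨z⟩

/-- Partial isomorphisms, as sets of pairs. -/
structure IsPartIso (R : Set (X × X')) : Prop where
  eq_iff : ∀ a ∈ R, ∀ b ∈ R, (a.1 = b.1 ↔ a.2 = b.2)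
  P_iff : ∀ a ∈ R, (P a.1 ↔ P a.2)
  E_iff : ∀ a ∈ R, ∀ b ∈ R, ∀ c ∈ R, (E a.1 b.1 c.1 ↔ E a.2 b.2 c.2)

namespace IsPartIso

variable {R S : Set (X × X')}

theorem mono (h : IsPartIso R) (hS : S ⊆ R) : IsPartIso S where
  eq_iff a ha b hb := h.eq_iff a (hS ha) b (hS hb)
  P_iff a ha := h.P_iff a (hS ha)
  E_iff a ha b hb c hc := h.E_iff a (hS ha) b (hS hb) c (hS hc)

theorem swap (h : IsPartIso R) : IsPartIso (Prod.swap '' R) where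
  eq_iff := by
    rintro _ ⟨a, ha, rfl⟩ _ ⟨b, hb, rfl⟩
    exact (h.eq_iff a ha b hb).symm
  P_iff := by
    rintro _ ⟨a, ha, rfl⟩
    exact (h.P_iff a ha).symm
  E_iff := by
    rintro _ ⟨a, ha, rfl⟩ _ ⟨b, hb, rfl⟩ _ ⟨c, hc, rfl⟩
    exact (h.E_iff a ha b hb c hc).symm

theorem insert_param (h : IsPartIso R) {x : X} {x' : X'} (hx : P x) (hx' : P x')
    (hne : ∀ a ∈ R, x ≠ a.1) (hne' : ∀ a ∈ R, x' ≠ a.2)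
    (hE : ∀ b ∈ R, ∀ c ∈ R, (E x b.1 c.1 ↔ E x' b.2 c.2)) : IsPartIso (insert (x, x') R) where
  eq_iff := by
    rintro a (rfl | ha) b (rfl | hb)
    · simp
    · simp [hne b hb, hne' b hb]
    · simp [(hne a ha).symm, (hne' a ha).symm]
    · exact h.eq_iff a ha b hb
  P_iff := by
    rintro a (rfl | ha)
    · simp [hx, hx']
    · exact h.P_iff a ha
  E_iff := by
    have no : ∀ {Y : Type u} [Feq Y] {y : Y} (a b : Y), P y → ¬ E a y b ∧ ¬ E a b y :=
      fun a b hy => ⟨fun he => (dom he).2.1 hy, fun he => (dom he).2.2 hy⟩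
    rintro a ha b (rfl | hb) c hc
    · simp [no _ _ hx, no _ _ hx']
    · rcases hc with rfl | hc
      · simp [no _ _ hx, no _ _ hx']
      · rcases ha with rfl | ha
        · exact hE b hb c hc
        · exact h.E_iff a ha b hb c hc

theorem insert_obj (h : IsPartIso R) {x : X} {x' : X'} (hx : ¬ P x) (hx' : ¬ P x')
    (hne : ∀ a ∈ R, x ≠ a.1) (hne' : ∀ a ∈ R, x' ≠ a.2)
    (hE : ∀ a ∈ R, ∀ c ∈ R, (E a.1 x c.1 ↔ E a.2 x' c.2)) : IsPartIso (insert (x, x') R) where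
  eq_iff := by
    rintro a (rfl | ha) b (rfl | hb)
    · simp
    · simp [hne b hb, hne' b hb]
    · simp [(hne a ha).symm, (hne' a ha).symm]
    · exact h.eq_iff a ha b hb
  P_iff := by
    rintro a (rfl | ha)
    · simp [hx, hx']
    · exact h.P_iff a ha
  E_iff := by
    have no : ∀ {Y : Type u} [Feq Y] {y : Y} (a b : Y), ¬ P y → ¬ E y a b :=
      fun a b hy he => hy (dom he).1
    rintro a (rfl | ha) b hb c hc
    · simp [no _ _ hx, no _ _ hx']
    · rcases hb with rfl | hb <;> rcases hc with rfl | hc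
      · exact ⟨fun he => refl ((h.P_iff a ha).1 (dom he).1) hx',
          fun he => refl ((h.P_iff a ha).2 (dom he).1) hx⟩
      · exact hE a ha c hc
      · exact ⟨fun he => symm ((hE a ha b hb).1 (symm he)),
          fun he => symm ((hE a ha b hb).2 (symm he))⟩
      · exact h.E_iff a ha b hb c hc

end IsPartIso

/-- A partial isomorphism with fewer than `κ` pairs into a `κ`-generic structure extends to any
further point. -/
theorem IsGeneric.extend {κ : Cardinal.{u}} (hX' : IsGeneric X' κ) {R : Set (X × X')}
    (hR : IsPartIso R) (hc : #R < κ) (x : X) : ∃ x', IsPartIso (insert (x, x') R) := by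
  classical
  by_cases hx : ∃ a ∈ R, x = a.1
  · obtain ⟨a, ha, rfl⟩ := hx
    exact ⟨a.2, hR.mono (Set.insert_subset ha subset_rfl)⟩
  push Not at hx
  have hran : ∀ S ⊆ R, #(Prod.snd '' S) < κ := fun S hS =>
    (Cardinal.mk_image_le.trans (Cardinal.mk_le_mk_of_subset hS)).trans_lt hc
  -- a section of the second projection
  have hback : ∀ y' : X', ∃ y : X, ∀ a ∈ R, a.2 = y' → a.1 = y := by
    intro y'
    by_cases h : ∃ a ∈ R, a.2 = y'
    · obtain ⟨a, ha, rfl⟩ := h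
      exact ⟨a.1, fun b hb hab => (hR.eq_iff b hb a ha).2 hab⟩
    · exact ⟨x, fun a ha hab => absurd ⟨a, ha, hab⟩ h⟩
  choose s hs using hback
  have hs' : ∀ a ∈ R, s a.2 = a.1 := fun a ha => (hs _ a ha rfl).symm
  by_cases hPx : P x
  · obtain ⟨x', hPx', hx', hE⟩ := hX'.param (Prod.snd '' R) (Prod.snd '' R) (Set X)
      (fun y => {w | E x (s y) w}) (hran _ subset_rfl) (hran _ subset_rfl)
    refine ⟨x', hR.insert_param hPx hPx' hx (fun a ha h => hx' ⟨a, ha, h.symm⟩)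
      fun b hb c hc => ?_⟩
    by_cases hbc : P b.1 ∨ P c.1
    · have hbc' : P b.2 ∨ P c.2 := by rwa [← hR.P_iff b hb, ← hR.P_iff c hc]
      constructor <;> intro h <;> have := dom h <;> tauto
    · push Not at hbc
      rw [hE _ ⟨b, hb, rfl⟩ _ ⟨c, hc, rfl⟩ (by rw [← hR.P_iff b hb]; exact hbc.1)
        (by rw [← hR.P_iff c hc]; exact hbc.2), hs' b hb, hs' c hc]
      constructor
      · intro h
        ext w
        exact ⟨fun hw => trans (symm h) hw, fun hw => trans h hw⟩
      · intro h
        have : c.1 ∈ {w | E x c.1 w} := refl hPx hbc.2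
        rw [← h] at this
        exact this
  · -- the parameters for which `x` is equivalent to an element of the domain, and the others
    let A : Set (X × X') := {a | a ∈ R ∧ P a.1 ∧ ∃ b ∈ R, E a.1 x b.1}
    let B : Set (X × X') := {a | a ∈ R ∧ P a.1 ∧ ¬ ∃ b ∈ R, E a.1 x b.1}
    have hgex : ∀ z' : X', ∃ y' : X', ∀ a ∈ A, a.2 = z' → ∃ b ∈ R, b.2 = y' ∧ E a.1 x b.1 := by
      intro z'
      by_cases h : ∃ a ∈ A, a.2 = z'
      · obtain ⟨a, ha, rfl⟩ := h
        obtain ⟨b, hb, hab⟩ := ha.2.2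
        refine ⟨b.2, fun a' ha' h => ⟨b, hb, rfl, ?_⟩⟩
        rwa [(hR.eq_iff a' ha'.1 a ha.1).2 h]
      · exact ⟨z', fun a ha hab => absurd ⟨a, ha, hab⟩ h⟩
    choose g hg using hgex
    obtain ⟨x', hPx', hx', hA, hB⟩ := hX'.obj (Prod.snd '' A) (Prod.snd '' B) (Prod.snd '' R) g
      (hran _ fun a ha => ha.1) (hran _ fun a ha => ha.1) (hran _ subset_rfl)
      (by rintro _ ⟨a, ha, rfl⟩; exact (hR.P_iff a ha.1).1 ha.2.1)
      (by rintro _ ⟨a, ha, rfl⟩; exact (hR.P_iff a ha.1).1 ha.2.1)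
      (by
        rw [Set.disjoint_left]
        rintro _ ⟨a, ha, rfl⟩ ⟨b, hb, hab⟩
        have := (hR.eq_iff b hb.1 a ha.1).2 hab
        exact hb.2.2 (this ▸ ha.2.2))
      (by
        rintro _ ⟨a, ha, rfl⟩
        obtain ⟨b, hb, hb', hab⟩ := hg _ a ha rfl
        rw [← hb', ← hR.P_iff b hb]
        exact (dom hab).2.2)
    refine ⟨x', hR.insert_obj hPx hPx' hx (fun a ha h => hx' ⟨a, ha, h.symm⟩)
      fun a ha c hc => ?_⟩
    by_cases hPa : P a.1
    · by_cases haA : ∃ b ∈ R, E a.1 x b.1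
      · have haA' : a ∈ A := ⟨ha, hPa, haA⟩
        obtain ⟨b, hb, hb', hab⟩ := hg _ a haA' rfl
        have h2 := hA _ ⟨a, haA', rfl⟩
        rw [← hb'] at h2
        have h3 := hR.E_iff a ha b hb c hc
        exact ⟨fun h => trans h2 (h3.1 (trans (symm hab) h)),
          fun h => trans hab (h3.2 (trans (symm h2) h))⟩
      · exact iff_of_false (fun h => haA ⟨c, hc, h⟩)
          (hB _ ⟨a, ⟨ha, hPa, haA⟩, rfl⟩ _ ⟨c, hc, rfl⟩)
    · exact iff_of_false (fun h => hPa (dom h).1)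
        fun h => hPa ((hR.P_iff a ha).2 (dom h).1)

/-- A structure is generic if each finite part of it is isomorphic to a part of a generic structure
such that all one-point extensions are realized. -/
theorem isGeneric_aleph0_of_pullback
    (h : ∀ S : Set X, S.Finite → ∃ (X' : Type u) (_ : Feq X') (f : X → X'), IsGeneric X' ℵ₀ ∧
      IsPartIso ((fun s => (s, f s)) '' S) ∧
      ∀ y, ∃ x, IsPartIso (insert (x, y) ((fun s => (s, f s)) '' S))) :
    IsGeneric X ℵ₀ where
  param Y Z C k hY hZ := by
    classical
    rw [Cardinal.lt_aleph0_iff_set_finite] at hY hZ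
    obtain ⟨X', _, f, hX', hf, hext⟩ := h (Y ∪ Z) (hY.union hZ)
    obtain ⟨w⟩ := hX'.nonempty Cardinal.aleph0_pos
    have : Nonempty X := ⟨(hext w).choose⟩
    have hinj : Set.InjOn f (Y ∪ Z) := fun a ha b hb hab =>
      (hf.eq_iff _ ⟨a, ha, rfl⟩ _ ⟨b, hb, rfl⟩).2 hab
    obtain ⟨z', hPz', hz', hE⟩ := hX'.param (f '' Y) (f '' Z) C
      (fun y => k (Function.invFunOn f (Y ∪ Z) y))
      (Cardinal.lt_aleph0_iff_set_finite.2 (hY.image f))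
      (Cardinal.lt_aleph0_iff_set_finite.2 (hZ.image f))
    obtain ⟨z, hz⟩ := hext z'
    have hmem : ∀ a ∈ Y ∪ Z, (a, f a) ∈ insert (z, z') ((fun s => (s, f s)) '' (Y ∪ Z)) :=
      fun a ha => Or.inr ⟨a, ha, rfl⟩
    have hmem0 : (z, z') ∈ insert (z, z') ((fun s => (s, f s)) '' (Y ∪ Z)) := Or.inl rfl
    refine ⟨z, (hz.P_iff _ hmem0).2 hPz', fun hzZ => hz' ⟨z, hzZ, ?_⟩,
      fun y hy y' hy' hPy hPy' => ?_⟩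
    · exact (hz.eq_iff _ (hmem z (.inr hzZ)) _ hmem0).1 rfl
    · have h1 := hE _ ⟨y, hy, rfl⟩ _ ⟨y', hy', rfl⟩
        (fun h' => hPy ((hz.P_iff _ (hmem y (.inl hy))).2 h'))
        (fun h' => hPy' ((hz.P_iff _ (hmem y' (.inl hy'))).2 h'))
      rw [hinj.leftInvOn_invFunOn (.inl hy), hinj.leftInvOn_invFunOn (.inl hy')] at h1
      rw [← h1]
      exact hz.E_iff _ hmem0 _ (hmem y (.inl hy)) _ (hmem y' (.inl hy'))
  obj A B Y g hA hB hY hPA hPB hAB hg := by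
    classical
    rw [Cardinal.lt_aleph0_iff_set_finite] at hA hB hY
    obtain ⟨X', _, f, hX', hf, hext⟩ := h ((A ∪ B) ∪ (Y ∪ g '' A))
      ((hA.union hB).union (hY.union (hA.image g)))
    set S := (A ∪ B) ∪ (Y ∪ g '' A)
    have hAS : ∀ a ∈ A, a ∈ S := fun a ha => .inl (.inl ha)
    have hBS : ∀ a ∈ B, a ∈ S := fun a ha => .inl (.inr ha)
    have hYS : ∀ a ∈ Y, a ∈ S := fun a ha => .inr (.inl ha)
    have hgS : ∀ a ∈ A, g a ∈ S := fun a ha => .inr (.inr ⟨a, ha, rfl⟩)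
    obtain ⟨w⟩ := hX'.nonempty Cardinal.aleph0_pos
    have : Nonempty X := ⟨(hext w).choose⟩
    have hinj : Set.InjOn f S := fun a ha b hb hab =>
      (hf.eq_iff _ ⟨a, ha, rfl⟩ _ ⟨b, hb, rfl⟩).2 hab
    have hP : ∀ a ∈ S, (P a ↔ P (f a)) := fun a ha => hf.P_iff _ ⟨a, ha, rfl⟩
    have hinv : ∀ a ∈ S, Function.invFunOn f S (f a) = a := fun a ha =>
      hinj.leftInvOn_invFunOn ha
    obtain ⟨x', hPx', hx', hA', hB'⟩ := hX'.obj (f '' A) (f '' B) (f '' Y)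
      (fun y => f (g (Function.invFunOn f S y)))
      (Cardinal.lt_aleph0_iff_set_finite.2 (hA.image f))
      (Cardinal.lt_aleph0_iff_set_finite.2 (hB.image f))
      (Cardinal.lt_aleph0_iff_set_finite.2 (hY.image f))
      (by rintro _ ⟨a, ha, rfl⟩; exact (hP a (hAS a ha)).1 (hPA a ha))
      (by rintro _ ⟨a, ha, rfl⟩; exact (hP a (hBS a ha)).1 (hPB a ha))
      (by
        rw [Set.disjoint_left]
        rintro _ ⟨a, ha, rfl⟩ ⟨b, hb, hab⟩
        rw [hinj (hBS b hb) (hAS a ha) hab] at hb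
        exact Set.disjoint_left.1 hAB ha hb)
      (by
        rintro _ ⟨a, ha, rfl⟩
        rw [hinv a (hAS a ha), ← hP _ (hgS a ha)]
        exact hg a ha)
    obtain ⟨x, hx⟩ := hext x'
    have hmem : ∀ a ∈ S, (a, f a) ∈ insert (x, x') ((fun s => (s, f s)) '' S) :=
      fun a ha => Or.inr ⟨a, ha, rfl⟩
    have hmem0 : (x, x') ∈ insert (x, x') ((fun s => (s, f s)) '' S) := Or.inl rfl
    refine ⟨x, fun h' => hPx' ((hx.P_iff _ hmem0).1 h'), fun hxY => hx' ⟨x, hxY, ?_⟩,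
      fun z hz => ?_, fun z hz y hy hE => ?_⟩
    · exact (hx.eq_iff _ (hmem x (hYS x hxY)) _ hmem0).1 rfl
    · have h1 := hA' _ ⟨z, hz, rfl⟩
      rw [hinv z (hAS z hz)] at h1
      exact (hx.E_iff _ (hmem z (hAS z hz)) _ hmem0 _ (hmem _ (hgS z hz))).2 h1
    · exact hB' _ ⟨z, hz, rfl⟩ _ ⟨y, hy, rfl⟩
        ((hx.E_iff _ (hmem z (hBS z hz)) _ hmem0 _ (hmem _ (hYS y hy))).1 hE)

end Feq

/-! ### Generic extensions -/

/-- Colours for the pairs of a parameter and an object. -/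
abbrev Colour (X : Type u) := Set (X ⊕ ℕ)

/-- The universe of the generic extension of `X`. A new element comes with a sequence `f` of
older elements and a sequence of colours for the pairs that it forms with them; two objects will be
equivalent for a parameter if they form pairs of the same colour with it. -/
inductive GenericExt (X : Type u) : Type u
  | base (x : X) : GenericExt X
  | new (isParam : Bool) (f : ℕ → GenericExt X) (c : ℕ → Colour X) : GenericExt X

namespace GenericExt

open Feq

variable {X : Type u}

/-- The elements to which a new element refers. -/
def args : GenericExt X → Set (GenericExt X)
  | base _ => ∅
  | new _ f _ => Set.range f

/-- Reference to older elements is acyclic. Hence at most one member of a pair prescribes the colour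
of the pair, and a new element differs from all the elements to which it refers. -/
theorem notMem_args_of_mem_args (a b : GenericExt X) (h : b ∈ args a) : a ∉ args b := by
  induction a generalizing b with
  | base x => exact absurd h (Set.notMem_empty _)
  | new e f c ih =>
    obtain ⟨i, rfl⟩ := h
    exact fun h' => ih i _ h' ⟨i, rfl⟩

theorem notMem_args_self (a : GenericExt X) : a ∉ args a := fun h =>
  notMem_args_of_mem_args a a h h

open Classical in
/-- The colour that `a` prescribes for the pair of `a` and `b`. -/
noncomputable def prescribed : GenericExt X → GenericExt X → Option (Colour X)
  | base _, _ => none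
  | new _ f c, b => if h : ∃ i, f i = b then some (c h.choose) else none

theorem prescribed_eq_none {a b : GenericExt X} (h : b ∉ args a) : prescribed a b = none := by
  cases a with
  | base => rfl
  | new e f c => exact dif_neg h

theorem prescribed_new {e : Bool} {f : ℕ → GenericExt X} {col : GenericExt X → Colour X}
    {b : GenericExt X} (h : b ∈ Set.range f) : prescribed (new e f (col ∘ f)) b = some (col b) := by
  have h' : ∃ i, f i = b := h
  rw [prescribed, dif_pos h', Function.comp_apply, h'.choose_spec]

theorem base_injective : Function.Injective (base : X → GenericExt X) := fun _ _ h => by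
  injection h

theorem exists_range_supset [Nonempty X] {S : Set (GenericExt X)} (hS : S.Countable) :
    ∃ f : ℕ → GenericExt X, S ⊆ Set.range f := by
  obtain ⟨f, hf⟩ := (hS.insert (base (Classical.arbitrary X))).exists_eq_range
    (Set.insert_nonempty _ _)
  exact ⟨f, hf ▸ Set.subset_insert _ _⟩

variable [Feq X]

/-- Being a parameter. -/
def isP : GenericExt X → Prop
  | base x => P x
  | new e _ _ => e = true

/-- The colour of a pair for which no colour is prescribed; for old elements it encodes the
class of the object. -/
def baseColour : GenericExt X → GenericExt X → Colour X
  | base z, base x => Sum.inl '' {y | E z x y}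
  | _, _ => ∅

/-- The colour of a parameter and an object. -/
noncomputable def colour (z x : GenericExt X) : Colour X :=
  (prescribed z x).getD ((prescribed x z).getD (baseColour z x))

noncomputable instance : Feq (GenericExt X) where
  P := isP
  E z x y := isP z ∧ ¬ isP x ∧ ¬ isP y ∧ colour z x = colour z y
  dom h := ⟨h.1, h.2.1, h.2.2.1⟩
  refl hz hx := ⟨hz, hx, hx, rfl⟩
  symm h := ⟨h.1, h.2.2.1, h.2.1, h.2.2.2.symm⟩
  trans h h' := ⟨h.1, h.2.1, h'.2.2.1, h.2.2.2.trans h'.2.2.2⟩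

theorem E_def (z x y : GenericExt X) :
    E z x y ↔ P z ∧ ¬ P x ∧ ¬ P y ∧ colour z x = colour z y := Iff.rfl

theorem base_P (x : X) : P (base x) ↔ P x := Iff.rfl

theorem base_E (z x y : X) : E (base z) (base x) (base y) ↔ E z x y := by
  rw [E_def, base_P, base_P, base_P]
  have hcol : ∀ w : X, colour (base z) (base w) = Sum.inl '' {y | E z w y} := fun _ => rfl
  rw [hcol, hcol, Sum.inl_injective.image_injective.eq_iff]
  constructor
  · rintro ⟨hz, -, hy, h⟩
    have : y ∈ {w | E z y w} := refl hz hy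
    rw [← h] at this
    exact this
  · intro h
    refine ⟨(dom h).1, (dom h).2.1, (dom h).2.2, ?_⟩
    ext w
    exact ⟨fun hw => trans (symm h) hw, fun hw => trans h hw⟩

theorem isGeneric [Nonempty X] : IsGeneric (GenericExt X) ℵ₁ where
  param Y Z C k hY hZ := by
    classical
    rw [Cardinal.lt_aleph_one_iff, Cardinal.le_aleph0_iff_set_countable] at hY hZ
    obtain ⟨f, hf⟩ := exists_range_supset (hY.union hZ)
    obtain ⟨e, he⟩ := Set.countable_iff_exists_injOn.1 hY
    -- the colour of an element of `Y` encodes its fibre for `k`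
    let col : GenericExt X → Colour X := fun y =>
      Sum.inr '' (e '' {y' | y' ∈ Y ∧ k y' = k y})
    have hcol : ∀ y ∈ Y, ∀ y' ∈ Y, (col y = col y' ↔ k y = k y') := by
      intro y hy y' hy'
      constructor
      · intro h
        have h := Set.image_injective.2 Sum.inr_injective h
        have hm : e y ∈ e '' {w | w ∈ Y ∧ k w = k y} := ⟨y, ⟨hy, rfl⟩, rfl⟩
        rw [h] at hm
        obtain ⟨w, ⟨hw, hkw⟩, hew⟩ := hm
        rw [← hkw, he hw hy hew]
      · intro h
        simp only [col, h]
    refine ⟨new true f (col ∘ f), rfl, fun hz => ?_, fun y hy y' hy' hPy hPy' => ?_⟩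
    · exact notMem_args_self (new _ f (col ∘ f)) (hf (.inr hz))
    · have hc : ∀ w ∈ Y, colour (new true f (col ∘ f)) w = col w := fun w hw => by
        rw [colour, prescribed_new (hf (.inl hw)), Option.getD_some]
      rw [E_def, hc y hy, hc y' hy', hcol y hy y' hy']
      exact ⟨fun h => h.2.2.2, fun h => ⟨rfl, hPy, hPy', h⟩⟩
  obj A B Y g hA hB hY hPA hPB hAB hg := by
    classical
    rw [Cardinal.lt_aleph_one_iff, Cardinal.le_aleph0_iff_set_countable] at hA hB hY
    obtain ⟨f, hf⟩ := exists_range_supset ((hA.union hB).union hY)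
    have hnew : ∀ z : GenericExt X, ∃ c : Colour X, ∀ y ∈ Y, c ≠ colour z y := by
      intro z
      have hcount : ((fun y => colour z y) '' Y).Countable := hY.image _
      have hunc : ¬ (Set.univ : Set (Colour X)).Countable := by
        rw [Set.countable_univ_iff, ← Cardinal.mk_le_aleph0_iff, not_le, Cardinal.mk_set]
        exact (Cardinal.aleph0_le_mk (X ⊕ ℕ)).trans_lt (Cardinal.cantor _)
      by_contra! hcon
      refine hunc (hcount.mono fun c _ => ?_)
      obtain ⟨y, hy, hc⟩ := hcon c
      exact ⟨y, hy, hc.symm⟩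
    choose nc hnc using hnew
    let col : GenericExt X → Colour X := fun z => if z ∈ A then colour z (g z) else nc z
    have hPx : ¬ P (new false f (col ∘ f)) := fun h : false = true => by simp at h
    have hc : ∀ z ∈ A ∪ B, colour z (new false f (col ∘ f)) = col z := fun w hw => by
      have hmem : w ∈ args (new false f (col ∘ f)) := hf (.inl hw)
      rw [colour, prescribed_eq_none (notMem_args_of_mem_args _ _ hmem), Option.getD_none,
        prescribed_new (hf (.inl hw)), Option.getD_some]
    refine ⟨new false f (col ∘ f), hPx, fun hz => ?_, fun z hz => ?_, fun z hz y hy hE => ?_⟩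
    · exact notMem_args_self (new _ f (col ∘ f)) (hf (.inr hz))
    · rw [E_def, hc z (.inl hz)]
      exact ⟨hPA z hz, hPx, hg z hz, if_pos hz⟩
    · have h1 := hE.2.2.2
      rw [hc z (.inr hz)] at h1
      simp only [col, if_neg (Set.disjoint_right.1 hAB hz)] at h1
      exact hnc z y hy h1

end GenericExt

/-! ### Ultrapowers of generic parametrized equivalence relations -/

/-- Fewer than `(#I)⁺` elements of the ultrapower have representatives of which only finitely many
are active at each point, and the active ones are pairwise distinct. -/
theorem exists_distribution {X I : Type u} {D : Ultrafilter I} [Infinite I]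
    (hreg : IsRegularUltrafilter D) (hD : GoodForEquality D)
    (W : Set (Germ (D : Filter I) X)) (hW : #W ≤ #I) :
    ∃ (rep : Germ (D : Filter I) X → I → X) (d : Germ (D : Filter I) X → Set I),
      (∀ a, (rep a : Germ (D : Filter I) X) = a) ∧ (∀ a ∈ W, d a ∈ D) ∧
      (∀ t, {a | a ∈ W ∧ t ∈ d a}.Finite) ∧
      ∀ t, ∀ a ∈ W, ∀ b ∈ W, t ∈ d a → t ∈ d b → rep a t = rep b t → a = b := by
  classical
  let rep : Germ (D : Filter I) X → I → X := Quotient.out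
  have hrep : ∀ a, (rep a : Germ (D : Filter I) X) = a := fun a => Quotient.out_eq a
  obtain ⟨Z, hZ, hZfin⟩ := hreg.exists_family W hW
  obtain ⟨d, hd, hinj⟩ := hD W X hW (fun a => rep a) fun a b hab => by
    rw [Ultrafilter.eventually_not]
    intro h
    apply hab
    have := Germ.coe_eq.2 h
    rw [hrep, hrep] at this
    exact Subtype.ext this
  refine ⟨rep, fun a => if h : a ∈ W then Z ⟨a, h⟩ ∩ d ⟨a, h⟩ else ∅, hrep, fun a ha => ?_,
    fun t => ?_, fun t a ha b hb hta htb hab => ?_⟩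
  · simp only [dif_pos ha]
    exact Filter.inter_mem (hZ _) (hd _)
  · refine ((hZfin t).image Subtype.val).subset ?_
    rintro a ⟨ha, hta⟩
    simp only [dif_pos ha] at hta
    exact ⟨⟨a, ha⟩, hta.1, rfl⟩
  · simp only [dif_pos ha] at hta
    simp only [dif_pos hb] at htb
    by_contra hne
    exact hinj t ⟨a, ha⟩ ⟨b, hb⟩ hta.2 htb.2 (fun h => hne (congrArg Subtype.val h)) hab

namespace Feq

variable {X : Type u} [Feq X] {I : Type u} (D : Ultrafilter I)

instance : Feq (Germ (D : Filter I) X) where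
  P a := a.LiftPred P
  E a b c := ∃ f g h : I → X, (f : Germ (D : Filter I) X) = a ∧ (g : Germ (D : Filter I) X) = b ∧
    (h : Germ (D : Filter I) X) = c ∧ ∀ᶠ t in (D : Filter I), E (f t) (g t) (h t)
  dom := by
    rintro _ _ _ ⟨f, g, h, rfl, rfl, rfl, H⟩
    simp only [Germ.liftPred_coe, ← Ultrafilter.eventually_not]
    exact ⟨H.mono fun t h => (dom h).1, H.mono fun t h => (dom h).2.1,
      H.mono fun t h => (dom h).2.2⟩
  refl := by
    intro a b
    induction a using Germ.inductionOn with | _ f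
    induction b using Germ.inductionOn with | _ g
    simp only [Germ.liftPred_coe, ← Ultrafilter.eventually_not]
    intro ha hb
    exact ⟨f, g, g, rfl, rfl, rfl, by filter_upwards [ha, hb] with t h h' using refl h h'⟩
  symm := by
    rintro _ _ _ ⟨f, g, h, rfl, rfl, rfl, H⟩
    exact ⟨f, h, g, rfl, rfl, rfl, H.mono fun t h => symm h⟩
  trans := by
    rintro _ _ _ _ ⟨f, g, h, rfl, rfl, rfl, H⟩ ⟨f', g', h', hf, hg, rfl, H'⟩
    refine ⟨f, g, h', rfl, rfl, rfl, ?_⟩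
    filter_upwards [H, H', Germ.coe_eq.1 hf, Germ.coe_eq.1 hg] with t h1 h2 h3 h4
    rw [h3, h4] at h2
    exact trans h1 h2

theorem germ_P (f : I → X) :
    P (f : Germ (D : Filter I) X) ↔ ∀ᶠ t in (D : Filter I), P (f t) := Iff.rfl

theorem germ_not_P (f : I → X) :
    ¬ P (f : Germ (D : Filter I) X) ↔ ∀ᶠ t in (D : Filter I), ¬ P (f t) := by
  rw [Ultrafilter.eventually_not]; rfl

theorem germ_E (f g h : I → X) : E (f : Germ (D : Filter I) X) (g : Germ (D : Filter I) X)
    (h : Germ (D : Filter I) X) ↔ ∀ᶠ t in (D : Filter I), E (f t) (g t) (h t) := by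
  constructor
  · rintro ⟨f', g', h', hf, hg, hh, H⟩
    filter_upwards [H, Germ.coe_eq.1 hf, Germ.coe_eq.1 hg, Germ.coe_eq.1 hh] with t h1 h2 h3 h4
    rwa [h2, h3, h4] at h1
  · exact fun H => ⟨f, g, h, rfl, rfl, rfl, H⟩

variable {D}

/-- If `D` is regular and good for equality, then the ultrapower of a generic structure is generic
for sets of the size of the index set. Only equalities between the elements that are active at a
point have to be under control: objects alone can be partitioned in any way, and distinct parameters
can put a new object into any of their classes. -/
theorem IsGeneric.germ [Infinite I] (hX : IsGeneric X ℵ₀) (hreg : IsRegularUltrafilter D)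
    (hD : GoodForEquality D) : IsGeneric (Germ (D : Filter I) X) (Order.succ #I) where
  param Y Z C k hY hZ := by
    classical
    rw [Order.lt_succ_iff] at hY hZ
    obtain ⟨rep, d, hrep, hd, hfin, hinj⟩ := exists_distribution hreg hD (Y ∪ Z)
      ((Cardinal.mk_union_le _ _).trans (Cardinal.add_le_of_le (Cardinal.aleph0_le_mk I) hY hZ))
    have hYW : ∀ a ∈ Y, a ∈ Y ∪ Z := fun a ha => .inl ha
    have hsol : ∀ t, ∃ z : X, P z ∧ (∀ a ∈ Z, t ∈ d a → z ≠ rep a t) ∧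
        ∀ y ∈ Y, ∀ y' ∈ Y, t ∈ d y → t ∈ d y' → ¬ P (rep y t) → ¬ P (rep y' t) →
          (E z (rep y t) (rep y' t) ↔ k y = k y') := by
      intro t
      have hf : ∀ S ⊆ Y ∪ Z, #((fun a => rep a t) '' {a | a ∈ S ∧ t ∈ d a}) < ℵ₀ := fun S hS =>
        Cardinal.lt_aleph0_iff_set_finite.2
          (((hfin t).subset fun a ha => ⟨hS ha.1, ha.2⟩).image _)
      let k' : X → Option C := fun x =>
        if h : ∃ a, (a ∈ Y ∧ t ∈ d a) ∧ rep a t = x then some (k h.choose) else none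
      have hk' : ∀ a ∈ Y, t ∈ d a → k' (rep a t) = some (k a) := by
        intro a ha hta
        have h : ∃ b, (b ∈ Y ∧ t ∈ d b) ∧ rep b t = rep a t := ⟨a, ⟨ha, hta⟩, rfl⟩
        have h2 := h.choose_spec
        have h3 : h.choose = a :=
          hinj t _ (hYW _ h2.1.1) a (hYW a ha) h2.1.2 hta h2.2
        simp only [k']
        rw [dif_pos h, h3]
      obtain ⟨z, hPz, hzZ, hE⟩ := hX.param _ _ (Option C) k' (hf Y Set.subset_union_left)
        (hf Z Set.subset_union_right)
      refine ⟨z, hPz, fun a ha hta h => hzZ ⟨a, ⟨ha, hta⟩, h.symm⟩,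
        fun y hy y' hy' ht ht' hP hP' => ?_⟩
      rw [hE _ ⟨y, ⟨hy, ht⟩, rfl⟩ _ ⟨y', ⟨hy', ht'⟩, rfl⟩ hP hP', hk' y hy ht, hk' y' hy' ht',
        Option.some_inj]
    choose z hPz hzZ hE using hsol
    refine ⟨(z : Germ (D : Filter I) X), (germ_P D z).2 (Eventually.of_forall hPz), fun hz => ?_,
      fun y hy y' hy' hP hP' => ?_⟩
    · have h1 := hrep z
      have h2 := (Germ.coe_eq.1 h1).and (hd z (.inr hz))
      obtain ⟨t, ht, ht'⟩ := h2.exists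
      exact hzZ t z hz ht' ht.symm
    · rw [← hrep y, germ_not_P] at hP
      rw [← hrep y', germ_not_P] at hP'
      have hev : ∀ᶠ t in (D : Filter I), (E (z t) (rep y t) (rep y' t) ↔ k y = k y') := by
        filter_upwards [hP, hP', hd y (.inl hy), hd y' (.inl hy')] with t h1 h2 h3 h4
        exact hE t y hy y' hy' h3 h4 h1 h2
      have h0 : E (z : Germ (D : Filter I) X) y y' ↔
          ∀ᶠ t in (D : Filter I), E (z t) (rep y t) (rep y' t) := by
        rw [← germ_E, hrep, hrep]
      rw [h0, eventually_congr hev, eventually_const]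
  obj A B Y g hA hB hY hPA hPB hAB hg := by
    classical
    rw [Order.lt_succ_iff] at hA hB hY
    obtain ⟨rep, d, hrep, hd, hfin, hinj⟩ := exists_distribution hreg hD ((A ∪ B) ∪ Y) (by
      have hI := Cardinal.aleph0_le_mk I
      refine (Cardinal.mk_union_le _ _).trans (Cardinal.add_le_of_le hI ?_ hY)
      exact (Cardinal.mk_union_le _ _).trans (Cardinal.add_le_of_le hI hA hB))
    have hAW : ∀ a ∈ A, a ∈ (A ∪ B) ∪ Y := fun a ha => .inl (.inl ha)
    have hBW : ∀ a ∈ B, a ∈ (A ∪ B) ∪ Y := fun a ha => .inl (.inr ha)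
    have hsol : ∀ t, ∃ x : X, ¬ P x ∧ (∀ a ∈ Y, t ∈ d a → x ≠ rep a t) ∧
        (∀ z ∈ A, t ∈ d z → P (rep z t) → ¬ P (rep (g z) t) → E (rep z t) x (rep (g z) t)) ∧
        ∀ z ∈ B, t ∈ d z → P (rep z t) → ∀ y ∈ Y, t ∈ d y → ¬ E (rep z t) x (rep y t) := by
      intro t
      have hf : ∀ S ⊆ {a | a ∈ (A ∪ B) ∪ Y ∧ t ∈ d a}, #((fun a => rep a t) '' S) < ℵ₀ :=
        fun S hS => Cardinal.lt_aleph0_iff_set_finite.2 (((hfin t).subset hS).image _)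
      let A' := {z | z ∈ A ∧ t ∈ d z ∧ P (rep z t) ∧ ¬ P (rep (g z) t)}
      let B' := {z | z ∈ B ∧ t ∈ d z ∧ P (rep z t)}
      let g' : X → X := fun x =>
        if h : ∃ a ∈ A', rep a t = x then rep (g h.choose) t else x
      have hg' : ∀ a ∈ A', g' (rep a t) = rep (g a) t := by
        intro a ha
        have h : ∃ b ∈ A', rep b t = rep a t := ⟨a, ha, rfl⟩
        have h2 := h.choose_spec
        have h3 : h.choose = a :=
          hinj t _ (hAW _ h2.1.1) a (hAW a ha.1) h2.1.2.1 ha.2.1 h2.2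
        simp only [g']
        rw [dif_pos h, h3]
      obtain ⟨x, hPx, hxY, hxA, hxB⟩ := hX.obj ((fun a => rep a t) '' A')
        ((fun a => rep a t) '' B') ((fun a => rep a t) '' {a | a ∈ Y ∧ t ∈ d a}) g'
        (hf _ fun a ha => ⟨hAW a ha.1, ha.2.1⟩) (hf _ fun a ha => ⟨hBW a ha.1, ha.2.1⟩)
        (hf _ fun a ha => ⟨.inr ha.1, ha.2⟩)
        (by rintro _ ⟨a, ha, rfl⟩; exact ha.2.2.1)
        (by rintro _ ⟨a, ha, rfl⟩; exact ha.2.2)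
        (by
          rw [Set.disjoint_left]
          rintro _ ⟨a, ha, rfl⟩ ⟨b, hb, hab⟩
          have := hinj t b (hBW b hb.1) a (hAW a ha.1) hb.2.1 ha.2.1 hab
          exact Set.disjoint_left.1 hAB ha.1 (this ▸ hb.1))
        (by rintro _ ⟨a, ha, rfl⟩; rw [hg' a ha]; exact ha.2.2.2)
      refine ⟨x, hPx, fun a ha hta h => hxY ⟨a, ⟨ha, hta⟩, h.symm⟩, fun z hz htz hP hP' => ?_,
        fun z hz htz hP y hy hty => hxB _ ⟨z, ⟨hz, htz, hP⟩, rfl⟩ _ ⟨y, ⟨hy, hty⟩, rfl⟩⟩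
      have := hxA _ ⟨z, ⟨hz, htz, hP, hP'⟩, rfl⟩
      rwa [hg' z ⟨hz, htz, hP, hP'⟩] at this
    choose x hPx hxY hxA hxB using hsol
    refine ⟨(x : Germ (D : Filter I) X), (germ_not_P D x).2 (Eventually.of_forall hPx),
      fun hx => ?_, fun z hz => ?_, fun z hz y hy hE => ?_⟩
    · have h1 := hrep x
      have h2 := (Germ.coe_eq.1 h1).and (hd x (.inr hx))
      obtain ⟨t, ht, ht'⟩ := h2.exists
      exact hxY t x hx ht' ht.symm
    · have h1 := hPA z hz
      have h2 := hg z hz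
      rw [← hrep z, germ_P] at h1
      rw [← hrep (g z), germ_not_P] at h2
      have h0 := germ_E D (rep z) x (rep (g z))
      rw [hrep, hrep] at h0
      rw [h0]
      filter_upwards [h1, h2, hd z (hAW z hz)] with t h1 h2 h3
      exact hxA t z hz h3 h1 h2
    · have h1 := hPB z hz
      rw [← hrep z, germ_P] at h1
      rw [← hrep z, ← hrep y, germ_E] at hE
      obtain ⟨t, h1, h2, h3, h4⟩ :=
        (h1.and (hE.and ((show ∀ᶠ t in (D : Filter I), t ∈ d z from hd z (hBW z hz)).and
          (hd y (.inr hy))))).exists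
      exact hxB t z hz h3 h1 y hy h4 h2

end Feq

/-! ### Parametrized equivalence relations as real-valued structures -/

/-- The atomic formulas with variables in `ι`: for `P`, `Q`, `E` and the distance. -/
abbrev Atom (ι : Type*) := ((Fin 1 → ι) ⊕ (Fin 1 → ι)) ⊕ ((Fin 3 → ι) ⊕ (Fin 2 → ι))

/-- Renaming of the variables of an atomic formula. -/
def Atom.map {ι ι' : Type*} (f : ι → ι') : Atom ι → Atom ι' :=
  Sum.map (Sum.map (f ∘ ·) (f ∘ ·)) (Sum.map (f ∘ ·) (f ∘ ·))

/-- The truth values of all atomic formulas. -/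
def RVStructure.atomVal (M : RVStructure.{u} (withDist feqLang)) {ι : Type*} (xs : ι → M) :
    Atom ι → unitInterval
  | .inl (.inl i) => M.relMap (Sum.inl FeqRel.P) (xs ∘ i)
  | .inl (.inr i) => M.relMap (Sum.inl FeqRel.Q) (xs ∘ i)
  | .inr (.inl i) => M.relMap (Sum.inl FeqRel.E) (xs ∘ i)
  | .inr (.inr i) => M.relMap (Sum.inr DistSymbol.dist) (xs ∘ i)

theorem RVStructure.atomVal_comp (M : RVStructure.{u} (withDist feqLang)) {ι ι' : Type*}
    (xs : ι → M) (f : ι' → ι) : M.atomVal (xs ∘ f) = M.atomVal xs ∘ Atom.map f := by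
  funext a; rcases a with (a | a) | (a | a) <;> rfl

namespace Feq

variable {X X' : Type u} [Feq X] [Feq X']

/-- The truth of atomic formulas. -/
def Holds {ι : Type*} (ys : ι → X) : Atom ι → Prop
  | .inl (.inl i) => P (ys (i 0))
  | .inl (.inr i) => ¬ P (ys (i 0))
  | .inr (.inl i) => E (ys (i 0)) (ys (i 1)) (ys (i 2))
  | .inr (.inr i) => ys (i 0) = ys (i 1)

theorem isPartIso_range_iff {ι : Type*} (xs : ι → X) (ys : ι → X') :
    IsPartIso (Set.range fun i => (xs i, ys i)) ↔ ∀ a, Holds xs a ↔ Holds ys a := by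
  constructor
  · intro h a
    have hm : ∀ i, (xs i, ys i) ∈ Set.range fun i => (xs i, ys i) := fun i => ⟨i, rfl⟩
    rcases a with (a | a) | (a | a)
    · exact h.P_iff _ (hm _)
    · exact not_congr (h.P_iff _ (hm _))
    · exact h.E_iff _ (hm _) _ (hm _) _ (hm _)
    · exact h.eq_iff _ (hm _) _ (hm _)
  · intro h
    refine ⟨?_, ?_, ?_⟩
    · rintro _ ⟨i, rfl⟩ _ ⟨j, rfl⟩
      exact h (.inr (.inr ![i, j]))
    · rintro _ ⟨i, rfl⟩
      exact h (.inl (.inl ![i]))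
    · rintro _ ⟨i, rfl⟩ _ ⟨j, rfl⟩ _ ⟨k, rfl⟩
      exact h (.inr (.inl ![i, j, k]))

open Classical in
/-- The truth of atomic formulas, as numbers. -/
noncomputable def atomVal {ι : Type*} (ys : ι → X) (a : Atom ι) : unitInterval :=
  if Holds ys a then 0 else 1

theorem atomVal_apply_eq_iff {ι ι' : Type*} (xs : ι → X) (ys : ι' → X') (a : Atom ι)
    (b : Atom ι') : atomVal xs a = atomVal ys b ↔ (Holds xs a ↔ Holds ys b) := by
  by_cases h : Holds xs a <;> by_cases h' : Holds ys b <;> simp [atomVal, h, h']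

theorem atomVal_eq_iff {ι : Type*} (xs : ι → X) (ys : ι → X') :
    atomVal xs = atomVal ys ↔ ∀ a, Holds xs a ↔ Holds ys a := by
  rw [funext_iff]
  exact forall_congr' fun a => atomVal_apply_eq_iff xs ys a a

theorem atomVal_mem {ι : Type*} (ys : ι → X) (a : Atom ι) :
    atomVal ys a ∈ ({0, 1} : Set unitInterval) := by
  by_cases h : Holds ys a <;> simp [atomVal, h]

theorem atomVal_comp {ι ι' : Type*} (ys : ι → X) (f : ι' → ι) :
    atomVal (ys ∘ f) = atomVal ys ∘ Atom.map f := by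
  classical
  funext a; rcases a with (a | a) | (a | a) <;> rfl

end Feq

open Feq

/-- The real-valued structure `M` becomes the parametrized equivalence relation `X` when elements at
distance `0` are identified by `π`. -/
structure Represents (M : RVStructure.{u} (withDist feqLang)) {X : Type u} [Feq X] (π : M → X) :
    Prop where
  surj : Function.Surjective π
  atomVal_eq : M.atomVal id = Feq.atomVal π

section Represents

variable {X X' : Type u} [Feq X] [Feq X'] {M M' : RVStructure.{u} (withDist feqLang)}
  {π : M → X} {π' : M' → X'}

theorem Represents.atomVal_apply (h : Represents M π) {ι : Type*} (xs : ι → M) :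
    M.atomVal xs = Feq.atomVal (π ∘ xs) := by
  rw [Feq.atomVal_comp, ← h.atomVal_eq, ← M.atomVal_comp, Function.id_comp]

/-! ### Saturation of generic structures and of their ultrapowers -/

theorem iInf_eq_of_back_and_forth {A B : Type*} {f : A → unitInterval} {g : B → unitInterval}
    (h₁ : ∀ a, ∃ b, f a = g b) (h₂ : ∀ b, ∃ a, f a = g b) : ⨅ a, f a = ⨅ b, g b := by
  refine congrArg sInf (Set.Subset.antisymm ?_ ?_)
  · rintro _ ⟨a, rfl⟩
    obtain ⟨b, hb⟩ := h₁ a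
    exact ⟨b, hb.symm⟩
  · rintro _ ⟨b, rfl⟩
    exact h₂ b

theorem iSup_eq_of_back_and_forth {A B : Type*} {f : A → unitInterval} {g : B → unitInterval}
    (h₁ : ∀ a, ∃ b, f a = g b) (h₂ : ∀ b, ∃ a, f a = g b) : ⨆ a, f a = ⨆ b, g b := by
  refine congrArg sSup (Set.Subset.antisymm ?_ ?_)
  · rintro _ ⟨a, rfl⟩
    obtain ⟨b, hb⟩ := h₁ a
    exact ⟨b, hb.symm⟩
  · rintro _ ⟨b, rfl⟩
    exact h₂ b

/-- Finite partial isomorphisms between generic structures preserve all truth values, by a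
back-and-forth argument. -/
theorem value_eq_of_isPartIso (hM : Represents M π) (hM' : Represents M' π')
    (hX : IsGeneric X ℵ₀) (hX' : IsGeneric X' ℵ₀) {α : Type*} {n : ℕ}
    (φ : CFormula (withDist feqLang) α n) {R : Set (X × X')} (hR : IsPartIso R) (hfin : R.Finite)
    (v : α → M) (v' : α → M') (xs : Fin n → M) (xs' : Fin n → M')
    (hv : ∀ a ∈ φ.freeVars, (π (v a), π' (v' a)) ∈ R) (hx : ∀ i, (π (xs i), π' (xs' i)) ∈ R) :
    M.value φ v xs = M'.value φ v' xs' := by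
  classical
  induction φ generalizing R with
  | @atom n l r ts =>
    have ht : ∀ i, (π (M.termVal (Sum.elim v xs) (ts i)),
        π' (M'.termVal (Sum.elim v' xs') (ts i))) ∈ R := by
      intro i
      have hsub : ∀ a ∈ (ts i).varFinsetLeft, (π (v a), π' (v' a)) ∈ R := fun a ha => by
        refine hv a ?_
        rw [CFormula.freeVars, Finset.mem_biUnion]
        exact ⟨i, Finset.mem_univ _, ha⟩
      generalize ts i = t at hsub
      rcases t with (a | j) | ⟨F, -⟩
      · exact hsub a (by simp [FirstOrder.Language.Term.varFinsetLeft])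
      · exact hx j
      · exact Empty.elim F
    have key : ∀ (a : Atom (Fin l)), M.atomVal (fun i => M.termVal (Sum.elim v xs) (ts i)) a =
        M'.atomVal (fun i => M'.termVal (Sum.elim v' xs') (ts i)) a := by
      intro a
      rw [hM.atomVal_apply, hM'.atomVal_apply]
      refine congrFun ((Feq.atomVal_eq_iff _ _).2 ((isPartIso_range_iff _ _).1 (hR.mono ?_))) a
      rintro _ ⟨i, rfl⟩
      exact ht i
    rcases r with r | r
    · cases r with
      | P => exact key (.inl (.inl id))
      | Q => exact key (.inl (.inr id))
      | E => exact key (.inr (.inl id))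
    · cases r with
      | dist => exact key (.inr (.inr id))
  | conn c φs ih =>
    simp only [RVStructure.value]
    congr 1; funext i
    refine ih i hR hfin _ _ (fun a ha => hv a ?_) hx
    rw [CFormula.freeVars, Finset.mem_biUnion]
    exact ⟨i, Finset.mem_univ _, ha⟩
  | inf φ ih =>
    simp only [RVStructure.value]
    refine iInf_eq_of_back_and_forth (fun a => ?_) (fun a' => ?_)
    · obtain ⟨y, hy⟩ := hX'.extend hR (Cardinal.lt_aleph0_iff_set_finite.2 hfin) (π a)
      obtain ⟨a', rfl⟩ := hM'.surj y
      refine ⟨a', ih hy (hfin.insert _) _ _ (fun b hb => .inr (hv b hb)) fun i => ?_⟩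
      induction i using Fin.lastCases with
      | last => simp
      | cast i => simpa using .inr (hx i)
    · obtain ⟨y, hy⟩ := hX.extend hR.swap
        (Cardinal.lt_aleph0_iff_set_finite.2 (hfin.image _)) (π' a')
      obtain ⟨a, rfl⟩ := hM.surj y
      have hy' := hy.swap
      rw [Set.image_insert_eq, Set.image_image] at hy'
      simp only [Prod.swap_swap, Set.image_id', Prod.swap_prod_mk] at hy'
      refine ⟨a, ih hy' (hfin.insert _) _ _ (fun b hb => .inr (hv b hb)) fun i => ?_⟩
      induction i using Fin.lastCases with
      | last => simp
      | cast i => simpa using .inr (hx i)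
  | sup φ ih =>
    simp only [RVStructure.value]
    refine iSup_eq_of_back_and_forth (fun a => ?_) (fun a' => ?_)
    · obtain ⟨y, hy⟩ := hX'.extend hR (Cardinal.lt_aleph0_iff_set_finite.2 hfin) (π a)
      obtain ⟨a', rfl⟩ := hM'.surj y
      refine ⟨a', ih hy (hfin.insert _) _ _ (fun b hb => .inr (hv b hb)) fun i => ?_⟩
      induction i using Fin.lastCases with
      | last => simp
      | cast i => simpa using .inr (hx i)
    · obtain ⟨y, hy⟩ := hX.extend hR.swap
        (Cardinal.lt_aleph0_iff_set_finite.2 (hfin.image _)) (π' a')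
      obtain ⟨a, rfl⟩ := hM.surj y
      have hy' := hy.swap
      rw [Set.image_insert_eq, Set.image_image] at hy'
      simp only [Prod.swap_swap, Set.image_id', Prod.swap_prod_mk] at hy'
      refine ⟨a, ih hy' (hfin.insert _) _ _ (fun b hb => .inr (hv b hb)) fun i => ?_⟩
      induction i using Fin.lastCases with
      | last => simp
      | cast i => simpa using .inr (hx i)

/-- A structure with a `κ`-generic quotient is `κ`-saturated. A type is given by an ultrafilter `U`
of `n`-tuples; the tuple of coordinate functions in the ultrapower modulo `U` is then embedded over
the parameters, one coordinate at a time. -/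
theorem Represents.isSaturated (hM : Represents M π) {κ : Cardinal.{u}} (hκ : ℵ₀ ≤ κ)
    (hX : IsGeneric X κ) : M.IsSaturated κ := by
  classical
  intro A hA n Γ hΓ
  let val : CFormula (withDist feqLang) (A ⊕ Fin n) 0 → (Fin n → M) → unitInterval :=
    fun φ x => M.val φ (Sum.elim (fun a : A => (a : M)) x)
  let 𝓕 : Set (Set (Fin n → M)) := (fun φ => {x | val φ x = 0}) '' Γ
  have hne : (Filter.generate 𝓕).NeBot := by
    rw [Filter.generate_neBot_iff]
    intro t ht hfin
    obtain ⟨s, hs, hsfin, rfl⟩ := Set.exists_subset_image_finite_and.1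
      ⟨t, ht, hfin, (rfl : t = t)⟩
    obtain ⟨x, hx⟩ := hΓ s hs hsfin
    refine ⟨x, ?_⟩
    rintro _ ⟨φ, hφ, rfl⟩
    exact hx φ hφ
  let U : Ultrafilter (Fin n → M) := Ultrafilter.of (Filter.generate 𝓕)
  have hU : ∀ φ ∈ Γ, ∀ᶠ x in (U : Filter (Fin n → M)), val φ x = 0 := fun φ hφ =>
    Ultrafilter.of_le _ (Filter.mem_generate_of_mem ⟨φ, hφ, rfl⟩)
  -- the graph of the inclusion of the parameters
  let toGerm : ((Fin n → M) → X) → Germ (U : Filter (Fin n → M)) X := fun f => f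
  let R₀ : Set (Germ (U : Filter (Fin n → M)) X × X) :=
    Set.range fun a : A => (toGerm fun _ => π a, π a)
  have hR₀ : IsPartIso R₀ := by
    refine ⟨?_, ?_, ?_⟩
    · rintro _ ⟨a, rfl⟩ _ ⟨b, rfl⟩
      simp only [toGerm, Germ.coe_eq]
      exact eventually_const
    · rintro _ ⟨a, rfl⟩
      exact (germ_P U _).trans eventually_const
    · rintro _ ⟨a, rfl⟩ _ ⟨b, rfl⟩ _ ⟨c, rfl⟩
      exact (germ_E U _ _ _).trans eventually_const
  have hR₀c : #R₀ < κ := Cardinal.mk_range_le.trans_lt hA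
  have hext : ∀ k ≤ n, ∃ (R : Set (Germ (U : Filter (Fin n → M)) X × X)) (x : Fin n → M),
      IsPartIso R ∧ #R < κ ∧ R₀ ⊆ R ∧
        ∀ i : Fin n, (i : ℕ) < k → (toGerm fun y => π (y i), π (x i)) ∈ R := by
    intro k
    induction k with
    | zero => exact fun _ => ⟨R₀, fun _ => Classical.arbitrary M, hR₀, hR₀c, subset_rfl,
        fun i hi => absurd hi (Nat.not_lt_zero _)⟩
    | succ k ih =>
      intro hk
      obtain ⟨R, x, hR, hRc, hsub, hx⟩ := ih (by omega)
      obtain ⟨y, hy⟩ := hX.extend hR hRc (toGerm fun y => π (y ⟨k, hk⟩))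
      obtain ⟨z, rfl⟩ := hM.surj y
      refine ⟨_, Function.update x ⟨k, hk⟩ z, hy, ?_, hsub.trans (Set.subset_insert _ _), ?_⟩
      · refine Cardinal.mk_insert_le.trans_lt (Cardinal.add_lt_of_lt hκ hRc ?_)
        exact Cardinal.one_lt_aleph0.trans_le hκ
      · intro i hi
        by_cases hik : i = ⟨k, hk⟩
        · subst hik
          simp
        · have : (i : ℕ) < k := by
            have : (i : ℕ) ≠ k := fun h => hik (Fin.ext h)
            omega
          rw [Function.update_of_ne hik]
          exact .inr (hx i this)
  obtain ⟨R, x, hR, -, hsub, hx⟩ := hext n le_rfl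
  refine ⟨x, fun φ hφ => ?_⟩
  -- at almost all tuples `y` the map `y ↦ x` over the parameters of `φ` is a partial isomorphism
  let fn : A ⊕ Fin n → (Fin n → M) → X := Sum.elim (fun a _ => π a) fun i y => π (y i)
  let im : A ⊕ Fin n → X := Sum.elim (fun a => π a) fun i => π (x i)
  have hmem : ∀ j, (toGerm (fn j), im j) ∈ R := by
    rintro (a | i)
    · exact hsub ⟨a, rfl⟩
    · exact hx i i.2
  have hcase : ∀ (p : (Fin n → M) → Prop) (q : Prop),
      ((∀ᶠ y in (U : Filter (Fin n → M)), p y) ↔ q) →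
        ∀ᶠ y in (U : Filter (Fin n → M)), (p y ↔ q) := by
    intro p q h
    by_cases hq : q
    · simpa [hq] using h
    · simp only [hq, iff_false] at h ⊢
      exact Ultrafilter.eventually_not.2 h
  have hev : ∀ᶠ y in (U : Filter (Fin n → M)),
      IsPartIso (Set.range fun j : φ.freeVars => (fn j y, im j)) := by
    have h1 : ∀ᶠ y in (U : Filter (Fin n → M)), ∀ i j : φ.freeVars,
        fn i y = fn j y ↔ im i = im j :=
      eventually_all.2 fun i => eventually_all.2 fun j => hcase _ _ (by
        rw [← hR.eq_iff _ (hmem i) _ (hmem j)]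
        exact Germ.coe_eq.symm)
    have h2 : ∀ᶠ y in (U : Filter (Fin n → M)), ∀ i : φ.freeVars, P (fn i y) ↔ P (im i) :=
      eventually_all.2 fun i => hcase _ _ (by
        rw [← hR.P_iff _ (hmem i)]
        exact (germ_P U _).symm)
    have h3 : ∀ᶠ y in (U : Filter (Fin n → M)), ∀ i j k : φ.freeVars,
        E (fn i y) (fn j y) (fn k y) ↔ E (im i) (im j) (im k) :=
      eventually_all.2 fun i => eventually_all.2 fun j => eventually_all.2 fun k =>
        hcase _ _ (by
          rw [← hR.E_iff _ (hmem i) _ (hmem j) _ (hmem k)]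
          exact (germ_E U _ _ _).symm)
    filter_upwards [h1, h2, h3] with y h1 h2 h3
    refine ⟨?_, ?_, ?_⟩
    · rintro _ ⟨i, rfl⟩ _ ⟨j, rfl⟩
      exact h1 i j
    · rintro _ ⟨i, rfl⟩
      exact h2 i
    · rintro _ ⟨i, rfl⟩ _ ⟨j, rfl⟩ _ ⟨k, rfl⟩
      exact h3 i j k
  obtain ⟨y, hy, hφy⟩ := (hev.and (hU φ hφ)).exists
  rw [← hφy]
  have hX₀ := hX.mono hκ
  refine (value_eq_of_isPartIso hM hM hX₀ hX₀ φ hy (Set.finite_range _) _ _ _ _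
    (fun j hj => ?_) fun i => i.elim0).symm
  refine ⟨⟨j, hj⟩, ?_⟩
  rcases j with j | j <;> rfl

open Classical in
theorem ulim_ite {I : Type*} (D : Ultrafilter I) (p : I → Prop) :
    RVStructure.ulim D (fun t => if p t then (0 : unitInterval) else 1) =
      if ∀ᶠ t in (D : Filter I), p t then 0 else 1 := by
  refine RVStructure.ulim_eq (tendsto_const_nhds.congr' ?_)
  split_ifs with h
  · filter_upwards [h] with t ht
    rw [if_pos ht]
  · rw [← Ultrafilter.eventually_not] at h
    filter_upwards [h] with t ht
    rw [if_neg ht]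

/-- Ultrapowers of real-valued structures represent ultrapowers. -/
theorem Represents.ultrapower (hM : Represents M π) {I : Type u} (D : Ultrafilter I) :
    ∃ π' : M.ultrapower D → Germ (D : Filter I) X, Represents (M.ultrapower D) π' := by
  classical
  have hatom : ∀ {ι : Type} (f : ι → I → M) (a : Atom ι),
      (M.ultrapower D).atomVal (fun i => M.toUltrapower D (f i)) a =
        Feq.atomVal (fun i => ((π ∘ f i : I → X) : Germ (D : Filter I) X)) a := by
    intro ι f a
    have h1 : (M.ultrapower D).atomVal (fun i => M.toUltrapower D (f i)) a =
        RVStructure.ulim D fun t => M.atomVal (fun i => f i t) a := by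
      rcases a with (a | a) | (a | a) <;>
        exact (M.preUltrapower D).reduction_relMap _ fun i => f (a i)
    rw [h1]
    simp only [hM.atomVal_apply, Feq.atomVal]
    rw [ulim_ite]
    congr 1
    rcases a with (a | a) | (a | a)
    · exact propext (germ_P D _).symm
    · exact propext (germ_not_P D _).symm
    · exact propext (germ_E D _ _ _).symm
    · exact propext Germ.coe_eq.symm
  have hwd : ∀ f g : I → M, (M.preUltrapower D).LeibnizEq f g →
      ((π ∘ f : I → X) : Germ (D : Filter I) X) = ((π ∘ g : I → X) : Germ (D : Filter I) X) := by
    intro f g hfg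
    have hq : M.toUltrapower D f = M.toUltrapower D g := Quotient.sound hfg
    have h1 := hatom ![f, g] (.inr (.inr ![0, 1]))
    have h2 := hatom ![g, g] (.inr (.inr ![0, 1]))
    have e : (fun i => M.toUltrapower D ((![f, g] : Fin 2 → I → M) i)) =
        fun i => M.toUltrapower D ((![g, g] : Fin 2 → I → M) i) := by
      funext i
      fin_cases i
      · exact hq
      · rfl
    rw [e, h2] at h1
    exact ((atomVal_apply_eq_iff _ _ _ _).1 h1).1 rfl
  let π' : M.ultrapower D → Germ (D : Filter I) X :=
    Quotient.lift (s := (M.preUltrapower D).leibnizSetoid)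
      (fun f => ((π ∘ (show I → M from f) : I → X) : Germ (D : Filter I) X)) hwd
  refine ⟨π', ⟨fun a => ?_, ?_⟩⟩
  · induction a using Germ.inductionOn with | _ f
    choose g hg using fun t => hM.surj (f t)
    refine ⟨M.toUltrapower D g, ?_⟩
    change ((π ∘ g : I → X) : Germ (D : Filter I) X) = f
    rw [show π ∘ g = f from funext hg]
  · have : ∀ {ι : Type} (xs : ι → M.ultrapower D),
        (M.ultrapower D).atomVal xs = Feq.atomVal (π' ∘ xs) := by
      intro ι xs
      choose f hf using fun i => M.toUltrapower_surjective D (xs i)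
      obtain rfl : (fun i => M.toUltrapower D (f i)) = xs := funext hf
      funext a
      exact hatom f a
    funext a
    rcases a with (a | a) | (a | a)
    · exact congrFun (this a) (.inl (.inl id))
    · exact congrFun (this a) (.inl (.inr id))
    · exact congrFun (this a) (.inr (.inl id))
    · exact congrFun (this a) (.inr (.inr id))

end Represents

/-! ### Models of the continuous theory of a class of generic structures -/

/-- The first order structure `K` is the parametrized equivalence relation given by `Feq K`. -/
structure IsFeqModel (K : Type u) [feqLang.Structure K] [Feq K] : Prop where
  P_iff : ∀ xs : Fin 1 → K, Language.Structure.RelMap (L := feqLang) FeqRel.P xs ↔ P (xs 0)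
  Q_iff : ∀ xs : Fin 1 → K, Language.Structure.RelMap (L := feqLang) FeqRel.Q xs ↔ ¬ P (xs 0)
  E_iff : ∀ xs : Fin 3 → K,
    Language.Structure.RelMap (L := feqLang) FeqRel.E xs ↔ E (xs 0) (xs 1) (xs 2)

theorem IsFeqModel.represents {K : Type u} [feqLang.Structure K] [Feq K] [Nonempty K]
    (h : IsFeqModel K) : Represents (discreteStructure feqLang K) (id : K → K) := by
  classical
  refine ⟨Function.surjective_id, ?_⟩
  funext a
  rcases a with (a | a) | (a | a)
  · simp only [RVStructure.atomVal, discreteStructure, Feq.atomVal, Holds, h.P_iff]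
    exact if_congr Iff.rfl rfl rfl
  · simp only [RVStructure.atomVal, discreteStructure, Feq.atomVal, Holds, h.Q_iff]
    congr
  · simp only [RVStructure.atomVal, discreteStructure, Feq.atomVal, Holds, h.E_iff]
    exact if_congr Iff.rfl rfl rfl
  · simp only [RVStructure.atomVal, discreteStructure, Feq.atomVal, Holds]
    exact if_congr Iff.rfl rfl rfl

/-- All models of `T` are generic parametrized equivalence relations. -/
def IsGenericTheory (T : feqLang.Theory) : Prop :=
  ∀ (K : Type u) [feqLang.Structure K] [Nonempty K], K ⊨ T →
    ∃ _ : Feq K, IsFeqModel K ∧ IsGeneric K ℵ₀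

/-- `IsGeneric X ℵ₀` can be tested with tuples. -/
theorem isGeneric_aleph0_of_tuples {X : Type u} [Feq X]
    (h : ∀ (n : ℕ) (s : Fin n → X), ∃ (X' : Type u) (_ : Feq X') (t : Fin n → X'),
      IsGeneric X' ℵ₀ ∧ Feq.atomVal s = Feq.atomVal t ∧
      ∀ y : X', ∃ x : X, Feq.atomVal (Fin.snoc s x : Fin (n + 1) → X) =
        Feq.atomVal (Fin.snoc t y : Fin (n + 1) → X')) : IsGeneric X ℵ₀ := by
  refine isGeneric_aleph0_of_pullback fun S hS => ?_
  obtain ⟨n, s, hinj, rfl⟩ := hS.fin_param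
  obtain ⟨X', _, t, hX', hst, hext⟩ := h n s
  have : Nonempty X' := hX'.nonempty Cardinal.aleph0_pos
  have himage : (fun a => (a, Function.extend s t (fun _ => Classical.arbitrary X') a)) ''
      Set.range s = Set.range fun i => (s i, t i) := by
    rw [← Set.range_comp]
    congr 1
    funext i
    simp [hinj.extend_apply]
  refine ⟨X', _, Function.extend s t fun _ => Classical.arbitrary X', hX', ?_, fun y => ?_⟩
  · rw [himage, isPartIso_range_iff, ← atomVal_eq_iff, hst]
  · obtain ⟨x, hx⟩ := hext y
    rw [atomVal_eq_iff, ← isPartIso_range_iff] at hx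
    refine ⟨x, hx.mono ?_⟩
    rw [himage]
    rintro _ (rfl | ⟨i, rfl⟩)
    · exact ⟨Fin.last n, by simp⟩
    · exact ⟨i.castSucc, by simp⟩

/-- The distance to a set of vectors, cut off at `1`. -/
noncomputable def distTo {J : Type*} [Fintype J] (S : Set (J → unitInterval)) :
    C(J → unitInterval, unitInterval) :=
  ⟨fun w => Set.projIcc 0 1 zero_le_one (Metric.infDist w S),
    continuous_projIcc.comp (Metric.continuous_infDist_pt S)⟩

section distTo

variable {J : Type*} [Fintype J] {S : Set (J → unitInterval)} {w : J → unitInterval}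

theorem distTo_of_mem (h : w ∈ S) : distTo S w = 0 := by
  change Set.projIcc 0 1 zero_le_one (Metric.infDist w S) = 0
  rw [Metric.infDist_zero_of_mem h]
  exact Set.projIcc_of_le_left (zero_le_one (α := ℝ)) le_rfl

theorem infDist_le_of_distTo_lt_one (h : distTo S w < 1) : Metric.infDist w S ≤ distTo S w := by
  by_contra hlt
  rcases le_total 1 (Metric.infDist w S) with h1 | h1
  · have : distTo S w = 1 := Set.projIcc_of_right_le zero_le_one h1
    exact absurd this h.ne
  · have : ((distTo S w : unitInterval) : ℝ) = Metric.infDist w S :=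
      congrArg Subtype.val (Set.projIcc_of_mem zero_le_one ⟨Metric.infDist_nonneg, h1⟩)
    exact hlt this.ge

theorem mem_of_distTo_eq_zero (hS : S.Nonempty) (hfin : S.Finite) (h : distTo S w = 0) :
    w ∈ S := by
  have h1 := infDist_le_of_distTo_lt_one (S := S) (w := w) (by rw [h]; exact zero_lt_one)
  rw [h] at h1
  rw [hfin.isClosed.mem_iff_infDist_zero hS]
  exact le_antisymm h1 Metric.infDist_nonneg

theorem mem_of_distTo_lt_one (hS : S.Nonempty)
    (h01 : ∀ s ∈ S, ∀ j, s j ∈ ({0, 1} : Set unitInterval))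
    (hw : ∀ j, w j ∈ ({0, 1} : Set unitInterval)) (h : distTo S w < 1) : w ∈ S := by
  have h1 : Metric.infDist w S < 1 :=
    (infDist_le_of_distTo_lt_one h).trans_lt (Subtype.coe_lt_coe.2 h)
  obtain ⟨s, hs, hd⟩ := (Metric.infDist_lt_iff hS).1 h1
  suffices w = s by rwa [this]
  funext j
  have hj := (dist_le_pi_dist w s j).trans_lt hd
  rcases hw j with hwj | hwj <;> rcases h01 s hs j with hsj | hsj <;>
    rw [hwj, hsj] at hj ⊢ <;>
    simp [Subtype.dist_eq, Real.dist_eq] at hj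

end distTo

/-- The atomic formula with the given variables. -/
def atomFormula {n : ℕ} : Atom (Fin n) → CFormula (withDist feqLang) Empty n
  | .inl (.inl i) => .atom (Sum.inl FeqRel.P) fun k => .var (.inr (i k))
  | .inl (.inr i) => .atom (Sum.inl FeqRel.Q) fun k => .var (.inr (i k))
  | .inr (.inl i) => .atom (Sum.inl FeqRel.E) fun k => .var (.inr (i k))
  | .inr (.inr i) => .atom (Sum.inr DistSymbol.dist) fun k => .var (.inr (i k))

theorem value_atomFormula (M : RVStructure.{u} (withDist feqLang)) {n : ℕ} (a : Atom (Fin n))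
    (xs : Fin n → M) : M.value (atomFormula a) Empty.elim xs = M.atomVal xs a := by
  rcases a with (a | a) | (a | a) <;> rfl

section Models

variable {T : feqLang.Theory} {M : RVStructure.{u} (withDist feqLang)}

/-- The atomic type of a tuple in a model of the continuous theory is realized in a generic
structure, since the finitely many atomic types so realized form a closed set. -/
theorem exists_atomVal_eq_fin (hT : IsGenericTheory.{u} T)
    (hex : ∃ (K : Type u) (_ : Feq K), IsGeneric K ℵ₀)
    (hM : M.IsModel (continuousTheory.{u} T)) {n : ℕ} (xs : Fin n → M) :
    ∃ (K : Type u) (_ : Feq K) (ys : Fin n → K), IsGeneric K ℵ₀ ∧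
      M.atomVal xs = Feq.atomVal ys := by
  let S : Set (Atom (Fin n) → unitInterval) :=
    {w | ∃ (K : Type u) (_ : Feq K) (ys : Fin n → K), IsGeneric K ℵ₀ ∧ w = Feq.atomVal ys}
  have hne : S.Nonempty := by
    obtain ⟨K, _, hK⟩ := hex
    obtain ⟨z⟩ := hK.nonempty Cardinal.aleph0_pos
    exact ⟨_, K, _, fun _ => z, hK, rfl⟩
  have hfin : S.Finite := by
    refine (Set.Finite.pi' fun _ => Set.toFinite ({0, 1} : Set unitInterval)).subset ?_
    rintro _ ⟨K, _, ys, -, rfl⟩ a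
    exact atomVal_mem ys a
  have hmem : (CFormula.comb (distTo S) atomFormula : CFormula (withDist feqLang) Empty n).sups ∈
      continuousTheory.{u} T := by
    intro K _ _ hK
    obtain ⟨_, hFK, hgen⟩ := hT K hK
    rw [RVStructure.val_sups_eq_zero]
    intro ys
    rw [RVStructure.value_comb]
    simp only [value_atomFormula]
    exact distTo_of_mem ⟨K, _, ys, hgen, hFK.represents.atomVal_apply ys⟩
  have h0 := hM _ hmem
  rw [RVStructure.val_sups_eq_zero] at h0
  have h1 := h0 xs
  rw [RVStructure.value_comb] at h1
  simp only [value_atomFormula] at h1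
  exact mem_of_distTo_eq_zero hne hfin h1

theorem exists_atomVal_eq (hT : IsGenericTheory.{u} T)
    (hex : ∃ (K : Type u) (_ : Feq K), IsGeneric K ℵ₀)
    (hM : M.IsModel (continuousTheory.{u} T)) {ι : Type*} [Finite ι] (xs : ι → M) :
    ∃ (K : Type u) (_ : Feq K) (ys : ι → K), IsGeneric K ℵ₀ ∧ M.atomVal xs = Feq.atomVal ys := by
  obtain ⟨n, ⟨e⟩⟩ := Finite.exists_equiv_fin ι
  obtain ⟨K, _, ys, hK, h⟩ := exists_atomVal_eq_fin hT hex hM (xs ∘ e.symm)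
  refine ⟨K, _, ys ∘ e, hK, ?_⟩
  have hxs : xs = (xs ∘ e.symm) ∘ e := by
    funext i
    simp
  rw [hxs, M.atomVal_comp, h, Feq.atomVal_comp]

/-- One-point extensions of atomic types are realized in models of the continuous theory. -/
theorem exists_atomVal_snoc_eq (hT : IsGenericTheory.{u} T)
    (hex : ∃ (K : Type u) (_ : Feq K), IsGeneric K ℵ₀)
    (hM : M.IsModel (continuousTheory.{u} T)) {n : ℕ} (xs : Fin n → M) {K : Type u} [Feq K]
    (ys : Fin n → K) (hxy : M.atomVal xs = Feq.atomVal ys) (y : K) :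
    ∃ x : M, M.atomVal (Fin.snoc xs x : Fin (n + 1) → M) =
      Feq.atomVal (Fin.snoc ys y : Fin (n + 1) → K) := by
  have hsnoc : ∀ {Z : Type u} (zs : Fin n → Z) (z : Z),
      (Fin.snoc zs z : Fin (n + 1) → Z) ∘ Fin.castSucc = zs := fun zs z => by
    funext i
    simp
  let S : Set (Atom (Fin (n + 1)) → unitInterval) :=
    {w | (∀ a, w a ∈ ({0, 1} : Set unitInterval)) ∧
      (w ∘ Atom.map Fin.castSucc = Feq.atomVal ys →
        w = Feq.atomVal (Fin.snoc ys y : Fin (n + 1) → K))}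
  have hne : S.Nonempty := ⟨_, atomVal_mem _, fun _ => rfl⟩
  have hmem : (CFormula.inf (CFormula.comb (distTo S) atomFormula) :
      CFormula (withDist feqLang) Empty n).sups ∈ continuousTheory.{u} T := by
    intro K' _ _ hK'
    obtain ⟨_, hFK, hgen⟩ := hT K' hK'
    rw [RVStructure.val_sups_eq_zero]
    intro (zs : Fin n → K')
    have hz : ∃ z : K', Feq.atomVal (Fin.snoc zs z : Fin (n + 1) → K') ∈ S := by
      by_cases h : Feq.atomVal zs = Feq.atomVal ys
      · have hR := (isPartIso_range_iff ys zs).2 ((atomVal_eq_iff _ _).1 h.symm)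
        obtain ⟨z, hz⟩ := hgen.extend hR
          (Cardinal.lt_aleph0_iff_set_finite.2 (Set.finite_range _)) y
        refine ⟨z, atomVal_mem _, fun _ => ?_⟩
        symm
        rw [atomVal_eq_iff, ← isPartIso_range_iff]
        refine hz.mono ?_
        rintro _ ⟨i, rfl⟩
        induction i using Fin.lastCases with
        | last => simp
        | cast i => exact .inr ⟨i, by simp⟩
      · refine ⟨Classical.arbitrary K', atomVal_mem _, fun h' => absurd ?_ h⟩
        rw [← Feq.atomVal_comp, hsnoc] at h'
        exact h'
    obtain ⟨z, hz⟩ := hz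
    refine le_antisymm ?_ bot_le
    simp only [RVStructure.value]
    refine iInf_le_of_le (show (discreteStructure feqLang K').carrier from z) ?_
    rw [RVStructure.value_comb]
    simp only [value_atomFormula, hFK.represents.atomVal_apply]
    exact (distTo_of_mem hz).le
  have h0 := hM _ hmem
  rw [RVStructure.val_sups_eq_zero] at h0
  have h1 := h0 xs
  simp only [RVStructure.value, RVStructure.value_comb, value_atomFormula] at h1
  obtain ⟨x, hx⟩ := iInf_lt_iff.1 (h1.trans_lt (zero_lt_one (α := unitInterval)))
  refine ⟨x, ?_⟩
  have hx01 : ∀ a, M.atomVal (Fin.snoc xs x : Fin (n + 1) → M) a ∈ ({0, 1} : Set unitInterval) := by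
    obtain ⟨K', _, zs, -, h⟩ := exists_atomVal_eq hT hex hM (Fin.snoc xs x : Fin (n + 1) → M)
    rw [h]
    exact atomVal_mem zs
  refine (mem_of_distTo_lt_one hne (fun s hs => hs.1) hx01 hx).2 ?_
  rw [← M.atomVal_comp, hsnoc, hxy]

/-- Every model of the continuous theory becomes generic when points at distance `0` are
identified. -/
theorem exists_represents_of_isModel (hT : IsGenericTheory.{u} T)
    (hex : ∃ (K : Type u) (_ : Feq K), IsGeneric K ℵ₀)
    (hM : M.IsModel (continuousTheory.{u} T)) :
    ∃ (X : Type u) (_ : Feq X) (π : M → X), Represents M π ∧ IsGeneric X ℵ₀ := by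
  classical
  have hvec : ∀ {n : ℕ} (xs : Fin n → M) (i j k : Fin n), xs ∘ ![i] = ![xs i] ∧
      xs ∘ ![i, j] = ![xs i, xs j] ∧ xs ∘ ![i, j, k] = ![xs i, xs j, xs k] := by
    intro n xs i j k
    refine ⟨?_, ?_, ?_⟩ <;> funext l <;> fin_cases l <;> rfl
  let dP : M → Prop := fun a => M.relMap (Sum.inl FeqRel.P) ![a] = 0
  let dE : M → M → M → Prop := fun a b c => M.relMap (Sum.inl FeqRel.E) ![a, b, c] = 0
  let deq : M → M → Prop := fun a b => M.relMap (Sum.inr DistSymbol.dist) ![a, b] = 0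
  have hloc : ∀ {n : ℕ} (xs : Fin n → M), ∃ (K : Type u) (_ : Feq K) (ys : Fin n → K),
      (∀ i, dP (xs i) ↔ P (ys i)) ∧ (∀ i j k, dE (xs i) (xs j) (xs k) ↔ E (ys i) (ys j) (ys k)) ∧
      ∀ i j, deq (xs i) (xs j) ↔ ys i = ys j := by
    intro n xs
    obtain ⟨K, fK, ys, -, h⟩ := exists_atomVal_eq hT hex hM xs
    have h0 : ∀ a, M.atomVal xs a = 0 ↔ Holds ys a := fun a => by
      rw [h, Feq.atomVal]
      split_ifs with h <;> simp [h]
    refine ⟨K, fK, ys, fun i => ?_, fun i j k => ?_, fun i j => ?_⟩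
    · have := h0 (.inl (.inl ![i]))
      simp only [RVStructure.atomVal, hvec xs i i i] at this
      exact this
    · have := h0 (.inr (.inl ![i, j, k]))
      simp only [RVStructure.atomVal, hvec xs i j k] at this
      exact this
    · have := h0 (.inr (.inr ![i, j]))
      simp only [RVStructure.atomVal, hvec xs i j j] at this
      exact this
  let s : Setoid M :=
    { r := deq
      iseqv :=
        { refl := fun a => by
            obtain ⟨K, _, ys, -, -, h⟩ := hloc ![a]
            exact (h 0 0).2 rfl
          symm := fun {a b} hab => by
            obtain ⟨K, _, ys, -, -, h⟩ := hloc ![a, b]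
            exact (h 1 0).2 ((h 0 1).1 hab).symm
          trans := fun {a b c} hab hbc => by
            obtain ⟨K, _, ys, -, -, h⟩ := hloc ![a, b, c]
            exact (h 0 2).2 (((h 0 1).1 hab).trans ((h 1 2).1 hbc)) } }
  let X := Quotient s
  let fX : Feq X :=
    { P := fun a => dP a.out
      E := fun a b c => dE a.out b.out c.out
      dom := fun {a b c} h => by
        obtain ⟨K, _, ys, hP, hE, -⟩ := hloc ![a.out, b.out, c.out]
        have h' := dom ((hE 0 1 2).1 h)
        exact ⟨(hP 0).2 h'.1, fun h => h'.2.1 ((hP 1).1 h), fun h => h'.2.2 ((hP 2).1 h)⟩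
      refl := fun {a b} ha hb => by
        obtain ⟨K, _, ys, hP, hE, -⟩ := hloc ![a.out, b.out]
        exact (hE 0 1 1).2 (refl ((hP 0).1 ha) fun h => hb ((hP 1).2 h))
      symm := fun {a b c} h => by
        obtain ⟨K, _, ys, hP, hE, -⟩ := hloc ![a.out, b.out, c.out]
        exact (hE 0 2 1).2 (symm ((hE 0 1 2).1 h))
      trans := fun {a b c e} h h' => by
        obtain ⟨K, _, ys, hP, hE, -⟩ := hloc ![a.out, b.out, c.out, e.out]
        exact (hE 0 1 3).2 (trans ((hE 0 1 2).1 h) ((hE 0 2 3).1 h')) }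
  let π : M → X := Quotient.mk s
  have hout : ∀ {ι : Type} [Finite ι] (xs : ι → M),
      M.atomVal xs = M.atomVal fun i => (π (xs i)).out := by
    intro ι _ xs
    obtain ⟨K, _, ys, -, h⟩ := exists_atomVal_eq hT hex hM
      (Sum.elim xs fun i => (π (xs i)).out)
    have hlr : ys ∘ Sum.inl = ys ∘ Sum.inr := by
      funext i
      have hd : M.atomVal (Sum.elim xs fun i => (π (xs i)).out)
          (.inr (.inr ![.inl i, .inr i])) = 0 := by
        have : deq (xs i) (π (xs i)).out := s.symm (Quotient.mk_out (s := s) (xs i))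
        simp only [RVStructure.atomVal]
        convert this using 2
        funext l; fin_cases l <;> rfl
      rw [h, Feq.atomVal] at hd
      by_contra hne
      rw [if_neg (show ¬ Holds ys (.inr (.inr ![.inl i, .inr i])) from hne)] at hd
      exact one_ne_zero hd
    have h1 := congrArg (fun w => w ∘ Atom.map Sum.inl) h
    have h2 := congrArg (fun w => w ∘ Atom.map Sum.inr) h
    simp only [← M.atomVal_comp, ← Feq.atomVal_comp, Sum.elim_comp_inl, Sum.elim_comp_inr] at h1 h2
    rw [h1, h2, hlr]
  have hrep : ∀ {n : ℕ} (xs : Fin n → M), M.atomVal xs = Feq.atomVal (π ∘ xs) := by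
    intro n xs
    rw [hout xs]
    obtain ⟨K, _, ys, -, h⟩ := exists_atomVal_eq hT hex hM fun i => (π (xs i)).out
    have key : ∀ a, M.atomVal (fun i => (π (xs i)).out) a = 0 ↔ Holds (π ∘ xs) a := by
      intro a
      have hP : ∀ i, Holds ys (.inl (.inl i)) ↔ Holds (π ∘ xs) (.inl (.inl i)) := fun i => by
        have : M.atomVal (fun i => (π (xs i)).out) (.inl (.inl i)) = 0 ↔ dP (π (xs (i 0))).out := by
          simp only [RVStructure.atomVal, dP]
          rw [show (fun i => (π (xs i)).out) ∘ i = ![(π (xs (i 0))).out] from by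
            funext l; fin_cases l; rfl]
        rw [show Holds (π ∘ xs) (.inl (.inl i)) ↔ dP (π (xs (i 0))).out from Iff.rfl, ← this, h,
          Feq.atomVal]
        split_ifs with h <;> simp [h]
      rcases a with (a | a) | (a | a)
      · rw [← hP, h, Feq.atomVal]
        split_ifs with h <;> simp [h]
      · rw [show Holds (π ∘ xs) (.inl (.inr a)) ↔ ¬ Holds (π ∘ xs) (.inl (.inl a)) from Iff.rfl,
          ← hP, h, Feq.atomVal]
        rw [show Holds ys (.inl (.inr a)) ↔ ¬ Holds ys (.inl (.inl a)) from Iff.rfl]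
        split_ifs with h <;> simpa using h
      · simp only [RVStructure.atomVal]
        rw [show (fun i => (π (xs i)).out) ∘ a =
          ![(π (xs (a 0))).out, (π (xs (a 1))).out, (π (xs (a 2))).out] from by
            funext l; fin_cases l <;> rfl]
        rfl
      · simp only [RVStructure.atomVal]
        rw [show (fun i => (π (xs i)).out) ∘ a =
          ![(π (xs (a 0))).out, (π (xs (a 1))).out] from by funext l; fin_cases l <;> rfl]
        change deq _ _ ↔ π (xs (a 0)) = π (xs (a 1))
        rw [← Quotient.out_eq (π (xs (a 0))), ← Quotient.out_eq (π (xs (a 1))),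
          Quotient.eq (r := s)]
        simp only [Quotient.out_eq]
        rfl
    funext a
    by_cases ha : Holds (π ∘ xs) a
    · rw [(key a).2 ha, Feq.atomVal, if_pos ha]
    · have h1 : M.atomVal (fun i => (π (xs i)).out) a ∈ ({0, 1} : Set unitInterval) := by
        rw [h]
        exact atomVal_mem ys a
      rcases h1 with h1 | h1
      · exact absurd ((key a).1 h1) ha
      · rw [h1, Feq.atomVal, if_neg ha]
  refine ⟨X, fX, π, ⟨Quotient.mk_surjective, ?_⟩, isGeneric_aleph0_of_tuples fun n t => ?_⟩
  · funext a
    rcases a with (a | a) | (a | a)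
    · exact congrFun (hrep a) (.inl (.inl id))
    · exact congrFun (hrep a) (.inl (.inr id))
    · exact congrFun (hrep a) (.inr (.inl id))
    · exact congrFun (hrep a) (.inr (.inr id))
  · choose xs hxs using fun i => Quotient.mk_surjective (t i)
    obtain rfl : π ∘ xs = t := funext hxs
    obtain ⟨K, _, ys, hK, hxy⟩ := exists_atomVal_eq hT hex hM xs
    refine ⟨K, _, ys, hK, ?_, fun y => ?_⟩
    · rw [← hrep, hxy]
    · obtain ⟨x, hx⟩ := exists_atomVal_snoc_eq hT hex hM xs ys hxy y
      refine ⟨π x, ?_⟩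
      rw [← hx, hrep, Fin.comp_snoc]

/-- A regular ultrafilter that is good for equality saturates every continuous theory whose models
are generic. -/
theorem GoodForEquality.saturates {I : Type u} [Infinite I] {D : Ultrafilter I}
    (hD : GoodForEquality D) (hreg : IsRegularUltrafilter D) (hT : IsGenericTheory.{u} T)
    (hex : ∃ (K : Type u) (_ : Feq K), IsGeneric K ℵ₀) :
    Saturates D (continuousTheory.{u} T) := by
  intro M hM
  obtain ⟨X, _, π, hπ, hX⟩ := exists_represents_of_isModel hT hex hM
  obtain ⟨π', hπ'⟩ := hπ.ultrapower D
  exact hπ'.isSaturated ((Cardinal.aleph0_le_mk I).trans (Order.le_succ _)) (hX.germ hreg hD)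

end Models

/-! ### First order models of the theory of parametrized equivalence relations -/

section FirstOrder

open Language

/-- A parametrized equivalence relation as a first order structure. -/
abbrev feqStructure (X : Type u) [Feq X] : feqLang.Structure X where
  funMap F := Empty.elim F
  RelMap {n} R xs := match n, R, xs with
    | _, FeqRel.P, xs => P (xs 0)
    | _, FeqRel.Q, xs => ¬ P (xs 0)
    | _, FeqRel.E, xs => E (xs 0) (xs 1) (xs 2)

theorem isFeqModel_feqStructure (X : Type u) [Feq X] :
    letI := feqStructure X
    IsFeqModel X :=
  letI := feqStructure X
  ⟨fun _ => Iff.rfl, fun _ => Iff.rfl, fun _ => Iff.rfl⟩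

variable {K : Type u} [feqLang.Structure K]

theorem model_feqTheory_iff : K ⊨ feqTheory ↔
    let rP : K → Prop := fun x => Structure.RelMap (L := feqLang) FeqRel.P ![x]
    let rQ : K → Prop := fun x => Structure.RelMap (L := feqLang) FeqRel.Q ![x]
    let rE : K → K → K → Prop := fun z x y => Structure.RelMap (L := feqLang) FeqRel.E ![z, x, y]
    (∀ x, rP x ∨ rQ x) ∧ (∀ x, ¬ (rP x ∧ rQ x)) ∧
    (∀ z x y, rE z x y → rP z ∧ rQ x ∧ rQ y) ∧ (∀ z x, rP z → rQ x → rE z x x) ∧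
    (∀ z x y, rE z x y → rE z y x) ∧ ∀ z x y w, rE z x y → rE z y w → rE z x w := by
  have h1 : ∀ {n : ℕ} (v : Empty → K) (xs : Fin n → K) (t : feqLang.Term (Empty ⊕ Fin n)),
      (fun i => ((![t] : Fin 1 → _) i).realize (Sum.elim v xs)) =
        ![t.realize (Sum.elim v xs)] := by
    intro n v xs t; funext i; fin_cases i; rfl
  have h3 : ∀ {n : ℕ} (v : Empty → K) (xs : Fin n → K)
      (t t' t'' : feqLang.Term (Empty ⊕ Fin n)),
      (fun i => ((![t, t', t''] : Fin 3 → _) i).realize (Sum.elim v xs)) =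
        ![t.realize (Sum.elim v xs), t'.realize (Sum.elim v xs), t''.realize (Sum.elim v xs)] := by
    intro n v xs t t' t''; funext i; fin_cases i <;> rfl
  simp only [feqTheory, Theory.model_iff, Set.mem_insert_iff, Set.mem_singleton_iff,
    forall_eq_or_imp, forall_eq, Sentence.Realize, Formula.Realize, BoundedFormula.realize_all,
    BoundedFormula.realize_imp, BoundedFormula.realize_inf, BoundedFormula.realize_sup,
    BoundedFormula.realize_not, feqP, feqQ, feqE, BoundedFormula.realize_rel, h1, h3]
  rfl

theorem exists_isFeqModel (h : K ⊨ feqTheory) : ∃ _ : Feq K, IsFeqModel K := by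
  obtain ⟨h1, h2, h3, h4, h5, h6⟩ := model_feqTheory_iff.1 h
  have hQ : ∀ x : K, Structure.RelMap (L := feqLang) FeqRel.Q ![x] ↔
      ¬ Structure.RelMap (L := feqLang) FeqRel.P ![x] := fun x =>
    ⟨fun hq hp => h2 x ⟨hp, hq⟩, fun hp => (h1 x).resolve_left hp⟩
  have e1 : ∀ xs : Fin 1 → K, xs = ![xs 0] := fun xs => by funext i; fin_cases i; rfl
  have e3 : ∀ xs : Fin 3 → K, xs = ![xs 0, xs 1, xs 2] := fun xs => by
    funext i; fin_cases i <;> rfl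
  let fK : Feq K := {
    P := fun x => Structure.RelMap (L := feqLang) FeqRel.P ![x]
    E := fun z x y => Structure.RelMap (L := feqLang) FeqRel.E ![z, x, y]
    dom := fun {z x y} h => ⟨(h3 z x y h).1, (hQ x).1 (h3 z x y h).2.1, (hQ y).1 (h3 z x y h).2.2⟩
    refl := fun {z x} hz hx => h4 z x hz ((hQ x).2 hx)
    symm := fun {z x y} h => h5 z x y h
    trans := fun {z x y w} h h' => h6 z x y w h h' }
  refine ⟨fK, ⟨fun xs => ?_, fun xs => ?_, fun xs => ?_⟩⟩
  · rw [e1 xs]; rfl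
  · rw [e1 xs]; exact hQ _
  · rw [e3 xs]; rfl

theorem IsFeqModel.model [Feq K] (h : IsFeqModel K) : K ⊨ feqTheory := by
  rw [model_feqTheory_iff]
  simp only [h.P_iff, h.Q_iff, h.E_iff]
  exact ⟨fun x => em _, fun x hx => hx.2 hx.1, fun z x y h => dom h, fun z x hz hx => refl hz hx,
    fun z x y h => symm h, fun z x y w h h' => trans h h'⟩

variable {K' : Type u} [feqLang.Structure K'] [Feq K] [Feq K']

theorem holds_embedding (hK : IsFeqModel K) (hK' : IsFeqModel K') (f : K ↪[feqLang] K')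
    {ι : Type*} (xs : ι → K) (a : Atom ι) : Holds (f ∘ xs) a ↔ Holds xs a := by
  rcases a with (a | a) | (a | a)
  · exact (hK'.P_iff (f ∘ xs ∘ a)).symm.trans ((f.map_rel _ _).trans (hK.P_iff (xs ∘ a)))
  · exact (hK'.Q_iff (f ∘ xs ∘ a)).symm.trans ((f.map_rel _ _).trans (hK.Q_iff (xs ∘ a)))
  · exact (hK'.E_iff (f ∘ xs ∘ a)).symm.trans ((f.map_rel _ _).trans (hK.E_iff (xs ∘ a)))
  · exact f.injective.eq_iff

/-- Embeddings of first order structures from injective maps that preserve `P` and `E`. -/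
def embeddingOfFeq (hK : IsFeqModel K) (hK' : IsFeqModel K') (f : K → K')
    (hf : Function.Injective f) (hP : ∀ x, P (f x) ↔ P x)
    (hE : ∀ z x y, E (f z) (f x) (f y) ↔ E z x y) : K ↪[feqLang] K' where
  toFun := f
  inj' := hf
  map_fun' F := Empty.elim F
  map_rel' {n} r xs := by
    cases r with
    | P => exact (hK'.P_iff _).trans ((hP _).trans (hK.P_iff _).symm)
    | Q => exact (hK'.Q_iff _).trans ((not_congr (hP _)).trans (hK.Q_iff _).symm)
    | E => exact (hK'.E_iff _).trans ((hE _ _ _).trans (hK.E_iff _).symm)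

/-- Finite partial isomorphisms between generic structures preserve all first order formulas. -/
theorem realize_iff_of_isPartIso (hK : IsFeqModel K) (hK' : IsFeqModel K') (hX : IsGeneric K ℵ₀)
    (hX' : IsGeneric K' ℵ₀) {α : Type*} [DecidableEq α] {n : ℕ} (φ : feqLang.BoundedFormula α n)
    {R : Set (K × K')} (hR : IsPartIso R) (hfin : R.Finite)
    (v : α → K) (v' : α → K') (xs : Fin n → K) (xs' : Fin n → K')
    (hv : ∀ a ∈ φ.freeVarFinset, (v a, v' a) ∈ R) (hx : ∀ i, (xs i, xs' i) ∈ R) :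
    φ.Realize v xs ↔ φ.Realize v' xs' := by
  have ht : ∀ {n : ℕ} (t : feqLang.Term (α ⊕ Fin n)) {R : Set (K × K')} (xs : Fin n → K)
      (xs' : Fin n → K'), (∀ a ∈ t.varFinsetLeft, (v a, v' a) ∈ R) →
      (∀ i, (xs i, xs' i) ∈ R) → (t.realize (Sum.elim v xs), t.realize (Sum.elim v' xs')) ∈ R := by
    intro n t R xs xs' hv hx
    rcases t with (a | j) | ⟨F, -⟩
    · exact hv a (by simp [Term.varFinsetLeft])
    · exact hx j
    · exact Empty.elim F
  induction φ generalizing R with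
  | falsum => exact Iff.rfl
  | equal t₁ t₂ =>
    simp only [BoundedFormula.freeVarFinset, Finset.mem_union] at hv
    exact hR.eq_iff _ (ht t₁ xs xs' (fun a ha => hv a (.inl ha)) hx) _
      (ht t₂ xs xs' (fun a ha => hv a (.inr ha)) hx)
  | rel r ts =>
    simp only [BoundedFormula.freeVarFinset, Finset.mem_biUnion, Finset.mem_univ, true_and] at hv
    have key : ∀ a : Atom _, Holds (fun i => (ts i).realize (Sum.elim v xs)) a ↔
        Holds (fun i => (ts i).realize (Sum.elim v' xs')) a := by
      rw [← isPartIso_range_iff]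
      refine hR.mono ?_
      rintro _ ⟨i, rfl⟩
      exact ht (ts i) xs xs' (fun a ha => hv a ⟨i, ha⟩) hx
    change Structure.RelMap r (fun i => (ts i).realize (Sum.elim v xs)) ↔
      Structure.RelMap r (fun i => (ts i).realize (Sum.elim v' xs'))
    generalize (fun i => (ts i).realize (Sum.elim v xs)) = w at key ⊢
    generalize (fun i => (ts i).realize (Sum.elim v' xs')) = w' at key ⊢
    cases r with
    | P => exact (hK.P_iff w).trans ((key (.inl (.inl id))).trans (hK'.P_iff w').symm)
    | Q => exact (hK.Q_iff w).trans ((key (.inl (.inr id))).trans (hK'.Q_iff w').symm)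
    | E => exact (hK.E_iff w).trans ((key (.inr (.inl id))).trans (hK'.E_iff w').symm)
  | imp φ ψ ihφ ihψ =>
    simp only [BoundedFormula.freeVarFinset, Finset.mem_union] at hv
    simp only [BoundedFormula.realize_imp]
    exact imp_congr (ihφ hR hfin _ _ (fun a ha => hv a (.inl ha)) hx)
      (ihψ hR hfin _ _ (fun a ha => hv a (.inr ha)) hx)
  | all φ ih =>
    simp only [BoundedFormula.realize_all]
    constructor
    · intro h a'
      obtain ⟨a, ha⟩ := hX.extend hR.swap (Cardinal.lt_aleph0_iff_set_finite.2 (hfin.image _)) a'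
      have ha' := ha.swap
      rw [Set.image_insert_eq, Set.image_image] at ha'
      simp only [Prod.swap_swap, Set.image_id', Prod.swap_prod_mk] at ha'
      refine (ih ha' (hfin.insert _) _ _ (fun b hb => .inr (hv b hb)) fun i => ?_).1 (h a)
      induction i using Fin.lastCases with
      | last => simp
      | cast i => simpa using .inr (hx i)
    · intro h a
      obtain ⟨a', ha'⟩ := hX'.extend hR (Cardinal.lt_aleph0_iff_set_finite.2 hfin) a
      refine (ih ha' (hfin.insert _) _ _ (fun b hb => .inr (hv b hb)) fun i => ?_).2 (h a')
      induction i using Fin.lastCases with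
      | last => simp
      | cast i => simpa using .inr (hx i)

/-- The atomic formula with the given terms. -/
def atomBoundedFormula {α : Type*} {m n : ℕ} (ts : Fin n → feqLang.Term (α ⊕ Fin m)) :
    Atom (Fin n) → feqLang.BoundedFormula α m
  | .inl (.inl i) => Relations.boundedFormula (L := feqLang) FeqRel.P (ts ∘ i)
  | .inl (.inr i) => Relations.boundedFormula (L := feqLang) FeqRel.Q (ts ∘ i)
  | .inr (.inl i) => Relations.boundedFormula (L := feqLang) FeqRel.E (ts ∘ i)
  | .inr (.inr i) => Term.bdEqual (ts (i 0)) (ts (i 1))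

open Classical in
/-- The formula which says that `τ` is the atomic type of the given terms. -/
noncomputable def diagramFormula {α : Type*} {m n : ℕ} (τ : Atom (Fin n) → Prop)
    (ts : Fin n → feqLang.Term (α ⊕ Fin m)) : feqLang.BoundedFormula α m :=
  BoundedFormula.iInf fun a : Atom (Fin n) =>
    if τ a then atomBoundedFormula ts a else (atomBoundedFormula ts a).not

theorem realize_diagramFormula (hK : IsFeqModel K) {α : Type*} {m n : ℕ}
    (τ : Atom (Fin n) → Prop) (ts : Fin n → feqLang.Term (α ⊕ Fin m)) (v : α → K)
    (xs : Fin m → K) : (diagramFormula τ ts).Realize v xs ↔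
      ∀ a, Holds (fun i => (ts i).realize (Sum.elim v xs)) a ↔ τ a := by
  have hatom : ∀ a, (atomBoundedFormula ts a).Realize v xs ↔
      Holds (fun i => (ts i).realize (Sum.elim v xs)) a := by
    intro a
    rcases a with (a | a) | (a | a)
    · exact BoundedFormula.realize_rel.trans (hK.P_iff _)
    · exact BoundedFormula.realize_rel.trans (hK.Q_iff _)
    · exact BoundedFormula.realize_rel.trans (hK.E_iff _)
    · exact BoundedFormula.realize_bdEqual _ _
  rw [diagramFormula, BoundedFormula.realize_iInf]
  refine forall_congr' fun a => ?_
  split_ifs with h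
  · rw [hatom]; simp [h]
  · rw [BoundedFormula.realize_not, hatom]; simp [h]

theorem atomVal_base {X : Type u} [Feq X] {ι : Type*} (s : ι → X) :
    Feq.atomVal s = Feq.atomVal fun i => GenericExt.base (s i) := by
  rw [atomVal_eq_iff]
  intro a
  rcases a with (a | a) | (a | a)
  · exact Iff.rfl
  · exact Iff.rfl
  · exact (GenericExt.base_E _ _ _).symm
  · exact GenericExt.base_injective.eq_iff.symm

end FirstOrder

/-! ### The model completion -/

section ModelCompletion

open Language

/-- The inclusion of a model of `feqTheory` into its generic extension. -/
noncomputable def baseEmbedding {K : Type u} [feqLang.Structure K] [Feq K] (hK : IsFeqModel K) :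
    letI := feqStructure (GenericExt K)
    K ↪[feqLang] GenericExt K :=
  letI := feqStructure (GenericExt K)
  embeddingOfFeq hK (isFeqModel_feqStructure _) GenericExt.base GenericExt.base_injective
    GenericExt.base_P GenericExt.base_E

/-- The first order theory of all generic parametrized equivalence relations. -/
def genericTheory : feqLang.Theory :=
  {σ | ∀ (K : Type u) [feqLang.Structure K] [Feq K], IsFeqModel K → IsGeneric K ℵ₀ → K ⊨ σ}

/-- Genericity is an elementary property: it says that each atomic type of an `(n + 1)`-tuple that
extends the type of a given `n`-tuple is realized. -/
theorem isGenericTheory_genericTheory : IsGenericTheory.{u} genericTheory.{u} := by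
  intro K _ _ hK
  have hfeq : K ⊨ feqTheory := by
    rw [Theory.model_iff]
    intro σ hσ
    exact hK.realize_of_mem σ fun K' _ _ hK' _ => hK'.model.realize_of_mem σ hσ
  obtain ⟨_, hFK⟩ := exists_isFeqModel hfeq
  refine ⟨_, hFK, isGeneric_aleph0_of_tuples fun n s => ⟨GenericExt K, inferInstance,
    fun i => .base (s i), GenericExt.isGeneric.mono Cardinal.aleph0_lt_aleph_one.le,
    atomVal_base s, fun y => ?_⟩⟩
  let t : Fin (n + 1) → GenericExt K := Fin.snoc (fun i => GenericExt.base (s i)) y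
  let σ : feqLang.Sentence := BoundedFormula.alls (n := n)
    ((diagramFormula (α := Empty) (Holds s) fun i : Fin n =>
      (&i : feqLang.Term (Empty ⊕ Fin n))).imp
      (diagramFormula (Holds t) fun i : Fin (n + 1) =>
        (&i : feqLang.Term (Empty ⊕ Fin (n + 1)))).ex)
  have hσ : ∀ (K' : Type u) [feqLang.Structure K'] [Feq K'], IsFeqModel K' →
      (K' ⊨ σ ↔ ∀ xs : Fin n → K', (∀ a, Holds xs a ↔ Holds s a) →
        ∃ x, ∀ a, Holds (Fin.snoc xs x : Fin (n + 1) → K') a ↔ Holds t a) := by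
    intro K' _ _ hK'
    simp only [σ, Sentence.Realize, BoundedFormula.realize_alls,
      BoundedFormula.realize_imp, BoundedFormula.realize_ex, realize_diagramFormula hK']
    exact Iff.rfl
  have hmem : σ ∈ genericTheory.{u} := by
    intro K' _ _ hK' hgen
    rw [hσ K' hK']
    intro xs hxs
    have hR : IsPartIso (Set.range fun i => (GenericExt.base (s i), xs i)) := by
      rw [isPartIso_range_iff]
      intro a
      rw [hxs]
      exact ((atomVal_eq_iff _ _).1 (atomVal_base s) a).symm
    obtain ⟨x, hx⟩ := hgen.extend hR (Cardinal.lt_aleph0_iff_set_finite.2 (Set.finite_range _)) y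
    refine ⟨x, fun a => ((isPartIso_range_iff t (Fin.snoc xs x)).1 (hx.mono ?_) a).symm⟩
    rintro _ ⟨i, rfl⟩
    induction i using Fin.lastCases with
    | last => simp [t]
    | cast i => exact .inr ⟨i, by simp [t]⟩
  obtain ⟨x, hx⟩ := (hσ K hFK).1 (hK.realize_of_mem σ hmem) s fun _ => Iff.rfl
  exact ⟨x, (atomVal_eq_iff _ _).2 hx⟩

theorem isModelCompletion_genericTheory :
    IsModelCompletion.{u} feqTheory genericTheory.{u} where
  models K _ _ hK := by
    obtain ⟨_, hFK, -⟩ := isGenericTheory_genericTheory K hK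
    exact hFK.model
  embeds K _ _ hK := by
    obtain ⟨_, hFK⟩ := exists_isFeqModel hK
    let _ := feqStructure (GenericExt K)
    refine ⟨GenericExt K, inferInstance, ?_, ⟨baseEmbedding hFK⟩⟩
    rw [Theory.model_iff]
    exact fun σ hσ => hσ _ (isFeqModel_feqStructure _)
      (GenericExt.isGeneric.mono Cardinal.aleph0_lt_aleph_one.le)
  complete K _ _ hK N₁ N₂ _ _ hN₁ hN₂ f₁ f₂ φ := by
    classical
    have : Nonempty N₁ := ⟨f₁ (Classical.arbitrary K)⟩
    have : Nonempty N₂ := ⟨f₂ (Classical.arbitrary K)⟩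
    obtain ⟨_, hFK⟩ := exists_isFeqModel hK
    obtain ⟨_, hF₁, hgen₁⟩ := isGenericTheory_genericTheory N₁ hN₁
    obtain ⟨_, hF₂, hgen₂⟩ := isGenericTheory_genericTheory N₂ hN₂
    have hR : IsPartIso (Set.range fun k : φ.freeVarFinset => (f₁ k, f₂ k)) := by
      rw [isPartIso_range_iff]
      intro a
      exact (holds_embedding hFK hF₁ f₁ (fun k : φ.freeVarFinset => (k : K)) a).trans
        (holds_embedding hFK hF₂ f₂ (fun k : φ.freeVarFinset => (k : K)) a).symm
    exact realize_iff_of_isPartIso hF₁ hF₂ hgen₁ hgen₂ φ hR (Set.finite_range _) _ _ _ _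
      (fun k hk => ⟨⟨k, hk⟩, rfl⟩) fun i => i.elim0

/-- The models of any model completion are generic, since they are elementary substructures of
extensions of their generic extensions. -/
theorem IsModelCompletion.isGenericTheory {T : feqLang.Theory}
    (hT : IsModelCompletion.{u} feqTheory T) : IsGenericTheory.{u} T := by
  intro N _ _ hN
  have hfeq := hT.models N hN
  obtain ⟨_, hFN⟩ := exists_isFeqModel hfeq
  let _ := feqStructure (GenericExt N)
  have hFG : IsFeqModel (GenericExt N) := isFeqModel_feqStructure _
  have : Nonempty (GenericExt N) := ⟨.base (Classical.arbitrary N)⟩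
  obtain ⟨N', _, hN', ⟨g⟩⟩ := hT.embeds (GenericExt N) hFG.model
  have : Nonempty N' := ⟨g (.base (Classical.arbitrary N))⟩
  obtain ⟨_, hFN'⟩ := exists_isFeqModel (hT.models N' hN')
  refine ⟨_, hFN, isGeneric_aleph0_of_tuples fun n s => ⟨GenericExt N, inferInstance,
    fun i => .base (s i), GenericExt.isGeneric.mono Cardinal.aleph0_lt_aleph_one.le,
    atomVal_base s, fun y => ?_⟩⟩
  let t : Fin (n + 1) → GenericExt N := Fin.snoc (fun i => GenericExt.base (s i)) y
  -- the formula with parameters `s` which says that the type of `t` is realized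
  let ts : Fin (n + 1) → feqLang.Term (N ⊕ Fin 1) :=
    Fin.snoc (fun i => Term.var (Sum.inl (s i))) (&0)
  let φ : feqLang.Formula N := BoundedFormula.ex (n := 0) (diagramFormula (Holds t) ts)
  have hφ : ∀ (K' : Type u) [feqLang.Structure K'] [Feq K'], IsFeqModel K' → ∀ v : N → K',
      (φ.Realize v ↔ ∃ x, ∀ a, Holds (Fin.snoc (v ∘ s) x : Fin (n + 1) → K') a ↔ Holds t a) := by
    intro K' _ _ hK' v
    simp only [φ, Formula.Realize, BoundedFormula.realize_ex, realize_diagramFormula hK']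
    refine exists_congr fun x => forall_congr' fun a => ?_
    suffices (fun i => (ts i).realize (Sum.elim v (Fin.snoc default x))) =
      (Fin.snoc (v ∘ s) x : Fin (n + 1) → K') by rw [this]
    funext i
    induction i using Fin.lastCases with
    | last => simp [ts]; rfl
    | cast i => simp [ts]
  have h1 := (hT.complete N hfeq N N' hN hN' (Embedding.refl feqLang N)
    (g.comp (baseEmbedding hFN)) φ).2 (by
      rw [hφ N' hFN']
      refine ⟨g y, fun a => ?_⟩
      rw [← holds_embedding hFG hFN' g t a]
      suffices (Fin.snoc ((g.comp (baseEmbedding hFN)) ∘ s) (g y) : Fin (n + 1) → N') = g ∘ t by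
        rw [this]
      simp only [t, Fin.comp_snoc]
      rfl)
  rw [hφ N hFN] at h1
  obtain ⟨x, hx⟩ := h1
  exact ⟨x, (atomVal_eq_iff _ _).2 hx⟩

end ModelCompletion

/-! ### An array in a generic structure -/

/-- A parametrized equivalence relation as a real-valued structure. -/
noncomputable def feqRVStructure (X : Type u) [Feq X] [hX : Nonempty X] :
    RVStructure.{u} (withDist feqLang) where
  carrier := X
  nonempty := hX
  funMap F := Empty.elim F
  relMap {n} R xs := match n, R, xs with
    | _, Sum.inl FeqRel.P, xs => Feq.atomVal xs (.inl (.inl id))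
    | _, Sum.inl FeqRel.Q, xs => Feq.atomVal xs (.inl (.inr id))
    | _, Sum.inl FeqRel.E, xs => Feq.atomVal xs (.inr (.inl id))
    | _, Sum.inr .dist, xs => Feq.atomVal xs (.inr (.inr id))

theorem represents_feqRVStructure (X : Type u) [Feq X] [Nonempty X] :
    Represents (feqRVStructure X) (id : X → X) := by
  refine ⟨Function.surjective_id, ?_⟩
  funext a
  rcases a with (a | a) | (a | a) <;> rfl

/-- The index set of an array of objects, with one parameter for each row. -/
inductive ArrayBase : Type u
  | param (n : ℕ) : ArrayBase
  | obj (n m : ℕ) : ArrayBase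

namespace ArrayBase

/-- Being a parameter. -/
def isParam : ArrayBase.{u} → Prop
  | param _ => True
  | obj _ _ => False

/-- All parameters induce the equality of objects. -/
instance : Feq ArrayBase.{u} where
  P := isParam
  E z x y := isParam z ∧ ¬ isParam x ∧ x = y
  dom := by
    rintro z x _ ⟨h, h', rfl⟩
    exact ⟨h, h', h'⟩
  refl h h' := ⟨h, h', rfl⟩
  symm := by
    rintro z x _ ⟨h, h', rfl⟩
    exact ⟨h, h', rfl⟩
  trans := by
    rintro z x _ _ ⟨h, h', rfl⟩ ⟨-, -, rfl⟩
    exact ⟨h, h', rfl⟩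

instance : Nonempty ArrayBase.{u} := ⟨param 0⟩

/-- The entries of the array: pairs of the parameter of the row and an object. -/
def entry (n m : ℕ) : Fin 2 → ArrayBase.{u} := ![param n, obj n m]

theorem entry_eq_iff (n m n' m' : ℕ) (r r' : Fin 2) :
    (entry n m r : ArrayBase.{u}) = entry n' m' r' ↔ r = r' ∧ n = n' ∧ (r = 1 → m = m') := by
  fin_cases r <;> fin_cases r' <;> simp [entry]

theorem P_entry_iff (n m : ℕ) (r : Fin 2) : P (entry n m r : ArrayBase.{u}) ↔ r = 0 := by
  change isParam _ ↔ _
  fin_cases r <;> simp [entry, isParam]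

end ArrayBase

open ArrayBase

/-- The generic structure that contains the array. -/
noncomputable abbrev arrayStructure : RVStructure.{u} (withDist feqLang) :=
  haveI : Nonempty (GenericExt ArrayBase.{u}) := ⟨.base (param 0)⟩
  feqRVStructure (GenericExt ArrayBase.{u})

theorem isGeneric_arrayStructure : IsGeneric (GenericExt ArrayBase.{u}) ℵ₀ :=
  GenericExt.isGeneric.mono Cardinal.aleph0_lt_aleph_one.le

theorem represents_arrayStructure :
    Represents arrayStructure.{u} (id : GenericExt ArrayBase.{u} → _) :=
  haveI : Nonempty (GenericExt ArrayBase.{u}) := ⟨.base (param 0)⟩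
  represents_feqRVStructure _

/-- The truth values of formulas at elements of the array depend on equalities only. -/
theorem val_eq_of_array {α : Type*} (ψ : CFormula (withDist feqLang) α 0)
    (v v' : α → ArrayBase.{u}) (h : ∀ a b, v a = v b ↔ v' a = v' b) (hP : ∀ a, P (v a) ↔ P (v' a)) :
    arrayStructure.val ψ (fun a => GenericExt.base (v a)) =
      arrayStructure.val ψ (fun a => GenericExt.base (v' a)) := by
  have hR : IsPartIso (Set.range fun a : ψ.freeVars =>
      (GenericExt.base (v a), GenericExt.base (v' a))) := by
    rw [isPartIso_range_iff, ← atomVal_eq_iff]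
    refine (atomVal_base fun a : ψ.freeVars => v a).symm.trans
      (Eq.trans ?_ (atomVal_base fun a : ψ.freeVars => v' a))
    rw [atomVal_eq_iff]
    intro a
    rcases a with (a | a) | (a | a)
    · exact hP _
    · exact not_congr (hP _)
    · exact and_congr (hP _) (and_congr (not_congr (hP _)) (h _ _))
    · exact h _ _
  exact value_eq_of_isPartIso represents_arrayStructure represents_arrayStructure
    isGeneric_arrayStructure isGeneric_arrayStructure ψ hR (Set.finite_range _) _ _ _ _
    (fun a ha => ⟨⟨a, ha⟩, rfl⟩) fun i => i.elim0

/-! ### The continuous theory of the model completion -/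

section Theory

variable {T : feqLang.Theory}

/-- All models of a theory of generic structures have the same continuous theory. -/
theorem continuousTheory_eq (hT : IsGenericTheory.{u} T)
    (hex : ∃ (K : Type u) (_ : feqLang.Structure K) (_ : Nonempty K), K ⊨ T) :
    continuousTheory.{u} T = arrayStructure.{u}.theory := by
  have key : ∀ (K : Type u) [feqLang.Structure K] [Nonempty K], K ⊨ T →
      ∀ φ : CSentence (withDist feqLang),
        (discreteStructure feqLang K).val φ Empty.elim = arrayStructure.{u}.val φ Empty.elim := by
    intro K _ _ hK φ
    obtain ⟨_, hFK, hgen⟩ := hT K hK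
    exact value_eq_of_isPartIso hFK.represents represents_arrayStructure hgen
      isGeneric_arrayStructure φ (R := ∅) ⟨by simp, by simp, by simp⟩ Set.finite_empty _ _ _ _
      (fun a => a.elim) fun i => i.elim0
  ext φ
  constructor
  · intro h
    obtain ⟨K, _, _, hK⟩ := hex
    exact (key K hK φ).symm.trans (h K hK)
  · exact fun h K _ _ hK => (key K hK φ).trans h

/-- The discrete metric, with trivial moduli of uniform continuity. -/
def discreteSignature : MetricSignature (withDist feqLang) where
  dist := Sum.inr DistSymbol.dist
  funMod _ _ := 1
  relMod _ _ := 1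
  funMod_pos _ _ _ := one_pos
  relMod_pos _ _ _ := one_pos

theorem isMetric_feqRVStructure (X : Type u) [Feq X] [Nonempty X] :
    discreteSignature.IsMetric (feqRVStructure X) := by
  classical
  have hd : ∀ a b : X, discreteSignature.d (feqRVStructure X) a b = if a = b then 0 else 1 := by
    intro a b
    change ((Feq.atomVal ![a, b] (.inr (.inr id)) : unitInterval) : ℝ) = _
    by_cases h : a = b <;> simp [Feq.atomVal, Holds, h]
  have hlt : ∀ a b : X, discreteSignature.d (feqRVStructure X) a b < 1 → a = b := by
    intro a b h
    by_contra hne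
    rw [hd, if_neg hne] at h
    exact lt_irrefl _ h
  refine { d_self := ?_, d_comm := ?_, d_triangle := ?_, fun_modulus := ?_, rel_modulus := ?_,
           eq_of_d_eq_zero := ?_, complete := ?_ }
  · exact fun a => (hd a a).trans (if_pos rfl)
  · intro (a : X) (b : X)
    rw [hd, hd]
    exact if_congr eq_comm rfl rfl
  · intro (a : X) (b : X) (c : X)
    rw [hd, hd, hd]
    by_cases hab : a = b
    · simp [hab]
    · rw [if_neg hab]
      split_ifs <;> norm_num
  · exact fun F => Empty.elim F
  · intro n R ε hε x y h
    have : x = y := funext fun i => hlt _ _ (h i)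
    rw [this]
    simpa using hε.le
  · exact fun a b h => hlt a b (h.trans_lt one_pos)
  · intro s hs
    obtain ⟨N, hN⟩ := hs 1 one_pos
    refine ⟨s N, fun ε hε => ⟨N, fun n hn => ?_⟩⟩
    have : s n = s N := hlt _ _ (hN n hn N le_rfl)
    rw [this]
    exact ((hd (s N) (s N)).trans (if_pos rfl)).trans_lt hε

/-- The witness is `E(z, x, y)`, with one parameter `z` for each row and with objects that are
pairwise inequivalent for all these parameters. -/
theorem isTP₂_of_isGenericTheory (hT : IsGenericTheory.{u} T)
    (hex : ∃ (K : Type u) (_ : feqLang.Structure K) (_ : Nonempty K), K ⊨ T) :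
    IsTP₂.{u} (continuousTheory.{u} T) := by
  -- the formula `E(y₀, x, y₁)`
  let φ : CFormula (withDist feqLang) (Fin 1 ⊕ Fin 2) 0 :=
    .atom (Sum.inl FeqRel.E) fun k => .var (.inl ((![.inr 0, .inl 0, .inr 1] : Fin 3 → _) k))
  let b : ℕ → ℕ → Fin 2 → GenericExt ArrayBase.{u} := fun n m r => .base (entry n m r)
  have hφ : ∀ (x : Fin 1 → GenericExt ArrayBase.{u}) (n m : ℕ),
      arrayStructure.{u}.val φ (Sum.elim x (b n m)) = 0 ↔
        E (GenericExt.base (param n)) (x 0) (GenericExt.base (obj n m)) := by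
    intro x n m
    change Feq.atomVal (fun k => Sum.elim x (b n m) ((![.inr 0, .inl 0, .inr 1] : Fin 3 → _) k))
      (.inr (.inl id)) = 0 ↔ _
    rw [Feq.atomVal]
    split_ifs with h
    · exact iff_of_true rfl h
    · exact iff_of_false one_ne_zero h
  refine ⟨arrayStructure, ?_, ?_, 1, 2, φ, b, ?_, ?_, ?_, ?_⟩
  · rw [continuousTheory_eq hT hex]
    exact fun φ h => h
  · exact represents_arrayStructure.isSaturated Cardinal.aleph0_lt_aleph_one.le
      GenericExt.isGeneric
  · intro n k i j hi hj ψ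
    let B : Set arrayStructure.{u} := {a | ∃ n' m r, n' ≠ n ∧ a = b n' m r}
    have hB : ∀ a : B, ∃ n' m r, n' ≠ n ∧ a.1 = GenericExt.base (entry n' m r) := fun a => a.2
    choose n' m' r' hn' he using hB
    have e : ∀ i : Fin k → ℕ, (Sum.elim (fun a => a.1) fun x => b n (i x.1) x.2 :
          B ⊕ (Fin k × Fin 2) → arrayStructure.{u}) =
        fun x => GenericExt.base (Sum.elim (fun a => entry (n' a) (m' a) (r' a))
          (fun x => entry n (i x.1) x.2) x) := by
      intro i
      funext x
      rcases x with x | x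
      · exact he x
      · rfl
    refine (congrArg _ (e i)).trans ((val_eq_of_array ψ _ _ ?_ ?_).trans (congrArg _ (e j)).symm)
    · rintro (x | x) (y | y)
      · exact Iff.rfl
      · simp [entry_eq_iff, hn']
      · simp [entry_eq_iff, (hn' _).symm]
      · simp [entry_eq_iff, hi.injective.eq_iff, hj.injective.eq_iff]
    · rintro (x | x)
      · exact Iff.rfl
      · simp [P_entry_iff]
  · intro k i j hi hj ψ
    refine val_eq_of_array ψ (fun x => entry (i x.1) x.2.1 x.2.2)
      (fun x => entry (j x.1) x.2.1 x.2.2) (fun x y => ?_) fun x => ?_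
    · simp [entry_eq_iff, hi.injective.eq_iff, hj.injective.eq_iff]
    · simp [P_entry_iff]
  · rintro n ⟨x, hx⟩
    have h := trans (symm ((hφ x n 0).1 (hx 0))) ((hφ x n 1).1 (hx 1))
    rw [GenericExt.base_E] at h
    have h' : obj n 0 = obj n 1 := h.2.2
    injection h' with _ h'
    exact zero_ne_one h'
  · intro f
    have hinj : Function.Injective fun n =>
        (GenericExt.base (param n) : GenericExt ArrayBase.{u}) :=
      fun n n' h => by
        have := GenericExt.base_injective h
        injection this
    have hcount : #(Set.range fun n => (GenericExt.base (param n) : GenericExt ArrayBase.{u})) <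
        ℵ₁ := by
      rw [Cardinal.lt_aleph_one_iff, Cardinal.le_aleph0_iff_set_countable]
      exact Set.countable_range _
    have hempty : #(∅ : Set (GenericExt ArrayBase.{u})) < ℵ₁ := by simp
    obtain ⟨x, -, -, hx, -⟩ := GenericExt.isGeneric.obj _ ∅ ∅
      (Function.extend _ (fun n => GenericExt.base (obj n (f n))) id) hcount hempty hempty
      (by rintro _ ⟨n, rfl⟩; exact trivial) (by simp) (by simp)
      (by
        rintro _ ⟨n, rfl⟩
        rw [hinj.extend_apply]
        exact id)
    refine ⟨fun _ => x, fun n => (hφ _ _ _).2 ?_⟩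
    have := hx _ ⟨n, rfl⟩
    rwa [hinj.extend_apply] at this

end Theory

end ContModel

theorem mainTheorem7 :
    (∃ Tfeq : ContModel.feqLang.Theory,
      ContModel.IsModelCompletion.{u} ContModel.feqTheory Tfeq) ∧
    ∀ Tfeq : ContModel.feqLang.Theory,
      ContModel.IsModelCompletion.{u} ContModel.feqTheory Tfeq →
      ContModel.IsMetricTheory.{u} (ContModel.continuousTheory.{u} Tfeq) ∧
      ContModel.IsTP₂.{u} (ContModel.continuousTheory.{u} Tfeq) ∧
      ∀ (L : FirstOrder.Language.{0, 0}), Countable L.Symbols →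
        ∀ T : ContModel.CTheory L, ContModel.IsMetricTheory.{u} T → ContModel.IsTP₂.{u} T →
          ContModel.TriangleLE.{u} (ContModel.continuousTheory.{u} Tfeq) T := by
  refine ⟨⟨_, ContModel.isModelCompletion_genericTheory⟩, fun Tfeq h => ?_⟩
  have hT := h.isGenericTheory
  have hex : ∃ (K : Type u) (_ : ContModel.feqLang.Structure K) (_ : Nonempty K), K ⊨ Tfeq := by
    let _ := ContModel.feqStructure ContModel.ArrayBase.{u}
    obtain ⟨N, sN, hN, ⟨f⟩⟩ := h.embeds ContModel.ArrayBase.{u}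
      (ContModel.isFeqModel_feqStructure _).model
    exact ⟨N, sN, ⟨f (Classical.arbitrary _)⟩, hN⟩
  refine ⟨⟨ContModel.discreteSignature, ContModel.arrayStructure, ?_,
    ContModel.continuousTheory_eq hT hex⟩, ContModel.isTP₂_of_isGenericTheory hT hex, ?_⟩
  · have : Nonempty (ContModel.GenericExt ContModel.ArrayBase.{u}) := ⟨.base (.param 0)⟩
    exact ContModel.isMetric_feqRVStructure _
  · intro L _ T _ hTP I _ D hreg hsat
    exact (hTP.goodForEquality hreg hsat).saturates hreg hT
      ⟨_, _, ContModel.isGeneric_arrayStructure⟩
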